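/- Messages $n\in\mathbb Z$ arrive at the points $T_n$ of a Poisson process on $\mathbb R$ of rate $\lambda>0$ ($T_n<T_{n+1}$, $T_0\le 0<T_1$). Message $n$ has size (service time) $\sigma_n$; the $\sigma_n$ are i.i.d. with distribution $G$, independent of the arrivals, where $G((-\infty,0])=0$ and $\int_0^\infty x\,dG(x)<\infty$; let $\hat G(s)=\int_0^\infty e^{-sx}\,dG(x)$. Message $n$ leaves at time $T_n+\Delta_n$, and $\psi_n=1$ if it leaves because it has been completely processed (it is then called successful), $\psi_n=0$ otherwise. There is a single server, no service preemption, one cell for the message being processed and one cell for a stored message. A message finding the server idle is processed at once. In $\mathcal B_2$ a message finding the server busy is stored if the storage cell is empty and is immediately rejected ($\Delta_n=0$) if it is not. In $\mathcal P_2$ a message finding the server busy is always stored, and the previously stored message, if any, is pushed out and leaves at that moment. At the end of a service the stored message, if any, enters service. The number of messages in the system at time $t$ is $\xi(t)=\#\{n: T_n\le t<T_n+\Delta_n\}$, and the successful departure epochs $\{T_n+\Delta_n:\psi_n=1\}$ are enumerated increasingly as $(S_n)_{n\in\mathbb Z}$ with $S_0\le 0<S_1$. Consider each of the two systems in a stationary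 version under a probability $\mathbb P$: the arrival process marked by $(\sigma_n,\Delta_n,\psi_n)$ is stationary, and the system is non-anticipating, i.e. for each $t$ what has happened up to time $t$ (arrival times and sizes of the messages that arrived, departures and successes that occurred) is independent of the arrival times and sizes of the messages arriving after $t$. Let $\mathbb P^0$ be the Palm probability of $\mathbb P$ with respect to $\{S_n\}$ and $K_n=\xi(S_n)$. Then, for both $\mathcal B_2$ and $\mathcal P_2$, almost surely the $S_n$ can be enumerated as above, $\mathbb P^0$ is a well-defined probability measure, and: (i) $\xi$ is a semi-Markov process with respect to the points $S_n$: there is a family of probability laws $(\kappa_i)$, the same for all $n$ and for both systems, such that, conditionally on the past seen from $S_n$, namely $(S_n-S_{n-k},K_{n-k})_{k\ge0}$ and $(\xi(S_n-u))_{u\ge0}$, the future $\big((S_{n+k}-S_n,K_{n+k})_{k\ge0},(\xi(S_n+u))_{u\ge0}\big)$ has law $\kappa_{K_n}$. This holds under $\mathbb P^0$ for all $n\in\mathbb Z$, and under $\mathbb P$ for all $n\ge1$, in the latter case also when the value of $S_n$ is added to the past. (ii) The process $(\xi(t))_{t\in\mathbb R}$ has the same law under $\mathbb P$ in $\mathcal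 B_2$ as in $\mathcal P_2$. (iii) Under $\mathbb P^0$ the random variables $K_n$, $n\in\mathbb Z$, are i.i.d. Bernoulli with $\mathbb P^0(K_n=0)=\hat G(\lambda)=1-\mathbb P^0(K_n=1)$. -/

import Mathlib

open MeasureTheory ProbabilityTheory Set Filter
open scoped ENNReal NNReal

noncomputable section

namespace AoI

/-- One realisation of a message processing system on the whole time axis. Message `n : ℤ` arrives
at time `T n`, has size `size n`, leaves the system at time `T n + Δ n`, and `ψ n` says whether
it leaves because it has been processed in its entirety. -/
structure MessageFlow where
  T : ℤ → ℝ
  size : ℤ → ℝ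
  Δ : ℤ → ℝ
  ψ : ℤ → Prop

namespace MessageFlow

/-- The sequence of arrival times marked by size, sojourn time and success. -/
def marked (x : MessageFlow) (n : ℤ) : ℝ × ℝ × ℝ × Prop :=
  (x.T n, x.size n, x.Δ n, x.ψ n)

/-- The product σ-algebra: all the coordinates are measurable. -/
instance : MeasurableSpace MessageFlow := MeasurableSpace.comap marked inferInstance

/-- The departure time of message `n`. -/
def dep (x : MessageFlow) (n : ℤ) : ℝ := x.T n + x.Δ n

/-- Message `n` is in the system at time `t`. -/
def InSystem (x : MessageFlow) (n : ℤ) (t : ℝ) : Prop := x.T n ≤ t ∧ t < x.dep n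

/-- Message `n` is being processed at time `t`. There is no service preemption, so the processing
of a successful message occupies the last `size n` time units of its stay; the messages which are
not successful are never processed. -/
def InService (x : MessageFlow) (n : ℤ) (t : ℝ) : Prop :=
  x.ψ n ∧ x.dep n - x.size n ≤ t ∧ t < x.dep n

/-- Message `n` is stored, but not being processed, at time `t`. -/
def Waiting (x : MessageFlow) (n : ℤ) (t : ℝ) : Prop :=
  x.InSystem n t ∧ ¬ x.InService n t

/-- The number of messages in the system at time `t`. -/
def numInSystem (x : MessageFlow) (t : ℝ) : ℕ := {n : ℤ | x.InSystem n t}.ncard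

/-- Arrival times and sizes as inputs: arrival times increase from `-∞` to `∞`, message `0` is the
last one to arrive up to time `0`, and sizes are positive. -/
structure IsInput (x : MessageFlow) : Prop where
  strictMono : StrictMono x.T
  tendsto_atTop : Tendsto x.T atTop atTop
  tendsto_atBot : Tendsto x.T atBot atBot
  label_nonpos : x.T 0 ≤ 0
  label_pos : 0 < x.T 1
  size_pos : ∀ n, 0 < x.size n

/-- The `B₂` system (one cell for the message being processed, one storage cell, blocking).
A message which finds the server idle is processed at once. If it finds the server busy and the
storage cell empty, it is stored and processed as soon as the current service ends. If it finds
the buffer full it is rejected at once. -/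
def IsB2 (x : MessageFlow) : Prop :=
  ∀ n : ℤ,
    ((∀ m < n, ¬ x.InService m (x.T n)) → x.ψ n ∧ x.dep n = x.T n + x.size n) ∧
    (∀ m < n, x.InService m (x.T n) →
      ((∀ l < n, ¬ x.Waiting l (x.T n)) → x.ψ n ∧ x.dep n = x.dep m + x.size n) ∧
      ((∃ l < n, x.Waiting l (x.T n)) → ¬ x.ψ n ∧ x.dep n = x.T n))

/-- The `P₂` system (one cell for the message being processed, one storage cell, push-out).
A message which finds the server idle is processed at once. If it finds the server busy it takes
the storage cell, pushing out the message stored there, if any. It is processed as soon as the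
current service ends, unless the next message arrives before that time; in that case it is pushed
out at the arrival of the next message. -/
def IsP2 (x : MessageFlow) : Prop :=
  ∀ n : ℤ,
    ((∀ m < n, ¬ x.InService m (x.T n)) → x.ψ n ∧ x.dep n = x.T n + x.size n) ∧
    (∀ m < n, x.InService m (x.T n) →
      (x.dep m ≤ x.T (n + 1) → x.ψ n ∧ x.dep n = x.dep m + x.size n) ∧
      (x.T (n + 1) < x.dep m → ¬ x.ψ n ∧ x.dep n = x.T (n + 1)))

/-- The label of the last message arriving in `(-∞, t]`. -/
def lastArrival (x : MessageFlow) (t : ℝ) : ℤ := sSup {n : ℤ | x.T n ≤ t}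

/-- The realisation seen from time `t`: `t` becomes the new origin of time, and messages are
relabelled accordingly. -/
def shift (t : ℝ) (x : MessageFlow) : MessageFlow where
  T n := x.T (x.lastArrival t + n) - t
  size n := x.size (x.lastArrival t + n)
  Δ n := x.Δ (x.lastArrival t + n)
  ψ n := x.ψ (x.lastArrival t + n)

/-- What has happened up to time `0`: arrival times and sizes of the messages that have arrived,
and, for the messages that have left, when they left and whether they were successful. -/
def history (x : MessageFlow) (k : ℕ) : ℝ × ℝ × ℝ × Prop :=
  (x.T (-k), x.size (-k), min (x.dep (-k)) 0, x.ψ (-k) ∧ x.dep (-k) ≤ 0)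

/-- The arrival times and sizes of the messages arriving after time `0`. -/
def futureInput (x : MessageFlow) (k : ℕ) : ℝ × ℝ := (x.T (k + 1), x.size (k + 1))

/-- Distances between successive elements of `{T n} ∪ {0}`, to the right (`inl`) and to
the left (`inr`) of the origin. -/
def gap (x : MessageFlow) : ℕ ⊕ ℕ → ℝ
  | .inl k => x.T (k + 1) - (if k = 0 then 0 else x.T k)
  | .inr k => (if k = 0 then 0 else x.T (1 - k)) - x.T (-k)

end MessageFlow

/-- `s` enumerates the set `A` increasingly, with `0 ∈ [s 0, s 1)`. -/
def IsEnumeration (A : Set ℝ) (s : ℤ → ℝ) : Prop :=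
  StrictMono s ∧ range s = A ∧ s 0 ≤ 0 ∧ 0 < s 1

open Classical in
/-- The (unique) increasing enumeration of `A` with `0 ∈ [s 0, s 1)`, if there is one. -/
def enumeration (A : Set ℝ) : ℤ → ℝ :=
  if h : ∃ s, IsEnumeration A s then h.choose else 0

/-- The set of successful departure epochs. -/
def MessageFlow.successEpochs (x : MessageFlow) : Set ℝ := {t | ∃ n, x.ψ n ∧ x.dep n = t}

section Random

variable {Ω : Type*} [MeasurableSpace Ω]

/-- The input of the system: the arrival times form a Poisson process on `ℝ` with rate `lam`
(the distances from the origin to the nearest points on both sides and the distances between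
successive points on either side of the origin are i.i.d. exponential), and the sizes are
i.i.d. with distribution `G`, independent of the arrival process. -/
structure IsPoissonInput (P : Measure Ω) (X : Ω → MessageFlow) (lam : ℝ) (G : Measure ℝ) :
    Prop where
  isInput : ∀ᵐ ω ∂P, (X ω).IsInput
  gap_indep : iIndepFun (fun i ω => (X ω).gap i) P
  gap_law : ∀ i, HasLaw (fun ω => (X ω).gap i) (expMeasure lam) P
  size_indep : iIndepFun (fun n ω => (X ω).size n) P
  size_law : ∀ n, HasLaw (fun ω => (X ω).size n) G P
  indep : IndepFun (fun ω => (X ω).T) (fun ω => (X ω).size) P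

/-- The system with its arrivals is stationary, and it runs forward in time: what happens up to
time `0` (by stationarity: up to any time) does not anticipate the messages that arrive
afterwards. -/
structure IsStationarySystem (P : Measure Ω) (X : Ω → MessageFlow) (lam : ℝ) (G : Measure ℝ) :
    Prop where
  measurable : Measurable X
  input : IsPoissonInput P X lam G
  stationary : ∀ t : ℝ, IdentDistrib (fun ω => (X ω).shift t) X P P
  nonanticipating : IndepFun (fun ω => (X ω).history) (fun ω => (X ω).futureInput) P

/-- The process `ξ(t)`. -/
def xi (X : Ω → MessageFlow) (t : ℝ) (ω : Ω) : ℕ := (X ω).numInSystem t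

/-- The successful departure epochs `S n`, in increasing order, with `S 0 ≤ 0 < S 1`. -/
def S (X : Ω → MessageFlow) (n : ℤ) (ω : Ω) : ℝ := enumeration (X ω).successEpochs n

/-- The value of the process `Z` at the point `s n`. -/
def embedded (s : ℤ → Ω → ℝ) (Z : ℝ → Ω → ℕ) (n : ℤ) (ω : Ω) : ℕ := Z (s n ω) ω

/-- What is observed up to the point `s n`, seen from `s n`: the previous points, the embedded
values there, and the path of `Z` up to `s n`. -/
def past (s : ℤ → Ω → ℝ) (Z : ℝ → Ω → ℕ) (n : ℤ) (ω : Ω) : (ℕ → ℝ × ℕ) × (ℝ≥0 → ℕ) :=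
  (fun k => (s n ω - s (n - k) ω, embedded s Z (n - k) ω), fun u => Z (s n ω - u) ω)

/-- What is observed from the point `s n` on, seen from `s n`: the next points, the embedded
values there, and the path of `Z` from `s n` on. -/
def future (s : ℤ → Ω → ℝ) (Z : ℝ → Ω → ℕ) (n : ℤ) (ω : Ω) : (ℕ → ℝ × ℕ) × (ℝ≥0 → ℕ) :=
  (fun k => (s (n + k) ω - s n ω, embedded s Z (n + k) ω), fun u => Z (s n ω + u) ω)

/-- The state at the last observed point; on `past s Z n ω` its value is `Z (s n)`. -/
def present (p : (ℕ → ℝ × ℕ) × (ℝ≥0 → ℕ)) : ℕ := p.2 0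

lemma measurable_present : Measurable present :=
  (measurable_pi_apply (0 : ℝ≥0)).comp measurable_snd

/-- The state at the last observed point, when its position is observed as well. -/
def presentAt (p : ℝ × ((ℕ → ℝ × ℕ) × (ℝ≥0 → ℕ))) : ℕ := present p.2

lemma measurable_presentAt : Measurable presentAt :=
  measurable_present.comp measurable_snd

/-- The process `Z` is semi-Markov with respect to the points `s n`, `n ∈ ℤ`, with transition law
`κ`: given all that is observed up to the point `s n`, the future from `s n` on has
distribution `κ (Z (s n))`, which depends only on the state `Z (s n)`. In particular
`(s n, Z (s n))` is a Markov renewal sequence. -/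
def IsSemiMarkov (Q : Measure Ω) (s : ℤ → Ω → ℝ) (Z : ℝ → Ω → ℕ)
    (κ : Kernel ℕ ((ℕ → ℝ × ℕ) × (ℝ≥0 → ℕ))) : Prop :=
  ∀ n : ℤ, HasCondDistrib (future s Z n) (past s Z n) (κ.comap present measurable_present) Q

/-- The same property at the points `s n > 0`, the positions of these points in absolute time
being observed as well. -/
def IsSemiMarkovAfterZero (Q : Measure Ω) (s : ℤ → Ω → ℝ) (Z : ℝ → Ω → ℕ)
    (κ : Kernel ℕ ((ℕ → ℝ × ℕ) × (ℝ≥0 → ℕ))) : Prop :=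
  ∀ n : ℤ, 1 ≤ n → HasCondDistrib (future s Z n) (fun ω => (s n ω, past s Z n ω))
    (κ.comap presentAt measurable_presentAt) Q

/-- The Palm probability with respect to the points `s n`, realised on pairs of an outcome and a
point: `P⁰(A) = E[#{m : s m ∈ (0,1], (ω, m) ∈ A}] / E[#{m : s m ∈ (0,1]}]`. A pair `(ω, m)` stands
for the outcome `ω` seen from the point `s m`. -/
def palm (P : Measure Ω) (s : ℤ → Ω → ℝ) : Measure (Ω × ℤ) :=
  (∑' m : ℤ, P {ω | s m ω ∈ Ioc 0 1})⁻¹ •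
    Measure.sum fun m : ℤ => (P.restrict {ω | s m ω ∈ Ioc 0 1}).map fun ω => (ω, m)

/-- The points seen from the point at the origin of the Palm probability. -/
def palmPoints (s : ℤ → Ω → ℝ) (n : ℤ) (p : Ω × ℤ) : ℝ := s (p.2 + n) p.1 - s p.2 p.1

/-- A process seen from the point at the origin of the Palm probability. -/
def palmProcess (s : ℤ → Ω → ℝ) (Z : ℝ → Ω → ℕ) (t : ℝ) (p : Ω × ℤ) : ℕ :=
  Z (s p.2 p.1 + t) p.1

/-- The chain `K n = ξ(S n)` on the space of the Palm probability. -/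
def K (X : Ω → MessageFlow) : ℤ → Ω × ℤ → ℕ :=
  embedded (palmPoints (S X)) (palmProcess (S X) (xi X))

/-- The process `ξ` is semi-Markov with respect to the successful departure epochs, under the Palm
probability at all epochs and under `P` at the epochs after time `0`. The successful departure
epochs can be enumerated as required, and the Palm probability is well defined. -/
structure XiIsSemiMarkov (P : Measure Ω) (X : Ω → MessageFlow)
    (κ : Kernel ℕ ((ℕ → ℝ × ℕ) × (ℝ≥0 → ℕ))) : Prop where
  enumerated : ∀ᵐ ω ∂P, IsEnumeration (X ω).successEpochs (fun n => S X n ω)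
  palm_prob : IsProbabilityMeasure (palm P (S X))
  under_palm : IsSemiMarkov (palm P (S X)) (palmPoints (S X)) (palmProcess (S X) (xi X)) κ
  under_P : IsSemiMarkovAfterZero P (S X) (xi X) κ

/-- Under the Palm probability the `K n` are i.i.d. with `P⁰(K n = 0) = q = 1 - P⁰(K n = 1)`. -/
structure EmbeddedIsBernoulli (P : Measure Ω) (X : Ω → MessageFlow) (q : ℝ) : Prop where
  indep : iIndepFun (K X) (palm P (S X))
  zero : ∀ n, (palm P (S X)).real {p | K X n p = 0} = q
  one : ∀ n, (palm P (S X)).real {p | K X n p = 1} = 1 - q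

end Random

/-- The Laplace transform of a measure on `(0, ∞)`. -/
def laplace (G : Measure ℝ) (u : ℝ) : ℝ := ∫ x in Ioi 0, Real.exp (-u * x) ∂G

end AoI

end

/-! Everything is read off the sequence of services. To service `i` belong its beginning, the time
`A_i` from then to the first later arrival, and its duration `σ_i`. In both systems the next service
begins at the end of service `i` or at that arrival, whichever is later. Between the two beginnings
the system holds 2, 1 or 0 messages, depending only on whether the arrival has come and whether the
service has ended: the storage cell holds exactly one message from that arrival to the end of the
service, whichever message it is. So `ξ` and the points `S_n` are the same functionals of the
services in both systems (`Regular.numInSystem_eq`, `Regular.isEnumeration`). The policies differ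
only in the message served next: the first to arrive under blocking, the last to be stored under
push-out.

The marks `(A_i, σ_i)` are i.i.d. with law exponential times `G`. The environment of a service
consists of its duration and of the gaps and sizes of the arrivals from its beginning on; the next
environment is obtained by stopping the arrivals when the next service begins. By memorylessness the
gap running at that moment has a fresh exponential remainder. The message chosen depends on arrival
times but not on sizes, so its size still has law `G`, independent of what arrives later. This is
`map_cycleStep`; iterating it gives `map_cycleSeq`.

In the stationary system the state at time `0` is a function of the history
(`Regular.exists_level`), and the later arrivals are independent of the history. Locate each service
at its first later arrival. Then the marks that follow a service located in `(0, 1]` are i.i.d., up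
to a finite constant (`IsStationarySystem.isCycleFlow`). Stationarity makes the choice of location
immaterial (`IsCycleFlow.lintegral_eq_of_location`), so the law of the marks seen from a location is
shift invariant, hence i.i.d. on all of `ℤ` (`IsCycleFlow.marksMeasure_eq`). The services with a
distinguished one are thus distributed as i.i.d. marks placed according to Lebesgue measure, times a
constant which the total mass of `P` determines (`IsCycleFlow.intensity_spec`). It follows that the
law of the services under `P` is the same for both systems (`IsCycleFlow.map_eq`), and that under
the Palm probability the marks are i.i.d. (`IsCycleFlow.map_palmServices`).

It remains to study i.i.d. marks. `K_n` is the indicator of `A_n ≤ σ_n`, which gives the Bernoulli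
law. The past at `S_n` involves `A_n` only if `A_n ≤ σ_n`; the future involves the positive part of
`A_n - σ_n` and the later marks. Given `A_n > σ_n` this difference is a fresh exponential variable,
so past and future communicate through `K_n` alone (`lintegral_servicesPast_servicesFuture_zero`).
Under `P` the inversion formula adds a weight which, for `n ≥ 1`, is a function of the past
(`IsCycleFlow.lintegral_after_zero`). -/

noncomputable section

namespace AoI

/-! ### I.i.d. sequences built one element at a time. -/

section SequenceSpace

/-- Prepend an element to a sequence. -/
def scons {α : Type*} (x : α) (D : ℕ → α) : ℕ → α
  | 0 => x
  | k + 1 => D k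

@[simp] lemma scons_zero {α : Type*} (x : α) (D : ℕ → α) : scons x D 0 = x := rfl

@[simp] lemma scons_succ {α : Type*} (x : α) (D : ℕ → α) (k : ℕ) : scons x D (k + 1) = D k := rfl

lemma pi_range_succ_preimage_scons {α : Type*} (n : ℕ) (t : ℕ → Set α) :
    (fun p : α × (ℕ → α) => scons p.1 p.2) ⁻¹' Set.pi (Finset.range (n + 1) : Set ℕ) t
      = t 0 ×ˢ Set.pi (Finset.range n : Set ℕ) fun i => t (i + 1) := by
  ext ⟨x, D⟩
  simp only [mem_preimage, Set.mem_pi, Finset.mem_coe, Finset.mem_range, mem_prod]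
  constructor
  · intro h
    exact ⟨h 0 (by omega), fun i hi => h (i + 1) (by omega)⟩
  · rintro ⟨h0, h⟩ i hi
    cases i with
    | zero => exact h0
    | succ i => exact h i (by omega)

variable {α : Type*} [MeasurableSpace α]

lemma measurable_scons : Measurable fun p : α × (ℕ → α) => scons p.1 p.2 := by
  refine measurable_pi_lambda _ fun k => ?_
  cases k with
  | zero => exact measurable_fst
  | succ k => exact (measurable_pi_apply k).comp measurable_snd

@[fun_prop]
lemma Measurable.scons {β : Type*} [MeasurableSpace β] {f : β → α} {g : β → ℕ → α}
    (hf : Measurable f) (hg : Measurable g) : Measurable fun x => AoI.scons (f x) (g x) :=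
  measurable_scons.comp (hf.prodMk hg)

/-- Every finite set of coordinates lies in an initial segment, and the missing coordinates may be
filled with `univ`. Rectangles over initial segments are the sets on which induction by `scons`
works. -/
lemma eq_infinitePi_of_range (μ : Measure α) [IsProbabilityMeasure μ] (Q : Measure (ℕ → α))
    (h : ∀ (n : ℕ) (t : ℕ → Set α), (∀ i, MeasurableSet (t i)) →
      Q (Set.pi (Finset.range n) t) = ∏ i ∈ Finset.range n, μ (t i)) :
    Q = Measure.infinitePi fun _ : ℕ => μ := by
  classical
  refine Measure.eq_infinitePi _ fun s t ht => ?_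
  set n := s.sup id + 1
  have hs : ∀ i ∈ s, i ∈ Finset.range n := fun i hi => by
    have : i ≤ s.sup id := Finset.le_sup (f := id) hi
    simp only [Finset.mem_range, n]; omega
  have h1 : Set.pi (s : Set ℕ) t
      = Set.pi (Finset.range n : Set ℕ) fun i => if i ∈ s then t i else univ := by
    ext D
    simp only [Set.mem_pi, Finset.mem_coe]
    constructor
    · intro hD i _
      by_cases hi : i ∈ s
      · simpa [hi] using hD i hi
      · simp [hi]
    · intro hD i hi
      simpa [hi] using hD i (hs i hi)
  rw [h1, h n _ fun i => by split_ifs; exacts [ht i, MeasurableSet.univ]]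
  have h2 : ∀ i, μ (if i ∈ s then t i else univ) = if i ∈ s then μ (t i) else 1 := by
    intro i; split_ifs <;> simp
  simp_rw [h2]
  rw [← Finset.prod_filter]
  congr 1
  ext i
  simp only [Finset.mem_filter]
  exact ⟨fun h => h.2, fun h => ⟨hs i h, h⟩⟩

lemma infinitePi_map_scons (μ : Measure α) [IsProbabilityMeasure μ] :
    (μ.prod (Measure.infinitePi fun _ : ℕ => μ)).map (fun p => scons p.1 p.2)
      = Measure.infinitePi fun _ : ℕ => μ := by
  refine eq_infinitePi_of_range μ _ fun n t ht => ?_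
  rw [Measure.map_apply measurable_scons
    (MeasurableSet.pi (Finset.countable_toSet _) fun i _ => ht i)]
  cases n with
  | zero => simp
  | succ n =>
    rw [pi_range_succ_preimage_scons, Measure.prod_prod, Measure.infinitePi_pi _ fun i _ => ht _,
      Finset.prod_range_succ', mul_comm]

/-- First-step analysis: an i.i.d. sequence is its first element followed by an independent copy of
itself. The inductions on the number of arrivals or services rest on this. -/
lemma lintegral_infinitePi_scons (μ : Measure α) [IsProbabilityMeasure μ] {F : (ℕ → α) → ℝ≥0∞}
    (hF : Measurable F) :
    ∫⁻ D, F D ∂(Measure.infinitePi fun _ : ℕ => μ)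
      = ∫⁻ x, ∫⁻ D, F (scons x D) ∂(Measure.infinitePi fun _ : ℕ => μ) ∂μ := by
  conv_lhs => rw [← infinitePi_map_scons μ]
  rw [lintegral_map hF measurable_scons, lintegral_prod _ (by fun_prop)]

/-- If a random transformation `Φ` of an environment with law `ν` produces an output with law `μ`
and an independent environment with law `ν`, the successive outputs are i.i.d. -/
lemma map_iterate_eq_infinitePi {ε : Type*} [MeasurableSpace ε] (μ : Measure α)
    [IsProbabilityMeasure μ] (ν : Measure ε) [IsProbabilityMeasure ν] (Φ : ε → α × ε)
    (hΦ : Measurable Φ) (h : ν.map Φ = μ.prod ν) :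
    ν.map (fun e (i : ℕ) => (Φ ((fun e => (Φ e).2)^[i] e)).1)
      = Measure.infinitePi fun _ : ℕ => μ := by
  have hit : ∀ i : ℕ, Measurable (fun e => (Φ e).2)^[i] := fun i => hΦ.snd.iterate i
  have hseq : Measurable fun e (i : ℕ) => (Φ ((fun e => (Φ e).2)^[i] e)).1 :=
    measurable_pi_lambda _ fun i => (hΦ.comp (hit i)).fst
  refine eq_infinitePi_of_range μ _ fun n => ?_
  induction n with
  | zero =>
    intro t _
    rw [Measure.map_apply hseq (MeasurableSet.pi (Finset.countable_toSet _) fun i hi => by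
      simp at hi)]
    simp
  | succ n ih =>
    intro t ht
    have hm : MeasurableSet (Set.pi (Finset.range n : Set ℕ) fun i => t (i + 1)) :=
      MeasurableSet.pi (Finset.countable_toSet _) fun i _ => ht _
    have hm' : MeasurableSet (Set.pi (Finset.range (n + 1) : Set ℕ) t) :=
      MeasurableSet.pi (Finset.countable_toSet _) fun i _ => ht _
    have ih' := ih (fun i => t (i + 1)) fun i => ht _
    rw [Measure.map_apply hseq hm] at ih'
    rw [Measure.map_apply hseq hm']
    -- The rectangle splits into a condition on the first output and one on the outputs computed
    -- from the next environment; `h` makes the two independent.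
    have : (fun e (i : ℕ) => (Φ ((fun e => (Φ e).2)^[i] e)).1) ⁻¹'
        (Set.pi (Finset.range (n + 1) : Set ℕ) t) = Φ ⁻¹' (t 0 ×ˢ
        ((fun e (i : ℕ) => (Φ ((fun e => (Φ e).2)^[i] e)).1) ⁻¹'
          (Set.pi (Finset.range n : Set ℕ) fun i => t (i + 1)))) := by
      ext e
      simp only [mem_preimage, Set.mem_pi, Finset.mem_coe, Finset.mem_range, mem_prod]
      constructor
      · intro h
        exact ⟨h 0 (by omega), fun i hi => h (i + 1) (by omega)⟩
      · rintro ⟨h0, h⟩ i hi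
        cases i with
        | zero => exact h0
        | succ i => exact h i (by omega)
    rw [this, ← Measure.map_apply hΦ ((ht 0).prod (hseq hm)), h, Measure.prod_prod, ih',
      Finset.prod_range_succ', mul_comm]

end SequenceSpace

/-! ### The exponential law: memorylessness and sums of gaps. -/

section Exponential

variable {lam : ℝ}

lemma lintegral_expMeasure {g : ℝ → ℝ≥0∞} (hg : Measurable g) :
    ∫⁻ x, g x ∂(expMeasure lam) = ∫⁻ x, exponentialPDF lam x * g x := by
  have hm : Measurable (exponentialPDF lam) :=
    (measurable_exponentialPDFReal lam).ennreal_ofReal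
  have : expMeasure lam = volume.withDensity (exponentialPDF lam) := rfl
  rw [this, lintegral_withDensity_eq_lintegral_mul _ hm hg]
  rfl

/-- The density at `x + a` is `exp (-(lam * a))` times the density at `x`, and Lebesgue measure is
translation invariant. -/
lemma lintegral_expMeasure_shift {a : ℝ} (ha : 0 ≤ a) {g : ℝ → ℝ≥0∞}
    (hg : Measurable g) :
    ∫⁻ x, (Ici a).indicator (fun x => g (x - a)) x ∂(expMeasure lam)
      = ENNReal.ofReal (Real.exp (-(lam * a))) * ∫⁻ x, g x ∂(expMeasure lam) := by
  have hm : Measurable (exponentialPDF lam) :=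
    (measurable_exponentialPDFReal lam).ennreal_ofReal
  rw [lintegral_expMeasure (Measurable.indicator (by fun_prop) measurableSet_Ici),
    lintegral_expMeasure hg,
    ← lintegral_const_mul _ (show Measurable fun x => exponentialPDF lam x * g x from hm.mul hg),
    ← lintegral_add_right_eq_self _ a]
  refine lintegral_congr fun x => ?_
  by_cases hx : 0 ≤ x
  · rw [indicator_of_mem (by simpa using hx), exponentialPDF_of_nonneg hx,
      exponentialPDF_of_nonneg (by positivity), ← mul_assoc, ← ENNReal.ofReal_mul (by positivity),
      add_sub_cancel_right]
    congr 2
    rw [show -(lam * (x + a)) = -(lam * a) + -(lam * x) by ring, Real.exp_add]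
    ring
  · rw [indicator_of_notMem (by simpa using hx), exponentialPDF_of_neg (x := x) (by simpa using hx)]
    simp

lemma expMeasure_Ici (hlam : 0 < lam) {a : ℝ} (ha : 0 ≤ a) :
    expMeasure lam (Ici a) = ENNReal.ofReal (Real.exp (-(lam * a))) := by
  have := isProbabilityMeasure_expMeasure hlam
  have h := lintegral_expMeasure_shift (lam := lam) ha (g := fun _ => 1) measurable_const
  rwa [lintegral_indicator measurableSet_Ici, setLIntegral_one, lintegral_one, measure_univ,
    mul_one] at h

/-- The exponential distribution is memoryless. -/
lemma lintegral_expMeasure_memoryless (hlam : 0 < lam) {a : ℝ} (ha : 0 ≤ a) {g : ℝ → ℝ≥0∞}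
    (hg : Measurable g) :
    ∫⁻ x, (Ici a).indicator (fun x => g (x - a)) x ∂(expMeasure lam)
      = expMeasure lam (Ici a) * ∫⁻ x, g x ∂(expMeasure lam) := by
  rw [lintegral_expMeasure_shift ha hg, expMeasure_Ici hlam ha]

lemma expMeasure_singleton (a : ℝ) : expMeasure lam {a} = 0 :=
  withDensity_absolutelyContinuous _ _ (measure_singleton a)

lemma expMeasure_Ioi (hlam : 0 < lam) {a : ℝ} (ha : 0 ≤ a) :
    expMeasure lam (Ioi a) = ENNReal.ofReal (Real.exp (-(lam * a))) := by
  rw [← expMeasure_Ici hlam ha, measure_congr (Ioi_ae_eq_Ici' (expMeasure_singleton a))]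

lemma ae_expMeasure_pos (hlam : 0 < lam) : ∀ᵐ x ∂(expMeasure lam), 0 < x := by
  have := isProbabilityMeasure_expMeasure hlam
  have h : expMeasure lam (Ioi 0) = 1 := by rw [expMeasure_Ioi hlam le_rfl]; simp
  exact (prob_compl_eq_zero_iff measurableSet_Ioi).2 h

/-- The Laplace transform of the exponential distribution at `1`. -/
def expRatio (lam : ℝ) : ℝ≥0∞ := ∫⁻ x, ENNReal.ofReal (Real.exp (-x)) ∂(expMeasure lam)

lemma expRatio_lt_one (hlam : 0 < lam) : expRatio lam < 1 := by
  have := isProbabilityMeasure_expMeasure hlam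
  have hlt : ∀ᵐ x ∂(expMeasure lam), ENNReal.ofReal (Real.exp (-x)) < 1 := by
    filter_upwards [ae_expMeasure_pos hlam] with x hx
    rw [← ENNReal.ofReal_one]
    exact (ENNReal.ofReal_lt_ofReal_iff one_pos).2 (by simpa using hx)
  have hfin : ∫⁻ x, ENNReal.ofReal (Real.exp (-x)) ∂(expMeasure lam) ≠ ∞ := by
    refine ne_top_of_le_ne_top ENNReal.one_ne_top ?_
    calc _ ≤ ∫⁻ _, 1 ∂(expMeasure lam) := lintegral_mono_ae (hlt.mono fun _ h => h.le)
      _ = 1 := by simp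
  have := lintegral_strict_mono (IsProbabilityMeasure.ne_zero _) aemeasurable_const hfin hlt
  simpa [expRatio] using this

lemma lintegral_exp_neg_sum (hlam : 0 < lam) (n : ℕ) :
    ∫⁻ E, ENNReal.ofReal (Real.exp (-∑ i ∈ Finset.range n, E i))
      ∂(Measure.infinitePi fun _ : ℕ => expMeasure lam) = expRatio lam ^ n := by
  have := isProbabilityMeasure_expMeasure hlam
  induction n with
  | zero => simp
  | succ n ih =>
    rw [lintegral_infinitePi_scons _ (by fun_prop)]
    have : ∀ x (E : ℕ → ℝ), ENNReal.ofReal (Real.exp (-∑ i ∈ Finset.range (n + 1), scons x E i))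
        = ENNReal.ofReal (Real.exp (-x))
          * ENNReal.ofReal (Real.exp (-∑ i ∈ Finset.range n, E i)) := by
      intro x E
      rw [← ENNReal.ofReal_mul (by positivity), ← Real.exp_add, Finset.sum_range_succ']
      simp [add_comm]
    simp_rw [this]
    simp_rw [lintegral_const_mul _ (show Measurable fun E : ℕ → ℝ =>
      ENNReal.ofReal (Real.exp (-∑ i ∈ Finset.range n, E i)) by fun_prop), ih]
    rw [lintegral_mul_const _ (by fun_prop), pow_succ, mul_comm]
    rfl

/-- Markov's inequality for the exponential of minus the sum. The bound is geometric in `n`, which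
yields both that every level is reached (`ae_exists_le_sum`) and that the expected number of
services located in a unit interval is finite (`tsum_arrAt_le`). -/
lemma infinitePi_exp_sum_lt_le (hlam : 0 < lam) (u : ℝ) (n : ℕ) :
    (Measure.infinitePi fun _ : ℕ => expMeasure lam)
      {E | ∑ i ∈ Finset.range n, E i < u} ≤ ENNReal.ofReal (Real.exp u) * expRatio lam ^ n := by
  have := isProbabilityMeasure_expMeasure hlam
  rw [← lintegral_exp_neg_sum hlam n, ← lintegral_const_mul _ (by fun_prop),
    ← lintegral_indicator_one (measurableSet_lt (by fun_prop) measurable_const)]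
  refine lintegral_mono fun E => ?_
  by_cases h : ∑ i ∈ Finset.range n, E i < u
  · rw [indicator_of_mem (by exact h), ← ENNReal.ofReal_mul (by positivity), ← Real.exp_add]
    simp only [Pi.one_apply, ENNReal.one_le_ofReal, Real.one_le_exp_iff]
    linarith
  · rw [indicator_of_notMem (by exact h)]
    exact zero_le

lemma ae_exists_le_sum (hlam : 0 < lam) (u : ℝ) :
    ∀ᵐ E ∂(Measure.infinitePi fun _ : ℕ => expMeasure lam),
      ∃ n, u ≤ ∑ i ∈ Finset.range (n + 1), E i := by
  have := isProbabilityMeasure_expMeasure hlam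
  rw [ae_iff]
  refine le_antisymm (ge_of_tendsto' (x := atTop)
    (f := fun n => ENNReal.ofReal (Real.exp u) * expRatio lam ^ (n + 1)) ?_ fun n => ?_) zero_le
  · have h := ENNReal.Tendsto.const_mul (a := ENNReal.ofReal (Real.exp u))
      ((ENNReal.tendsto_pow_atTop_nhds_zero_of_lt_one (expRatio_lt_one hlam)).comp
        (tendsto_add_atTop_nat 1)) (Or.inr ENNReal.ofReal_ne_top)
    simpa using h
  · refine (measure_mono fun E hE => ?_).trans (infinitePi_exp_sum_lt_le hlam u (n + 1))
    simp only [not_exists, not_le, mem_ofPred_eq] at hE ⊢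
    exact hE n

end Exponential

end AoI

end

/-! ### From one service to the next: the marks are i.i.d. -/

noncomputable section

namespace AoI

section Residual

variable {lam : ℝ} {G : Measure ℝ}

/-- The first partial sum of the gaps `E` which reaches the level `u` is the one with
index `n`. -/
def Hit (u : ℝ) (E : ℕ → ℝ) (n : ℕ) : Prop :=
  u ≤ ∑ i ∈ Finset.range (n + 1), E i ∧ ∀ k < n, ∑ i ∈ Finset.range (k + 1), E i < u

lemma Hit.unique {u : ℝ} {E : ℕ → ℝ} {n m : ℕ} (hn : Hit u E n) (hm : Hit u E m) : n = m := by
  rcases lt_trichotomy n m with h | h | h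
  · exact absurd hn.1 (not_le.2 (hm.2 n h))
  · exact h
  · exact absurd hm.1 (not_le.2 (hn.2 m h))

lemma exists_hit {u : ℝ} {E : ℕ → ℝ} (h : ∃ n, u ≤ ∑ i ∈ Finset.range (n + 1), E i) :
    ∃ n, Hit u E n := by
  classical
  exact ⟨Nat.find h, Nat.find_spec h, fun k hk => not_le.1 (Nat.find_min h hk)⟩

lemma hit_scons_zero (u e : ℝ) (E : ℕ → ℝ) : Hit u (scons e E) 0 ↔ u ≤ e := by
  simp [Hit]

lemma hit_scons_succ (u e : ℝ) (E : ℕ → ℝ) (n : ℕ) :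
    Hit u (scons e E) (n + 1) ↔ e < u ∧ Hit (u - e) E n := by
  have hs : ∀ k, ∑ i ∈ Finset.range (k + 1), scons e E i = ∑ i ∈ Finset.range k, E i + e := by
    intro k; rw [Finset.sum_range_succ']; rfl
  simp only [Hit, hs]
  constructor
  · rintro ⟨h1, h2⟩
    refine ⟨by simpa using h2 0 (by omega), by linarith, fun k hk => ?_⟩
    have := h2 (k + 1) (by omega)
    linarith
  · rintro ⟨h0, h1, h2⟩
    refine ⟨by linarith, fun k hk => ?_⟩
    cases k with
    | zero => simpa using h0
    | succ k => have := h2 k (by omega); linarith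

open Classical in
/-- The index of the first partial sum of the gaps `E` which reaches the level `u`. -/
def hitIndex (u : ℝ) (E : ℕ → ℝ) : ℕ := if h : ∃ n, Hit u E n then h.choose else 0

lemma Hit.hitIndex_eq {u : ℝ} {E : ℕ → ℝ} {n : ℕ} (h : Hit u E n) : hitIndex u E = n := by
  have h' : ∃ n, Hit u E n := ⟨n, h⟩
  rw [hitIndex, dif_pos h']
  exact h'.choose_spec.unique h

lemma measurableSet_hit (n : ℕ) : MeasurableSet {p : ℝ × (ℕ → ℝ) | Hit p.1 p.2 n} := by
  refine MeasurableSet.inter (s₁ := {p : ℝ × (ℕ → ℝ) | p.1 ≤ ∑ i ∈ Finset.range (n + 1), p.2 i})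
    (measurableSet_le (by fun_prop) (by fun_prop)) ?_
  have : {p : ℝ × (ℕ → ℝ) | ∀ k < n, ∑ i ∈ Finset.range (k + 1), p.2 i < p.1}
      = ⋂ k, ⋂ _ : k < n, {p : ℝ × (ℕ → ℝ) | ∑ i ∈ Finset.range (k + 1), p.2 i < p.1} := by
    ext; simp
  change MeasurableSet {p : ℝ × (ℕ → ℝ) | ∀ k < n, ∑ i ∈ Finset.range (k + 1), p.2 i < p.1}
  rw [this]
  exact MeasurableSet.iInter fun k => MeasurableSet.iInter fun _ =>
    measurableSet_lt (by fun_prop) (by fun_prop)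

lemma measurable_hitIndex : Measurable fun p : ℝ × (ℕ → ℝ) => hitIndex p.1 p.2 := by
  refine measurable_to_countable' fun n => ?_
  have : (fun p : ℝ × (ℕ → ℝ) => hitIndex p.1 p.2) ⁻¹' {n} = {p | Hit p.1 p.2 n} ∪
      ((⋃ m, {p : ℝ × (ℕ → ℝ) | Hit p.1 p.2 m})ᶜ ∩ {_p | n = 0}) := by
    ext p
    simp only [mem_preimage, mem_singleton_iff, mem_union, mem_ofPred_eq, mem_inter_iff,
      mem_compl_iff, mem_iUnion]
    by_cases h : ∃ m, Hit p.1 p.2 m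
    · obtain ⟨m, hm⟩ := h
      rw [hm.hitIndex_eq]
      constructor
      · rintro rfl; exact Or.inl hm
      · rintro (h' | h')
        · exact hm.unique h'
        · exact absurd ⟨m, hm⟩ h'.1
    · rw [hitIndex, dif_neg h]
      constructor
      · intro h0; exact Or.inr ⟨h, h0.symm⟩
      · rintro (h' | h')
        · exact absurd ⟨n, h'⟩ h
        · exact h'.2.symm
  rw [this]
  exact (measurableSet_hit n).union
    (((MeasurableSet.iUnion measurableSet_hit).compl).inter (MeasurableSet.const _))

/-- The environment of a service: the size of the message in service, the gaps between the
arrivals from the beginning of the service on, and the sizes of the arriving messages. -/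
abbrev Env : Type := ℝ × (ℕ → ℝ) × (ℕ → ℝ)

/-- The environment at the level `u`, when it is reached by the arrival with index `n`. The
message in service has size `z` in the blocking system (`b = true`), and it is the last to
arrive before the level `u` in the push-out system. -/
def stepAt (b : Bool) (n : ℕ) (u z : ℝ) (D : (ℕ → ℝ) × (ℕ → ℝ)) : Env :=
  (if b then z else scons z D.2 n,
    scons (∑ i ∈ Finset.range (n + 1), D.1 i - u) (fun k => D.1 (n + 1 + k)),
    fun k => D.2 (n + k))

/-- The environment at the level `u`. -/
def step (b : Bool) (u z : ℝ) (D : (ℕ → ℝ) × (ℕ → ℝ)) : Env := stepAt b (hitIndex u D.1) u z D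

/-- Removing the first arrival lowers the level by its gap and, under push-out only, makes its size
the candidate for service. This recursion drives the inductions on `n`. -/
lemma stepAt_scons (b : Bool) (n : ℕ) (u z e y : ℝ) (E Z : ℕ → ℝ) :
    stepAt b (n + 1) u z (scons e E, scons y Z)
      = stepAt b n (u - e) (if b then z else y) (E, Z) := by
  simp only [stepAt, Prod.mk.injEq]
  refine ⟨?_, ?_, ?_⟩
  · cases b
    · cases n <;> simp
    · simp
  · congr 1
    · rw [Finset.sum_range_succ']; simp only [scons_succ, scons_zero]; ring
    · funext k; rw [show n + 1 + 1 + k = (n + 1 + k) + 1 by ring]; rfl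
  · funext k; rw [show n + 1 + k = (n + k) + 1 by ring]; rfl

lemma measurable_stepAt (b : Bool) (n : ℕ) :
    Measurable fun p : ℝ × ℝ × ((ℕ → ℝ) × (ℕ → ℝ)) => stepAt b n p.1 p.2.1 p.2.2 := by
  unfold stepAt
  refine Measurable.prodMk ?_ (Measurable.prodMk ?_ ?_)
  · cases b
    · simp only [Bool.false_eq_true, if_false]
      exact (measurable_pi_apply n).comp (Measurable.scons (by fun_prop) (by fun_prop))
    · simp only [if_true]; fun_prop
  · exact Measurable.scons (by fun_prop) (by fun_prop)
  · fun_prop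

lemma measurable_step (b : Bool) :
    Measurable fun p : ℝ × ℝ × ((ℕ → ℝ) × (ℕ → ℝ)) => step b p.1 p.2.1 p.2.2 := by
  have h : Measurable fun q : (ℝ × ℝ × ((ℕ → ℝ) × (ℕ → ℝ))) × ℕ =>
      stepAt b q.2 q.1.1 q.1.2.1 q.1.2.2 :=
    measurable_from_prod_countable_left fun n => measurable_stepAt b n
  have hi : Measurable fun p : ℝ × ℝ × ((ℕ → ℝ) × (ℕ → ℝ)) => hitIndex p.1 p.2.2.1 :=
    measurable_hitIndex.comp (measurable_fst.prodMk measurable_snd.snd.fst)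
  exact h.comp (measurable_id.prodMk hi)

/-- The law of the gaps and the sizes of a sequence of arrivals. -/
def arrivalLaw (lam : ℝ) (G : Measure ℝ) : Measure ((ℕ → ℝ) × (ℕ → ℝ)) :=
  (Measure.infinitePi fun _ : ℕ => expMeasure lam).prod (Measure.infinitePi fun _ : ℕ => G)

lemma isProbabilityMeasure_arrivalLaw (hlam : 0 < lam) [IsProbabilityMeasure G] :
    IsProbabilityMeasure (arrivalLaw lam G) := by
  have := isProbabilityMeasure_expMeasure hlam
  unfold arrivalLaw; infer_instance

lemma lintegral_arrivalLaw_scons (hlam : 0 < lam) [IsProbabilityMeasure G]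
    {F : (ℕ → ℝ) × (ℕ → ℝ) → ℝ≥0∞} (hF : Measurable F) :
    ∫⁻ D, F D ∂(arrivalLaw lam G) = ∫⁻ e, ∫⁻ y, ∫⁻ D, F (scons e D.1, scons y D.2)
      ∂(arrivalLaw lam G) ∂G ∂(expMeasure lam) := by
  have := isProbabilityMeasure_expMeasure hlam
  unfold arrivalLaw
  rw [lintegral_prod _ hF.aemeasurable, lintegral_infinitePi_scons _ (Measurable.lintegral_prod_right'
    (f := F) hF)]
  refine lintegral_congr fun e => ?_
  have h1 : ∀ E, ∫⁻ Z, F (scons e E, Z) ∂(Measure.infinitePi fun _ : ℕ => G)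
      = ∫⁻ y, ∫⁻ Z, F (scons e E, scons y Z) ∂(Measure.infinitePi fun _ : ℕ => G) ∂G :=
    fun E => lintegral_infinitePi_scons G (hF.comp (by fun_prop))
  simp_rw [h1]
  have hm : Measurable fun q : ((ℕ → ℝ) × ℝ) × (ℕ → ℝ) => F (scons e q.1.1, scons q.1.2 q.2) :=
    hF.comp (Measurable.prodMk (Measurable.scons (by fun_prop) (by fun_prop))
      (Measurable.scons (by fun_prop) (by fun_prop)))
  rw [lintegral_lintegral_swap (Measurable.lintegral_prod_right hm).aemeasurable]
  refine lintegral_congr fun y => ?_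
  rw [lintegral_prod]
  exact (hF.comp (Measurable.prodMk (Measurable.scons (by fun_prop) (by fun_prop))
      (Measurable.scons (by fun_prop) (by fun_prop)))).aemeasurable

lemma measurable_indicator_hit (n : ℕ) (u z : ℝ) (b : Bool) {F : Env → ℝ≥0∞} (hF : Measurable F) :
    Measurable fun D : (ℕ → ℝ) × (ℕ → ℝ) =>
      {D : (ℕ → ℝ) × (ℕ → ℝ) | Hit u D.1 n}.indicator (fun D => F (stepAt b n u z D)) D := by
  refine Measurable.indicator ?_ ?_
  · exact hF.comp ((measurable_stepAt b n).comp (by fun_prop :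
      Measurable fun D : (ℕ → ℝ) × (ℕ → ℝ) => (u, z, D)))
  · exact (measurableSet_hit n).preimage (by fun_prop : Measurable
      fun D : (ℕ → ℝ) × (ℕ → ℝ) => (u, D.1))

lemma lintegral_hit_succ (hlam : 0 < lam) [IsProbabilityMeasure G] (b : Bool) (n : ℕ) (u z : ℝ)
    {F : Env → ℝ≥0∞} (hF : Measurable F) :
    ∫⁻ D, {D : (ℕ → ℝ) × (ℕ → ℝ) | Hit u D.1 (n + 1)}.indicator
        (fun D => F (stepAt b (n + 1) u z D)) D ∂(arrivalLaw lam G)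
      = ∫⁻ e, ∫⁻ y, (Iio u).indicator (fun e => ∫⁻ D, {D : (ℕ → ℝ) × (ℕ → ℝ) |
        Hit (u - e) D.1 n}.indicator (fun D => F (stepAt b n (u - e) (if b then z else y) D)) D
          ∂(arrivalLaw lam G)) e ∂G ∂(expMeasure lam) := by
  rw [lintegral_arrivalLaw_scons hlam (measurable_indicator_hit _ _ _ _ hF)]
  refine lintegral_congr fun e => lintegral_congr fun y => ?_
  by_cases he : e < u
  · rw [indicator_of_mem (by exact he)]
    refine lintegral_congr fun D => ?_
    have h1 : Hit u (scons e D.1) (n + 1) ↔ Hit (u - e) D.1 n := by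
      rw [hit_scons_succ]; exact ⟨fun h => h.2, fun h => ⟨he, h⟩⟩
    by_cases h : Hit (u - e) D.1 n
    · rw [indicator_of_mem (by exact h1.2 h), indicator_of_mem (by exact h), stepAt_scons]
    · rw [indicator_of_notMem (by exact fun h' => h (h1.1 h')), indicator_of_notMem (by exact h)]
  · rw [indicator_of_notMem (by exact he)]
    simp [indicator, hit_scons_succ, he]

/-- The first gap reaches the level, so the candidate is still `z`, and by memorylessness the part
of the gap beyond the level is again exponential. -/
lemma lintegral_hit_zero (hlam : 0 < lam) [IsProbabilityMeasure G] (b : Bool) {u : ℝ} (hu : 0 ≤ u)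
    (z : ℝ) {f : ℝ → ℝ≥0∞} (hf : Measurable f) {g : (ℕ → ℝ) × (ℕ → ℝ) → ℝ≥0∞} (hg : Measurable g) :
    ∫⁻ D, {D : (ℕ → ℝ) × (ℕ → ℝ) | Hit u D.1 0}.indicator
        (fun D => f (stepAt b 0 u z D).1 * g (stepAt b 0 u z D).2) D ∂(arrivalLaw lam G)
      = expMeasure lam (Ici u) * (f z * ∫⁻ D, g D ∂(arrivalLaw lam G)) := by
  have := isProbabilityMeasure_expMeasure hlam
  have := isProbabilityMeasure_arrivalLaw hlam (G := G)
  rw [lintegral_arrivalLaw_scons hlam (measurable_indicator_hit 0 u z b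
    (F := fun v => f v.1 * g v.2) (by fun_prop))]
  set h : ℝ → ℝ≥0∞ := fun e => ∫⁻ y, ∫⁻ D, f z * g (scons e D.1, scons y D.2)
      ∂(arrivalLaw lam G) ∂G with hh
  have hm : Measurable fun q : (ℝ × ℝ) × ((ℕ → ℝ) × (ℕ → ℝ)) =>
      f z * g (scons q.1.1 q.2.1, scons q.1.2 q.2.2) :=
    measurable_const.mul (hg.comp (Measurable.prodMk (Measurable.scons (by fun_prop) (by fun_prop))
      (Measurable.scons (by fun_prop) (by fun_prop))))
  have hmh : Measurable h :=
    Measurable.lintegral_prod_right (Measurable.lintegral_prod_right hm)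
  have h1 : ∀ e, (∫⁻ y, ∫⁻ D, {D : (ℕ → ℝ) × (ℕ → ℝ) | Hit u D.1 0}.indicator
        (fun D => f (stepAt b 0 u z D).1 * g (stepAt b 0 u z D).2) (scons e D.1, scons y D.2)
        ∂(arrivalLaw lam G) ∂G) = (Ici u).indicator (fun e => h (e - u)) e := by
    intro e
    by_cases he : u ≤ e
    · rw [indicator_of_mem (by exact he)]
      refine lintegral_congr fun y => lintegral_congr fun D => ?_
      rw [indicator_of_mem (by exact (hit_scons_zero _ _ _).2 he)]
      have e1 : (stepAt b 0 u z (scons e D.1, scons y D.2)).1 = z := by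
        cases b <;> simp [stepAt]
      have e2 : (stepAt b 0 u z (scons e D.1, scons y D.2)).2
          = (scons (e - u) D.1, scons y D.2) := by
        simp only [stepAt, Prod.mk.injEq]
        refine ⟨?_, ?_⟩
        · congr 1
          · simp
          · funext k; rw [show 0 + 1 + k = k + 1 by ring]; rfl
        · funext k; rw [zero_add]
      rw [e1, e2]
    · rw [indicator_of_notMem (by exact he)]
      simp [indicator, hit_scons_zero, he]
  simp_rw [h1]
  rw [lintegral_expMeasure_memoryless hlam hu hmh]
  congr 1
  rw [← lintegral_const_mul _ hg, lintegral_arrivalLaw_scons hlam (by fun_prop)]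

/-- Each arrival before the level changes only the level and the candidate; at the last stage
`lintegral_hit_zero` makes the arrivals beyond the level fresh. -/
lemma lintegral_hit_eq_mul (hlam : 0 < lam) [IsProbabilityMeasure G] (b : Bool) (n : ℕ) {u : ℝ}
    (hu : 0 ≤ u) (z : ℝ) {f : ℝ → ℝ≥0∞} (hf : Measurable f) {g : (ℕ → ℝ) × (ℕ → ℝ) → ℝ≥0∞}
    (hg : Measurable g) (hg' : ∫⁻ D, g D ∂(arrivalLaw lam G) ≠ ∞) :
    ∫⁻ D, {D : (ℕ → ℝ) × (ℕ → ℝ) | Hit u D.1 n}.indicator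
        (fun D => f (stepAt b n u z D).1 * g (stepAt b n u z D).2) D ∂(arrivalLaw lam G)
      = (∫⁻ D, {D : (ℕ → ℝ) × (ℕ → ℝ) | Hit u D.1 n}.indicator
        (fun D => f (stepAt b n u z D).1) D ∂(arrivalLaw lam G)) *
        ∫⁻ D, g D ∂(arrivalLaw lam G) := by
  have := isProbabilityMeasure_expMeasure hlam
  have := isProbabilityMeasure_arrivalLaw hlam (G := G)
  induction n generalizing u z with
  | zero =>
    have h := lintegral_hit_zero hlam (G := G) b hu z hf (g := fun _ => 1) measurable_const
    simp only [mul_one, lintegral_one, measure_univ] at h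
    rw [lintegral_hit_zero hlam b hu z hf hg, h, mul_assoc]
  | succ n ih =>
    rw [lintegral_hit_succ hlam b n u z (F := fun v => f v.1 * g v.2) (by fun_prop),
      lintegral_hit_succ hlam b n u z (F := fun v => f v.1) (by fun_prop),
      ← lintegral_mul_const' _ _ hg']
    refine lintegral_congr fun e => ?_
    rw [← lintegral_mul_const' _ _ hg']
    refine lintegral_congr fun y => ?_
    by_cases he : e < u
    · rw [indicator_of_mem (by exact he), indicator_of_mem (by exact he),
        ih (sub_nonneg.2 he.le)]
    · rw [indicator_of_notMem (by exact he), indicator_of_notMem (by exact he), zero_mul]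

/-- The index at which the level is reached depends on the gaps and not on the sizes, so selecting a
message by this index does not bias its size. -/
lemma lintegral_hit_size (hlam : 0 < lam) [IsProbabilityMeasure G] (b : Bool) (n : ℕ) {u : ℝ}
    (hu : 0 ≤ u) {f : ℝ → ℝ≥0∞} (hf : Measurable f) (hf' : ∫⁻ z, f z ∂G ≠ ∞) :
    ∫⁻ z, ∫⁻ D, {D : (ℕ → ℝ) × (ℕ → ℝ) | Hit u D.1 n}.indicator
        (fun D => f (stepAt b n u z D).1) D ∂(arrivalLaw lam G) ∂G
      = arrivalLaw lam G {D | Hit u D.1 n} * ∫⁻ z, f z ∂G := by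
  have := isProbabilityMeasure_expMeasure hlam
  have := isProbabilityMeasure_arrivalLaw hlam (G := G)
  have hms : ∀ u : ℝ, MeasurableSet {D : (ℕ → ℝ) × (ℕ → ℝ) | Hit u D.1 n} := fun u =>
    (measurableSet_hit n).preimage (by fun_prop : Measurable
      fun D : (ℕ → ℝ) × (ℕ → ℝ) => (u, D.1))
  cases b with
  | true =>
    have h1 : ∀ z, ∫⁻ D, {D : (ℕ → ℝ) × (ℕ → ℝ) | Hit u D.1 n}.indicator
        (fun D => f (stepAt true n u z D).1) D ∂(arrivalLaw lam G)
          = f z * arrivalLaw lam G {D | Hit u D.1 n} := by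
      intro z
      exact lintegral_indicator_const (hms u) (f z)
    simp_rw [h1]
    rw [lintegral_mul_const _ hf, mul_comm]
  | false =>
    induction n generalizing u with
    | zero =>
      have h := fun z => lintegral_hit_zero hlam (G := G) false hu z hf (g := fun _ => 1)
        measurable_const
      have h1 := lintegral_hit_zero hlam (G := G) false hu 0 (f := fun _ => 1) measurable_const
        (g := fun _ => 1) measurable_const
      simp only [mul_one, lintegral_one, measure_univ] at h h1
      simp_rw [h]
      rw [lintegral_const_mul _ hf, ← lintegral_indicator_one (hms u)]
      exact congrArg (· * _) h1.symm
    | succ n ih =>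
      have hms' : ∀ u : ℝ, MeasurableSet {D : (ℕ → ℝ) × (ℕ → ℝ) | Hit u D.1 n} := fun u =>
        (measurableSet_hit n).preimage (by fun_prop : Measurable
          fun D : (ℕ → ℝ) × (ℕ → ℝ) => (u, D.1))
      simp_rw [lintegral_hit_succ hlam false n u _ (F := fun v => f v.1) (by fun_prop)]
      -- Under push-out the size `y` of the first arrival, again of law `G`, takes over the role of
      -- `z`, on which nothing depends any more.
      simp only [Bool.false_eq_true, if_false]
      have h1 := lintegral_hit_succ hlam (G := G) false n u 0 (F := fun _ => 1) measurable_const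
      refine (lintegral_const _).trans ?_
      rw [measure_univ, mul_one, ← lintegral_indicator_one (hms u)]
      refine Eq.trans ?_ (congrArg (· * _) h1.symm)
      rw [← lintegral_mul_const' _ _ hf']
      refine lintegral_congr fun e => ?_
      by_cases he : e < u
      · simp only [indicator_of_mem (show e ∈ Iio u from he)]
        rw [lintegral_const, measure_univ, mul_one]
        refine (ih (sub_nonneg.2 he.le) hms').trans ?_
        rw [← lintegral_indicator_one (hms' _)]
        rfl
      · simp only [indicator_of_notMem (show e ∉ Iio u from he), lintegral_zero, zero_mul]

lemma lintegral_step_eq_tsum (hlam : 0 < lam) [IsProbabilityMeasure G] (b : Bool) (u z : ℝ)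
    {F : Env → ℝ≥0∞} (hF : Measurable F) :
    ∫⁻ D, F (step b u z D) ∂(arrivalLaw lam G) = ∑' n, ∫⁻ D,
      {D : (ℕ → ℝ) × (ℕ → ℝ) | Hit u D.1 n}.indicator (fun D => F (stepAt b n u z D)) D
        ∂(arrivalLaw lam G) := by
  have := isProbabilityMeasure_expMeasure hlam
  rw [← lintegral_tsum fun n => (measurable_indicator_hit n u z b hF).aemeasurable]
  have hq : Measure.QuasiMeasurePreserving Prod.fst (arrivalLaw lam G)
      (Measure.infinitePi fun _ : ℕ => expMeasure lam) := Measure.quasiMeasurePreserving_fst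
  refine lintegral_congr_ae ?_
  filter_upwards [hq.ae (ae_exists_le_sum hlam u)] with D hD
  obtain ⟨n, hn⟩ := exists_hit hD
  rw [tsum_eq_single n]
  · rw [indicator_of_mem (by exact hn), step, hn.hitIndex_eq]
  · intro m hm
    rw [indicator_of_notMem]
    exact fun h => hm (Hit.unique h hn)

lemma tsum_hit (hlam : 0 < lam) [IsProbabilityMeasure G] (u : ℝ) :
    ∑' n, arrivalLaw lam G {D | Hit u D.1 n} = 1 := by
  have := isProbabilityMeasure_arrivalLaw hlam (G := G)
  have h := lintegral_step_eq_tsum hlam (G := G) true u 0 (F := fun _ => 1) measurable_const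
  rw [lintegral_one, measure_univ] at h
  rw [h]
  congr 1; funext n
  exact (lintegral_indicator_one ((measurableSet_hit n).preimage (by fun_prop : Measurable
      fun D : (ℕ → ℝ) × (ℕ → ℝ) => (u, D.1)))).symm

/-- At a given level, the message in service is independent of the arrivals to come, which have
the same law as the original arrivals. -/
lemma lintegral_step_eq_mul (hlam : 0 < lam) [IsProbabilityMeasure G] (b : Bool) {u : ℝ}
    (hu : 0 ≤ u) (z : ℝ) {f : ℝ → ℝ≥0∞} (hf : Measurable f) {g : (ℕ → ℝ) × (ℕ → ℝ) → ℝ≥0∞}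
    (hg : Measurable g) (hg' : ∫⁻ D, g D ∂(arrivalLaw lam G) ≠ ∞) :
    ∫⁻ D, f (step b u z D).1 * g (step b u z D).2 ∂(arrivalLaw lam G)
      = (∫⁻ D, f (step b u z D).1 ∂(arrivalLaw lam G)) * ∫⁻ D, g D ∂(arrivalLaw lam G) := by
  rw [lintegral_step_eq_tsum hlam b u z (F := fun v => f v.1 * g v.2) (by fun_prop),
    lintegral_step_eq_tsum hlam b u z (F := fun v => f v.1) (by fun_prop), ← ENNReal.tsum_mul_right]
  congr 1; funext n
  exact lintegral_hit_eq_mul hlam b n hu z hf hg hg'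

lemma lintegral_step_size (hlam : 0 < lam) [IsProbabilityMeasure G] (b : Bool) {u : ℝ}
    (hu : 0 ≤ u) {f : ℝ → ℝ≥0∞} (hf : Measurable f) (hf' : ∫⁻ z, f z ∂G ≠ ∞) :
    ∫⁻ z, ∫⁻ D, f (step b u z D).1 ∂(arrivalLaw lam G) ∂G = ∫⁻ z, f z ∂G := by
  have := isProbabilityMeasure_arrivalLaw hlam (G := G)
  simp_rw [fun z => lintegral_step_eq_tsum hlam (G := G) b u z (F := fun v => f v.1) (by fun_prop)]
  rw [lintegral_tsum]
  · simp_rw [fun n => lintegral_hit_size hlam (G := G) b n hu hf hf']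
    rw [ENNReal.tsum_mul_right, tsum_hit hlam, one_mul]
  · intro n
    refine (Measurable.lintegral_prod_right (f := fun z (D : (ℕ → ℝ) × (ℕ → ℝ)) =>
      {D : (ℕ → ℝ) × (ℕ → ℝ) | Hit u D.1 n}.indicator (fun D => f (stepAt b n u z D).1) D)
      ?_).aemeasurable
    refine Measurable.indicator (s := {p : ℝ × ((ℕ → ℝ) × (ℕ → ℝ)) | Hit u p.2.1 n})
      (f := fun p => f (stepAt b n u p.1 p.2).1) ?_ ?_
    · exact hf.comp ((measurable_stepAt b n).comp (by fun_prop :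
        Measurable fun p : ℝ × ((ℕ → ℝ) × (ℕ → ℝ)) => (u, p.1, p.2))).fst
    · exact (measurableSet_hit n).preimage (by fun_prop : Measurable
        fun p : ℝ × ((ℕ → ℝ) × (ℕ → ℝ)) => (u, p.2.1))

/-- The law of the environment of a service. -/
def envLaw (lam : ℝ) (G : Measure ℝ) : Measure Env := G.prod (arrivalLaw lam G)

/-- The law of the pairs formed of the time to the next arrival from the beginning of a service
on and of the duration of that service. -/
def cycleLaw (lam : ℝ) (G : Measure ℝ) : Measure (ℝ × ℝ) := (expMeasure lam).prod G

/-- From the environment of a service: the time to the next arrival and the duration of that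
service, and the environment of the next service. -/
def cycleStep (b : Bool) (e : Env) : (ℝ × ℝ) × Env :=
  ((e.2.1 0, e.1), step b (max (e.1 - e.2.1 0) 0) (e.2.2 0)
    (fun k => e.2.1 (k + 1), fun k => e.2.2 (k + 1)))

lemma measurable_cycleStep (b : Bool) : Measurable (cycleStep b) := by
  unfold cycleStep
  refine Measurable.prodMk (by fun_prop) ?_
  exact (measurable_step b).comp (by fun_prop : Measurable fun e : Env =>
    (max (e.1 - e.2.1 0) 0, e.2.2 0, ((fun k => e.2.1 (k + 1) : ℕ → ℝ),
      (fun k => e.2.2 (k + 1) : ℕ → ℝ))))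

lemma isProbabilityMeasure_envLaw (hlam : 0 < lam) [IsProbabilityMeasure G] :
    IsProbabilityMeasure (envLaw lam G) := by
  have := isProbabilityMeasure_arrivalLaw hlam (G := G)
  unfold envLaw; infer_instance

lemma isProbabilityMeasure_cycleLaw (hlam : 0 < lam) [IsProbabilityMeasure G] :
    IsProbabilityMeasure (cycleLaw lam G) := by
  have := isProbabilityMeasure_expMeasure hlam
  unfold cycleLaw; infer_instance

/-- For a service of given duration, the next environment is independent of the time to the next
arrival. -/
lemma lintegral_cycleStep (hlam : 0 < lam) [IsProbabilityMeasure G] (b : Bool) (σ : ℝ)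
    {f : ℝ → ℝ≥0∞} (hf : Measurable f) {g : Env → ℝ≥0∞} (hg : Measurable g) :
    ∫⁻ D, f (D.1 0) * g (cycleStep b (σ, D)).2 ∂(arrivalLaw lam G)
      = (∫⁻ e, f e ∂(expMeasure lam)) * ∫⁻ v, g v ∂(envLaw lam G) := by
  have := isProbabilityMeasure_arrivalLaw hlam (G := G)
  have := isProbabilityMeasure_expMeasure hlam
  have := isProbabilityMeasure_envLaw hlam (G := G)
  have hmc := measurable_cycleStep b
  -- The level is the time from the first arrival to the beginning of the next service; it is `0` if
  -- that arrival finds the server idle. Whatever its value `u`, the environment found there has the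
  -- same law.
  have key : ∀ u : ℝ, 0 ≤ u → (G.prod (arrivalLaw lam G)).map
      (fun p : ℝ × ((ℕ → ℝ) × (ℕ → ℝ)) => step b u p.1 p.2) = envLaw lam G := by
    intro u hu
    have hm : Measurable fun p : ℝ × ((ℕ → ℝ) × (ℕ → ℝ)) => step b u p.1 p.2 :=
      (measurable_step b).comp (by fun_prop :
        Measurable fun p : ℝ × ((ℕ → ℝ) × (ℕ → ℝ)) => (u, p.1, p.2))
    refine (Measure.prod_eq fun s t hs ht => ?_).symm
    rw [← lintegral_indicator_one (hs.prod ht), lintegral_map (measurable_one.indicator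
      (hs.prod ht)) hm, lintegral_prod (fun p : ℝ × ((ℕ → ℝ) × (ℕ → ℝ)) =>
        (s ×ˢ t).indicator (1 : Env → ℝ≥0∞) (step b u p.1 p.2))
        ((measurable_one.indicator (hs.prod ht)).comp hm).aemeasurable]
    have h1 : ∀ v : Env, (s ×ˢ t).indicator (1 : Env → ℝ≥0∞) v
        = s.indicator 1 v.1 * t.indicator 1 v.2 := by
      intro v; rw [indicator_prod_one]
    have ht' : ∫⁻ D, t.indicator 1 D ∂(arrivalLaw lam G) = arrivalLaw lam G t :=
      lintegral_indicator_one ht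
    have hs' : ∫⁻ D, s.indicator 1 D ∂G = G s := lintegral_indicator_one hs
    simp_rw [h1]
    simp_rw [fun z => lintegral_step_eq_mul hlam (G := G) b hu z (measurable_one.indicator hs)
      (measurable_one.indicator ht) (by rw [ht']; exact measure_ne_top _ _)]
    rw [lintegral_mul_const' _ _ (by rw [ht']; exact measure_ne_top _ _),
      lintegral_step_size hlam b hu (measurable_one.indicator hs)
        (by rw [hs']; exact measure_ne_top _ _), hs', ht']
  have hm2 : Measurable fun D : (ℕ → ℝ) × (ℕ → ℝ) => g (cycleStep b (σ, D)).2 :=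
    hg.comp (hmc.comp (by fun_prop)).snd
  rw [lintegral_arrivalLaw_scons hlam (F := fun D => f (D.1 0) * g (cycleStep b (σ, D)).2)
    ((hf.comp (by fun_prop)).mul hm2), ← lintegral_mul_const _ hf]
  refine lintegral_congr fun e => ?_
  have h2 : ∀ (y : ℝ) (D : (ℕ → ℝ) × (ℕ → ℝ)), (cycleStep b (σ, scons e D.1, scons y D.2)).2
      = step b (max (σ - e) 0) y D := fun y D => rfl
  simp only [h2, scons_zero]
  have hm : Measurable fun p : ℝ × ((ℕ → ℝ) × (ℕ → ℝ)) => step b (max (σ - e) 0) p.1 p.2 :=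
      (measurable_step b).comp (by fun_prop :
        Measurable fun p : ℝ × ((ℕ → ℝ) × (ℕ → ℝ)) => (max (σ - e) 0, p.1, p.2))
  rw [← key (max (σ - e) 0) (le_max_right _ _), lintegral_map hg hm,
    ← lintegral_const_mul _ (show Measurable fun p : ℝ × ((ℕ → ℝ) × (ℕ → ℝ)) =>
      g (step b (max (σ - e) 0) p.1 p.2) from hg.comp hm),
    lintegral_prod (fun p : ℝ × ((ℕ → ℝ) × (ℕ → ℝ)) => f e * g (step b (max (σ - e) 0) p.1 p.2))
      ((hg.comp hm).const_mul (f e)).aemeasurable]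

/-- Given the duration `σ`, the next environment is independent of the first gap and its law does
not involve `σ` (`lintegral_cycleStep`). Hence it is independent of the pair of both. -/
lemma map_cycleStep (hlam : 0 < lam) [IsProbabilityMeasure G] (b : Bool) :
    (envLaw lam G).map (cycleStep b) = (cycleLaw lam G).prod (envLaw lam G) := by
  have := isProbabilityMeasure_arrivalLaw hlam (G := G)
  have := isProbabilityMeasure_expMeasure hlam
  have := isProbabilityMeasure_envLaw hlam (G := G)
  have := isProbabilityMeasure_cycleLaw hlam (G := G)
  have hmc := measurable_cycleStep b
  refine (Measure.prod_eq fun s t hs ht => ?_).symm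
  have hst := (measurable_one (α := ℝ≥0∞) (β := (ℝ × ℝ) × Env)).indicator (hs.prod ht)
  have h1 : ∀ v : (ℝ × ℝ) × Env, (s ×ˢ t).indicator (1 : (ℝ × ℝ) × Env → ℝ≥0∞) v
        = s.indicator 1 v.1 * t.indicator 1 v.2 := by
      intro v; rw [indicator_prod_one]
  have h2 : ∀ σ : ℝ, ∫⁻ D, s.indicator (1 : ℝ × ℝ → ℝ≥0∞) (D.1 0, σ)
      * t.indicator (1 : Env → ℝ≥0∞) (cycleStep b (σ, D)).2 ∂(arrivalLaw lam G)
      = (∫⁻ e, s.indicator (1 : ℝ × ℝ → ℝ≥0∞) (e, σ) ∂(expMeasure lam)) * envLaw lam G t := by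
    intro σ
    rw [lintegral_cycleStep hlam b σ (f := fun e => s.indicator (1 : ℝ × ℝ → ℝ≥0∞) (e, σ))
      ((measurable_one.indicator hs).comp (by fun_prop)) (measurable_one.indicator ht),
      lintegral_indicator_one ht]
  rw [← lintegral_indicator_one (hs.prod ht), lintegral_map hst hmc, envLaw,
    lintegral_prod (fun e : Env => (s ×ˢ t).indicator (1 : (ℝ × ℝ) × Env → ℝ≥0∞) (cycleStep b e))
      (hst.comp hmc).aemeasurable]
  simp_rw [h1]
  refine (lintegral_congr h2).trans ?_
  rw [lintegral_mul_const' _ _ (measure_ne_top _ _)]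
  congr 1
  rw [← lintegral_indicator_one hs, cycleLaw, lintegral_prod_symm _
    (measurable_one.indicator hs).aemeasurable]

/-- The successive pairs of times to the next arrival and durations of service. -/
def cycleSeq (b : Bool) (e : Env) (i : ℕ) : ℝ × ℝ :=
  (cycleStep b ((fun e => (cycleStep b e).2)^[i] e)).1

lemma measurable_cycleSeq (b : Bool) : Measurable (cycleSeq b) :=
  measurable_pi_lambda _ fun i =>
    ((measurable_cycleStep b).comp ((measurable_cycleStep b).snd.iterate i)).fst

lemma map_cycleSeq (hlam : 0 < lam) [IsProbabilityMeasure G] (b : Bool) :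
    (envLaw lam G).map (cycleSeq b) = Measure.infinitePi fun _ : ℕ => cycleLaw lam G := by
  have := isProbabilityMeasure_envLaw hlam (G := G)
  have := isProbabilityMeasure_cycleLaw hlam (G := G)
  exact map_iterate_eq_infinitePi _ _ _ (measurable_cycleStep b) (map_cycleStep hlam b)

end Residual

end AoI

end

/-! ### Deterministic dynamics: what blocking and push-out have in common. -/

noncomputable section

namespace AoI

namespace MessageFlow

variable {x : MessageFlow}

/-- The time at which the service of message `n` begins, if it is successful. -/
def st (x : MessageFlow) (n : ℤ) : ℝ := x.dep n - x.size n

/-- The first message after message `m` which arrives from the beginning of the service of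
message `m` on. -/
def IsNext (x : MessageFlow) (m w : ℤ) : Prop := IsLeast {l | m < l ∧ x.st m ≤ x.T l} w

/-- What the two systems have in common. -/
structure Regular (b : Bool) (x : MessageFlow) : Prop extends x.IsInput where
  dep_le_st : ∀ m l, x.ψ m → x.ψ l → m < l → x.dep m ≤ x.st l
  busy : ∀ n, ∃ m ≤ n, x.InService m (x.T n)
  succ : ∀ m w, x.ψ m → x.IsNext m w → ∃ m', x.ψ m' ∧ w ≤ m' ∧ (∀ n, m < n → n < m' → ¬ x.ψ n) ∧
    x.st m' = max (x.dep m) (x.T w) ∧ ∀ w', IsLeast {l | w < l ∧ x.dep m ≤ x.T l} w' →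
      x.IsNext m' w' ∧ m' = if b then w else w' - 1
  num_eq_ite : ∀ m w t, x.ψ m → x.IsNext m w → x.st m ≤ t → t < max (x.dep m) (x.T w) →
    x.numInSystem t = if t < x.dep m then (if x.T w ≤ t then 2 else 1) else 0

lemma exists_isLeast_int {p : ℤ → Prop} (hb : ∃ b, ∀ l, p l → b ≤ l) (hne : ∃ l, p l) :
    ∃ w, IsLeast {l | p l} w := by
  obtain ⟨w, hw, h⟩ := Int.exists_least_of_bdd hb hne
  exact ⟨w, hw, h⟩

lemma exists_isGreatest_int {p : ℤ → Prop} (hb : ∃ b, ∀ l, p l → l ≤ b) (hne : ∃ l, p l) :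
    ∃ w, IsGreatest {l | p l} w := by
  obtain ⟨w, hw, h⟩ := Int.exists_greatest_of_bdd hb hne
  exact ⟨w, hw, h⟩

lemma IsInput.exists_isLeast (h : x.IsInput) (m : ℤ) (u : ℝ) :
    ∃ w, IsLeast {l | m < l ∧ u ≤ x.T l} w := by
  refine exists_isLeast_int ⟨m, fun l hl => hl.1.le⟩ ?_
  obtain ⟨l, h1, h2⟩ := ((h.tendsto_atTop.eventually_ge_atTop u).and
    (eventually_gt_atTop m)).exists
  exact ⟨l, h2, h1⟩

lemma IsInput.exists_isNext (h : x.IsInput) (m : ℤ) : ∃ w, x.IsNext m w :=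
  h.exists_isLeast m _

lemma IsInput.exists_last (h : x.IsInput) (t : ℝ) : ∃ l, x.T l ≤ t ∧ t < x.T (l + 1) := by
  obtain ⟨l, hl⟩ := exists_isGreatest_int (p := fun l => x.T l ≤ t) (by
    obtain ⟨b, hb⟩ := (h.tendsto_atTop.eventually_gt_atTop t).exists
    exact ⟨b, fun l hl => h.strictMono.le_iff_le.1 (hl.trans hb.le)⟩)
    (h.tendsto_atBot.eventually_le_atBot t).exists
  refine ⟨l, hl.1, ?_⟩
  by_contra hc
  have := hl.2 (show l + 1 ∈ {l | x.T l ≤ t} from not_lt.1 hc)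
  omega

section B2

lemma IsB2.dep_of_not_psi (hB : x.IsB2) {n : ℤ} (h : ¬ x.ψ n) : x.dep n = x.T n := by
  by_cases hi : ∀ m < n, ¬ x.InService m (x.T n)
  · exact absurd ((hB n).1 hi).1 h
  · push Not at hi
    obtain ⟨m, hm, hs⟩ := hi
    by_cases hw : ∀ l < n, ¬ x.Waiting l (x.T n)
    · exact absurd (((hB n).2 m hm hs).1 hw).1 h
    · push Not at hw
      exact (((hB n).2 m hm hs).2 hw).2

lemma IsB2.cases (hB : x.IsB2) {n : ℤ} (h : x.ψ n) :
    ((∀ m < n, ¬ x.InService m (x.T n)) ∧ x.st n = x.T n) ∨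
    ∃ m < n, x.InService m (x.T n) ∧ (∀ l < n, ¬ x.Waiting l (x.T n)) ∧ x.st n = x.dep m := by
  by_cases hi : ∀ m < n, ¬ x.InService m (x.T n)
  · exact Or.inl ⟨hi, by simp [st, ((hB n).1 hi).2]⟩
  · push Not at hi
    obtain ⟨m, hm, hs⟩ := hi
    by_cases hw : ∀ l < n, ¬ x.Waiting l (x.T n)
    · exact Or.inr ⟨m, hm, hs, hw, by simp [st, (((hB n).2 m hm hs).1 hw).2]⟩
    · push Not at hw
      exact absurd h (((hB n).2 m hm hs).2 hw).1

lemma st_lt_dep (hx : x.IsInput) (n : ℤ) : x.st n < x.dep n := by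
  have := hx.size_pos n; simp only [st]; linarith

lemma IsB2.le_st (hB : x.IsB2) {n : ℤ} (h : x.ψ n) : x.T n ≤ x.st n := by
  rcases hB.cases h with ⟨_, h1⟩ | ⟨m, _, h1, _, h2⟩
  · exact h1.ge
  · rw [h2]; exact h1.2.2.le

/-- If `l` finds the server idle, `m` must have begun by then: otherwise the message for which `m`
was waiting would be in service at `T l`. If `l` is stored, nobody is waiting at `T l`, so `m` has
left or is the message in service. -/
lemma IsB2.dep_le_st_and (hx : x.IsInput) (hB : x.IsB2) {m l : ℤ} (hm : x.ψ m) (hl : x.ψ l)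
    (hml : m < l) : x.dep m ≤ x.st l ∧ x.st m ≤ x.T l := by
  have hT : x.T m < x.T l := hx.strictMono hml
  have hsd := st_lt_dep hx m
  rcases hB.cases hl with ⟨hi, h1⟩ | ⟨l', hl', hs, hw, h1⟩
  · have hst : x.st m ≤ x.T l := by
      rcases hB.cases hm with ⟨_, h2⟩ | ⟨m', hm', hs', _, h2⟩
      · linarith
      · by_contra hc
        refine hi m' (hm'.trans hml) ⟨hs'.1, hs'.2.1.trans hT.le, ?_⟩
        linarith
    refine ⟨?_, hst⟩
    rw [h1]
    by_contra hc
    exact hi m hml ⟨hm, hst, not_le.1 hc⟩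
  · by_cases hd : x.T l < x.dep m
    · have hsm : x.InService m (x.T l) := by
        by_contra hc
        exact hw m hml ⟨⟨hT.le, hd⟩, hc⟩
      have := (((hB l).2 m hml hsm).1 hw).2
      exact ⟨by simp [st, this], hsm.2.1⟩
    · have := hs.2.2
      exact ⟨by linarith, by linarith⟩

/-- The next successful message after `m` is `w`, the first one arriving from the beginning of the
service of `m` on: it finds the server idle or the storage cell empty. Messages between `m` and `w`
arrive before this service begins and are rejected. -/
lemma IsB2.regular (hx : x.IsInput) (hB : x.IsB2) : x.Regular true := by
  have hsize := hx.size_pos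
  have hnext : ∀ m w, x.ψ m → x.IsNext m w →
      x.ψ w ∧ x.st w = max (x.dep m) (x.T w) ∧ ∀ n, m < n → n < w → ¬ x.ψ n := by
    intro m w hm hw
    have hno : ∀ n, m < n → n < w → ¬ x.ψ n := by
      intro n h1 h2 h3
      exact absurd (hw.2 ⟨h1, (hB.dep_le_st_and hx hm h3 h1).2⟩) (not_le.2 h2)
    have hst : x.st m ≤ x.T w := hw.1.2
    have hgone : ∀ m', x.ψ m' → m' < m → x.dep m' ≤ x.T w := fun m' h1 h2 =>
      (hB.dep_le_st_and hx h1 hm h2).1.trans hst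
    by_cases hd : x.dep m ≤ x.T w
    · have hidle : ∀ m' < w, ¬ x.InService m' (x.T w) := by
        intro m' h1 h2
        rcases lt_trichotomy m' m with h | rfl | h
        · exact absurd (hgone m' h2.1 h) (not_le.2 h2.2.2)
        · exact absurd hd (not_le.2 h2.2.2)
        · exact hno m' h h1 h2.1
      obtain ⟨h1, h2⟩ := (hB w).1 hidle
      exact ⟨h1, by rw [max_eq_right hd]; simp [st, h2], hno⟩
    · push Not at hd
      have hs : x.InService m (x.T w) := ⟨hm, hst, hd⟩
      have hwait : ∀ l < w, ¬ x.Waiting l (x.T w) := by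
        intro l h1 h2
        -- Under blocking an unsuccessful message leaves on arrival, so a waiting message is
        -- successful.
        have hl : x.ψ l := by
          by_contra hc
          have h3 := hB.dep_of_not_psi hc
          have h4 := h2.1
          rw [InSystem, h3] at h4
          linarith
        rcases lt_trichotomy l m with h | rfl | h
        · exact absurd (hgone l hl h) (not_le.2 h2.1.2)
        · exact h2.2 hs
        · exact hno l h h1 hl
      obtain ⟨h1, h2⟩ := ((hB w).2 m hw.1.1 hs).1 hwait
      exact ⟨h1, by rw [max_eq_left hd.le]; simp [st, h2], hno⟩
  refine ⟨hx, fun m l h1 h2 h3 => (hB.dep_le_st_and hx h1 h2 h3).1, ?_, ?_, ?_⟩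
  · intro n
    by_cases hi : ∀ m < n, ¬ x.InService m (x.T n)
    · obtain ⟨h1, h2⟩ := (hB n).1 hi
      exact ⟨n, le_rfl, h1, by linarith, by have := hsize n; linarith⟩
    · push Not at hi
      obtain ⟨m, h1, h2⟩ := hi
      exact ⟨m, h1.le, h2⟩
  · intro m w hm hw
    obtain ⟨h1, h2, h3⟩ := hnext m w hm hw
    refine ⟨w, h1, le_rfl, h3, h2, fun w' hw' => ⟨⟨⟨hw'.1.1, ?_⟩, ?_⟩, rfl⟩⟩
    · rw [h2]
      exact max_le hw'.1.2 (hx.strictMono hw'.1.1).le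
    · intro l hl
      refine hw'.2 ⟨hl.1, ?_⟩
      have := hl.2
      rw [h2] at this
      exact (le_max_left _ _).trans this
  · intro m w t hm hw h1 h2
    obtain ⟨g1, g2, g3⟩ := hnext m w hm hw
    have hin : ∀ n, x.InSystem n t → n = m ∨ n = w := by
      intro n hn
      have hnψ : x.ψ n := by
        by_contra hc
        have h4 := hn
        rw [InSystem, hB.dep_of_not_psi hc] at h4
        linarith
      rcases lt_trichotomy n m with h | h | h
      · have := (hB.dep_le_st_and hx hnψ hm h).1
        have := hn.2
        linarith
      · exact Or.inl h
      · rcases lt_trichotomy n w with h' | h' | h'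
        · exact absurd hnψ (g3 n h h')
        · exact Or.inr h'
        · have := (hB.dep_le_st_and hx g1 hnψ h').2
          have := hn.1
          linarith
    have hTm := hB.le_st hm
    have hdw := st_lt_dep hx w
    unfold numInSystem
    split_ifs with hd hT
    · have : {n : ℤ | x.InSystem n t} = {m, w} := by
        ext n
        constructor
        · exact hin n
        · rintro (rfl | rfl)
          · exact ⟨hTm.trans h1, hd⟩
          · exact ⟨hT, by linarith⟩
      rw [this, ncard_pair hw.1.1.ne]
    · have : {n : ℤ | x.InSystem n t} = {m} := by
        ext n
        constructor
        · intro hn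
          rcases hin n hn with h | rfl
          · exact h
          · exact absurd hn.1 hT
        · rintro rfl
          exact ⟨hTm.trans h1, hd⟩
      rw [this, ncard_singleton]
    · have : {n : ℤ | x.InSystem n t} = ∅ := by
        ext n
        refine ⟨fun hn => ?_, fun h => h.elim⟩
        rcases hin n hn with rfl | rfl
        · exact hd hn.2
        · rcases lt_max_iff.1 h2 with h | h
          · exact hd h
          · exact absurd hn.1 (not_le.2 h)
      rw [this, ncard_empty]

end B2

section P2

lemma IsP2.cases (hP : x.IsP2) {n : ℤ} (h : x.ψ n) :
    ((∀ m < n, ¬ x.InService m (x.T n)) ∧ x.st n = x.T n) ∨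
    ∃ m < n, x.InService m (x.T n) ∧ x.dep m ≤ x.T (n + 1) ∧ x.st n = x.dep m := by
  by_cases hi : ∀ m < n, ¬ x.InService m (x.T n)
  · exact Or.inl ⟨hi, by simp [st, ((hP n).1 hi).2]⟩
  · push Not at hi
    obtain ⟨m, hm, hs⟩ := hi
    by_cases hw : x.dep m ≤ x.T (n + 1)
    · exact Or.inr ⟨m, hm, hs, hw, by simp [st, (((hP n).2 m hm hs).1 hw).2]⟩
    · exact absurd h (((hP n).2 m hm hs).2 (not_le.1 hw)).1

lemma IsP2.dep_of_not_psi (hP : x.IsP2) {n : ℤ} (h : ¬ x.ψ n) : x.dep n = x.T (n + 1) := by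
  by_cases hi : ∀ m < n, ¬ x.InService m (x.T n)
  · exact absurd ((hP n).1 hi).1 h
  · push Not at hi
    obtain ⟨m, hm, hs⟩ := hi
    by_cases hw : x.dep m ≤ x.T (n + 1)
    · exact absurd (((hP n).2 m hm hs).1 hw).1 h
    · exact (((hP n).2 m hm hs).2 (not_le.1 hw)).2

lemma IsP2.le_st (hP : x.IsP2) {n : ℤ} (h : x.ψ n) : x.T n ≤ x.st n := by
  rcases hP.cases h with ⟨_, h1⟩ | ⟨m, _, h1, _, h2⟩
  · exact h1.ge
  · rw [h2]; exact h1.2.2.le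

/-- A message that is processed has not been pushed out, so it enters service no later than the next
arrival. This is why the first arrival from the beginning of a service on is always the next label
(`IsP2.isNext`). -/
lemma IsP2.st_le_T_succ (hx : x.IsInput) (hP : x.IsP2) {n : ℤ} (h : x.ψ n) :
    x.st n ≤ x.T (n + 1) := by
  rcases hP.cases h with ⟨_, h1⟩ | ⟨m, _, _, h1, h2⟩
  · rw [h1]; exact (hx.strictMono (lt_add_one n)).le
  · rwa [h2]

lemma IsP2.st_le_T (hx : x.IsInput) (hP : x.IsP2) {m l : ℤ} (hm : x.ψ m) (hml : m < l) :
    x.st m ≤ x.T l :=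
  (hP.st_le_T_succ hx hm).trans (hx.strictMono.monotone (by omega))

lemma IsP2.dep_le_st (hx : x.IsInput) (hP : x.IsP2) {m l : ℤ} (hm : x.ψ m) (hl : x.ψ l)
    (hml : m < l) : x.dep m ≤ x.st l := by
  by_cases hd : x.dep m ≤ x.T l
  · exact hd.trans (hP.le_st hl)
  · have hs : x.InService m (x.T l) := ⟨hm, hP.st_le_T hx hm hml, not_le.1 hd⟩
    by_cases hw : x.dep m ≤ x.T (l + 1)
    · simp [st, (((hP l).2 m hml hs).1 hw).2]
    · exact absurd hl (((hP l).2 m hml hs).2 (not_le.1 hw)).1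

lemma IsP2.isNext (hx : x.IsInput) (hP : x.IsP2) {m : ℤ} (hm : x.ψ m) : x.IsNext m (m + 1) :=
  ⟨⟨lt_add_one m, hP.st_le_T_succ hx hm⟩, fun l hl => by have := hl.1; omega⟩

/-- Let `w'` be the first message after `m + 1` that arrives no earlier than the end of the service
of `m`. The next successful message is `w' - 1`: it is `m + 1` if that one finds the server idle,
and otherwise the last one to be stored, all those in between being pushed out. The cell changes its
occupant but is never empty from the arrival of `m + 1` to the end of the service, so the count is
the same as under blocking. -/
lemma IsP2.regular (hx : x.IsInput) (hP : x.IsP2) : x.Regular false := by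
  have hsize := hx.size_pos
  refine ⟨hx, fun m l => hP.dep_le_st hx, ?_, ?_, ?_⟩
  · intro n
    by_cases hi : ∀ m < n, ¬ x.InService m (x.T n)
    · obtain ⟨h1, h2⟩ := (hP n).1 hi
      exact ⟨n, le_rfl, h1, by linarith, by have := hsize n; linarith⟩
    · push Not at hi
      obtain ⟨m, h1, h2⟩ := hi
      exact ⟨m, h1.le, h2⟩
  · intro m w hm hw
    obtain rfl : w = m + 1 := hw.unique (hP.isNext hx hm)
    obtain ⟨w', hw'⟩ := hx.exists_isLeast (m + 1) (x.dep m)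
    have hlt : m + 1 ≤ w' - 1 := by have := hw'.1.1; omega
    have hTw' : x.dep m ≤ x.T (w' - 1 + 1) := by rw [sub_add_cancel]; exact hw'.1.2
    have hsm := hP.st_le_T_succ hx hm
    have key : x.ψ (w' - 1) ∧ x.st (w' - 1) = max (x.dep m) (x.T (m + 1)) ∧
        ∀ n, m < n → n < w' - 1 → ¬ x.ψ n := by
      by_cases hd : x.dep m ≤ x.T (m + 1)
      · have he : w' - 1 = m + 1 := by
          have := hw'.2 (show m + 2 ∈ {l | m + 1 < l ∧ x.dep m ≤ x.T l} from
            ⟨by omega, hd.trans (hx.strictMono.monotone (by omega))⟩)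
          omega
        have hidle : ∀ m' < m + 1, ¬ x.InService m' (x.T (m + 1)) := by
          intro m' h1 h2
          rcases (Int.lt_add_one_iff.1 h1).lt_or_eq with h | rfl
          · have := hP.dep_le_st hx h2.1 hm h
            have := h2.2.2
            linarith
          · exact absurd hd (not_le.2 h2.2.2)
        obtain ⟨h1, h2⟩ := (hP (m + 1)).1 hidle
        rw [he, max_eq_right hd]
        exact ⟨h1, by simp [st, h2], fun n _ _ => by omega⟩
      · push Not at hd
        have hbusy : ∀ n, m < n → n ≤ w' - 1 → x.InService m (x.T n) := by
          intro n h1 h2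
          refine ⟨hm, hsm.trans (hx.strictMono.monotone (by omega)), ?_⟩
          rcases (show m + 1 ≤ n by omega).lt_or_eq with h | rfl
          · by_contra hc
            have := hw'.2 ⟨h, not_lt.1 hc⟩
            omega
          · exact hd
        obtain ⟨h1, h2⟩ := ((hP (w' - 1)).2 m (by omega) (hbusy _ (by omega) le_rfl)).1 hTw'
        refine ⟨h1, by rw [max_eq_left hd.le]; simp [st, h2], fun n g1 g2 => ?_⟩
        exact (((hP n).2 m g1 (hbusy n g1 g2.le)).2
          (hbusy (n + 1) (by omega) (by omega)).2.2).1
    refine ⟨w' - 1, key.1, hlt, key.2.2, key.2.1, fun v hv => ?_⟩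
    obtain rfl : v = w' := hv.unique hw'
    refine ⟨?_, rfl⟩
    have := hP.isNext hx key.1
    rwa [sub_add_cancel] at this
  · intro m w t hm hw h1 h2
    obtain rfl : w = m + 1 := hw.unique (hP.isNext hx hm)
    have hTm := hP.le_st hm
    have hsm := hP.st_le_T_succ hx hm
    obtain ⟨l, hl1, hl2⟩ := hx.exists_last t
    have hin : ∀ n, x.InSystem n t → n = m ∨ (m < n ∧ x.T n ≤ t) := by
      intro n hn
      rcases lt_trichotomy n m with h | h | h
      · have := hn.2
        by_cases hnψ : x.ψ n
        · have := hP.dep_le_st hx hnψ hm h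
          linarith
        · have h3 := hP.dep_of_not_psi hnψ
          have : x.T (n + 1) ≤ x.T m := hx.strictMono.monotone (by omega)
          linarith
      · exact Or.inl h
      · exact Or.inr ⟨h, hn.1⟩
    -- During the service of `m` the only later message present is the latest arrival `l`; those
    -- before it have been pushed out.
    have hdep : ∀ n, m < n → x.T n ≤ t → t < x.dep m → (x.InSystem n t ↔ n = l) := by
      intro n hmn hn hd
      have hs : x.InService m (x.T n) := ⟨hm, hP.st_le_T hx hm hmn, by linarith⟩
      have hnl : n < l + 1 := hx.strictMono.lt_iff_lt.1 (by linarith)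
      constructor
      · intro h
        by_contra hc
        have h3 : x.T (n + 1) ≤ t := (hx.strictMono.monotone (by omega)).trans hl1
        have h4 := (((hP n).2 m hmn hs).2 (by linarith)).2
        have := h.2
        linarith
      · rintro rfl
        refine ⟨hn, ?_⟩
        by_cases hw : x.dep m ≤ x.T (n + 1)
        · have h4 := (((hP n).2 m hmn hs).1 hw).2
          have := hsize n
          linarith
        · have h4 := (((hP n).2 m hmn hs).2 (not_le.1 hw)).2
          linarith
    unfold numInSystem
    split_ifs with hd hT
    · have hml : m < l := by
        have : m + 1 < l + 1 := hx.strictMono.lt_iff_lt.1 (by linarith)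
        omega
      have : {n : ℤ | x.InSystem n t} = {m, l} := by
        ext n
        constructor
        · intro hn
          rcases hin n hn with h | h
          · exact Or.inl h
          · exact Or.inr ((hdep n h.1 h.2 hd).1 hn)
        · rintro (rfl | rfl)
          · exact ⟨hTm.trans h1, hd⟩
          · exact (hdep n hml hl1 hd).2 rfl
      rw [this, ncard_pair hml.ne]
    · have : {n : ℤ | x.InSystem n t} = {m} := by
        ext n
        constructor
        · intro hn
          rcases hin n hn with h | h
          · exact h
          · exact absurd ((hx.strictMono.monotone (by omega)).trans h.2) hT
        · rintro rfl
          exact ⟨hTm.trans h1, hd⟩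
      rw [this, ncard_singleton]
    · have : {n : ℤ | x.InSystem n t} = ∅ := by
        ext n
        refine ⟨fun hn => ?_, fun h => h.elim⟩
        rcases hin n hn with rfl | h
        · exact hd hn.2
        · rcases lt_max_iff.1 h2 with h' | h'
          · exact hd h'
          · have : x.T (m + 1) ≤ x.T n := hx.strictMono.monotone (by omega)
            linarith
      rw [this, ncard_empty]

end P2

end MessageFlow

end AoI

end

/-! ### Measurable enumeration of the successful messages. -/

noncomputable section

namespace AoI

section Pick

variable {ι : Type*} [Countable ι] [Nonempty ι]

open Classical in
/-- An element of a countable type which satisfies `p`, if there is one. -/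
def pick (p : ι → Prop) : ι :=
  if h : ∃ k, p ((exists_surjective_nat ι).choose k) then
    (exists_surjective_nat ι).choose (Nat.find h)
  else Classical.arbitrary ι

lemma pick_spec {p : ι → Prop} (h : ∃ i, p i) : p (pick p) := by
  classical
  obtain ⟨i, hi⟩ := h
  obtain ⟨k, hk⟩ := (exists_surjective_nat ι).choose_spec i
  have h' : ∃ k, p ((exists_surjective_nat ι).choose k) := ⟨k, hk ▸ hi⟩
  rw [pick, dif_pos h']
  exact Nat.find_spec h'

lemma pick_eq {p : ι → Prop} {i : ι} (h : p i) (hu : ∀ j, p j → j = i) : pick p = i :=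
  hu _ (pick_spec ⟨i, h⟩)

/-- Taking the first hit in a fixed enumeration keeps the choice measurable even where the predicate
holds for several indices or for none. -/
lemma measurable_pick {α : Type*} [MeasurableSpace α] [MeasurableSpace ι] {p : α → ι → Prop}
    (hp : ∀ i, MeasurableSet {a | p a i}) : Measurable fun a => pick (p a) := by
  classical
  set e := (exists_surjective_nat ι).choose
  have hq : ∀ k, MeasurableSet {a | p a (e k) ∨ ∀ k, ¬ p a (e k)} := by
    intro k
    have : {a | p a (e k) ∨ ∀ k, ¬ p a (e k)} = {a | p a (e k)} ∪ ⋂ k, {a | p a (e k)}ᶜ := by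
      ext; simp
    rw [this]
    exact (hp _).union (MeasurableSet.iInter fun k => (hp _).compl)
  have hex : ∀ a, ∃ k, p a (e k) ∨ ∀ k, ¬ p a (e k) := by
    intro a
    by_cases h : ∃ k, p a (e k)
    · exact ⟨h.choose, Or.inl h.choose_spec⟩
    · exact ⟨0, Or.inr (not_exists.1 h)⟩
  have hE : MeasurableSet {a | ∃ k, p a (e k)} := by
    have : {a | ∃ k, p a (e k)} = ⋃ k, {a | p a (e k)} := by ext; simp
    rw [this]
    exact MeasurableSet.iUnion fun k => hp _
  have hf : Measurable fun a => if ∃ k, p a (e k) then e (Nat.find (hex a))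
      else Classical.arbitrary ι :=
    Measurable.ite hE (Measurable.find (f := fun k _ => e k) (fun _ => measurable_const) hq hex)
      measurable_const
  convert hf using 2 with a
  unfold pick
  by_cases h : ∃ k, p a (e k)
  · rw [dif_pos h, if_pos h]
    refine congrArg e ?_
    refine le_antisymm (Nat.find_min' _ ?_) (Nat.find_min' _ (Or.inl (Nat.find_spec h)))
    rcases Nat.find_spec (hex a) with h' | h'
    · exact h'
    · exact absurd h (not_exists.2 h')
  · rw [dif_neg h, if_neg h]

end Pick

/-- A nonempty set of integers without least or greatest element is a locally finite linear order
without end points, hence order isomorphic to `ℤ`. -/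
lemma exists_strictMono_range_int {p : ℤ → Prop} (h1 : ∀ n, ∃ m < n, p m)
    (h2 : ∀ n, ∃ m, n < m ∧ p m) : ∃ j : ℤ → ℤ, StrictMono j ∧ ∀ n, p n ↔ n ∈ range j := by
  classical
  have : NoMaxOrder {n // p n} := ⟨fun a => by
    obtain ⟨m, hm, hp⟩ := h2 a
    exact ⟨⟨m, hp⟩, hm⟩⟩
  have : NoMinOrder {n // p n} := ⟨fun a => by
    obtain ⟨m, hm, hp⟩ := h1 a
    exact ⟨⟨m, hp⟩, hm⟩⟩
  have : Nonempty {n // p n} := by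
    obtain ⟨m, hm, hp⟩ := h1 0
    exact ⟨⟨m, hp⟩⟩
  let _ : SuccOrder {n // p n} := LinearLocallyFiniteOrder.succOrder _
  let _ : PredOrder {n // p n} := LinearLocallyFiniteOrder.predOrder _
  let f : {n // p n} ≃o ℤ := orderIsoIntOfLinearSuccPredArch
  refine ⟨fun i => (f.symm i : ℤ), fun a b h => f.symm.strictMono h, fun n => ⟨fun h => ?_, ?_⟩⟩
  · exact ⟨f ⟨n, h⟩, by simp⟩
  · rintro ⟨i, rfl⟩
    exact (f.symm i).2

namespace MessageFlow

variable {x : MessageFlow} {b : Bool}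

/-- `j` enumerates the successful messages, those with labels `≤ 0` being the ones which have left
up to time `0`. -/
structure IsCycleEnum (x : MessageFlow) (j : ℤ → ℤ) : Prop where
  strictMono : StrictMono j
  psi_iff : ∀ n, x.ψ n ↔ n ∈ range j
  nonpos : x.dep (j 0) ≤ 0
  pos : 0 < x.dep (j 1)

lemma Regular.dep_lt_dep (h : x.Regular b) {m l : ℤ} (hm : x.ψ m) (hl : x.ψ l) (hml : m < l) :
    x.dep m < x.dep l :=
  (h.dep_le_st m l hm hl hml).trans_lt (st_lt_dep h.toIsInput l)

/-- By `busy` there are successful messages arbitrarily far in the past, and `succ` excludes a last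
one. The labels are then shifted so that `0` goes to the last successful departure up to time `0`.
-/
lemma Regular.exists_enum (h : x.Regular b) : ∃ j, x.IsCycleEnum j := by
  have hbelow : ∀ n, ∃ m < n, x.ψ m := fun n => by
    obtain ⟨m, hm, hs⟩ := h.busy (n - 1)
    exact ⟨m, by omega, hs.1⟩
  have habove : ∀ n, ∃ m, n < m ∧ x.ψ m := by
    intro n
    obtain ⟨m, hm, hs⟩ := h.busy n
    by_contra! hc
    obtain ⟨g, hg, hgm⟩ := exists_isGreatest_int (p := fun l => x.ψ l)
      ⟨n, fun l hl => by by_contra hl'; exact hc l (by omega) hl⟩ ⟨m, hs.1⟩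
    obtain ⟨w, hw⟩ := h.exists_isNext g
    obtain ⟨m', h1, h2, -⟩ := h.succ g w hg hw
    have := hgm h1
    have := hw.1.1
    omega
  obtain ⟨j, hj, hr⟩ := exists_strictMono_range_int hbelow habove
  have hψ : ∀ i, x.ψ (j i) := fun i => (hr _).2 ⟨i, rfl⟩
  have hneg : ∃ i, x.dep (j i) ≤ 0 := by
    obtain ⟨n, hn⟩ := (h.tendsto_atBot.eventually_le_atBot 0).exists
    obtain ⟨m, hm, hs⟩ := h.busy n
    obtain ⟨l, hl, hψl⟩ := hbelow m
    obtain ⟨i, rfl⟩ := (hr l).1 hψl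
    refine ⟨i, ?_⟩
    have := h.dep_le_st _ _ hψl hs.1 hl
    have := hs.2.1
    simp only [st] at *
    linarith
  have hpos : ∃ i, 0 < x.dep (j i) := by
    obtain ⟨n, hn⟩ := (h.tendsto_atTop.eventually_gt_atTop 0).exists
    obtain ⟨m, hm, hs⟩ := h.busy n
    obtain ⟨i, rfl⟩ := (hr m).1 hs.1
    have := hs.2.2
    exact ⟨i, by linarith⟩
  have hmono : StrictMono fun i => x.dep (j i) := fun a b hab =>
    h.dep_lt_dep (hψ a) (hψ b) (hj hab)
  obtain ⟨i0, hi0, hg⟩ := exists_isGreatest_int (p := fun i => x.dep (j i) ≤ 0)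
    (by
      obtain ⟨i, hi⟩ := hpos
      exact ⟨i, fun l hl => hmono.le_iff_le.1 (hl.trans hi.le)⟩) hneg
  refine ⟨fun i => j (i + i0), fun a b hab => hj (by omega), fun n => ?_, by simpa using hi0, ?_⟩
  · rw [hr]
    exact ⟨fun ⟨i, hi⟩ => ⟨i - i0, by simpa using hi⟩, fun ⟨i, hi⟩ => ⟨_, hi⟩⟩
  · by_contra hc
    have := hg (show 1 + i0 ∈ {i | x.dep (j i) ≤ 0} from not_lt.1 hc)
    omega

/-- The `k`-th successful message after the last one which has left up to time `0`. -/
def idxUp (x : MessageFlow) : ℕ → ℤ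
  | 0 => pick fun n : ℤ => x.ψ n ∧ x.dep n ≤ 0 ∧ ∀ l > n, x.ψ l → 0 < x.dep l
  | k + 1 => pick fun n : ℤ => x.ψ n ∧ idxUp x k < n ∧ ∀ l, idxUp x k < l → l < n → ¬ x.ψ l

/-- The `k`-th successful message before the last one which has left up to time `0`. -/
def idxDown (x : MessageFlow) : ℕ → ℤ
  | 0 => idxUp x 0
  | k + 1 => pick fun n : ℤ => x.ψ n ∧ n < idxDown x k ∧ ∀ l, n < l → l < idxDown x k → ¬ x.ψ l

/-- The enumeration of the successful messages. -/
def idx (x : MessageFlow) : ℤ → ℤ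
  | .ofNat k => idxUp x k
  | .negSucc k => idxDown x (k + 1)

lemma IsCycleEnum.psi {j : ℤ → ℤ} (hj : x.IsCycleEnum j) (i : ℤ) : x.ψ (j i) :=
  (hj.psi_iff _).2 ⟨i, rfl⟩

/-- Successful messages leave in the order in which they arrive. -/
def DepMono (x : MessageFlow) : Prop := ∀ m l, x.ψ m → x.ψ l → m < l → x.dep m < x.dep l

/-- The enumeration of `Regular.exists_enum` comes from an existence statement, whereas `idx` is
measurable by construction. Identifying the two lets `cyc` be measurable and still obey the
dynamics. -/
lemma IsCycleEnum.idx_eq {j : ℤ → ℤ} (hj : x.IsCycleEnum j) (hd : x.DepMono) (i : ℤ) :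
    x.idx i = j i := by
  have hno : ∀ i l, j i < l → l < j (i + 1) → ¬ x.ψ l := by
    intro i l h1 h2 h3
    obtain ⟨k, rfl⟩ := (hj.psi_iff l).1 h3
    have := hj.strictMono.lt_iff_lt.1 h1
    have := hj.strictMono.lt_iff_lt.1 h2
    omega
  have hup : ∀ k : ℕ, x.idxUp k = j k := by
    intro k
    induction k with
    | zero =>
      refine pick_eq ⟨hj.psi _, hj.nonpos, fun l hl hψ => ?_⟩ ?_
      · obtain ⟨k, rfl⟩ := (hj.psi_iff l).1 hψ
        have h0 : (0 : ℤ) < k := hj.strictMono.lt_iff_lt.1 hl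
        rcases (show 1 ≤ k by omega).lt_or_eq with h | rfl
        · exact hj.pos.trans (hd _ _ (hj.psi _) (hj.psi _) (hj.strictMono h))
        · exact hj.pos
      · rintro n ⟨h1, h2, h3⟩
        obtain ⟨k, rfl⟩ := (hj.psi_iff n).1 h1
        rcases lt_trichotomy k 0 with h | rfl | h
        · exact absurd (h3 _ (hj.strictMono h) (hj.psi _)) (not_lt.2 hj.nonpos)
        · rfl
        · exfalso
          rcases (show 1 ≤ k by omega).lt_or_eq with h | rfl
          · have := hd _ _ (hj.psi 1) (hj.psi _) (hj.strictMono h)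
            have := hj.pos
            linarith
          · have := hj.pos
            linarith
    | succ k ih =>
      rw [idxUp, ih]
      refine pick_eq ⟨hj.psi _, hj.strictMono (by omega), fun l h1 h2 => ?_⟩ ?_
      · exact hno k l h1 (by exact_mod_cast h2)
      · rintro n ⟨h1, h2, h3⟩
        obtain ⟨i, rfl⟩ := (hj.psi_iff n).1 h1
        have h4 := hj.strictMono.lt_iff_lt.1 h2
        rcases (show (k : ℤ) + 1 ≤ i by omega).lt_or_eq with h | rfl
        · exact absurd (hj.psi _) (h3 (j (k + 1)) (hj.strictMono (by omega)) (hj.strictMono h))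
        · push_cast; rfl
  have hdown : ∀ k : ℕ, x.idxDown k = j (-k) := by
    intro k
    induction k with
    | zero => rw [idxDown, hup]; simp
    | succ k ih =>
      rw [idxDown, ih]
      refine pick_eq ⟨hj.psi _, hj.strictMono (by omega), fun l h1 h2 => ?_⟩ ?_
      · refine hno (-((k + 1 : ℕ) : ℤ)) l h1 ?_
        rwa [show -((k + 1 : ℕ) : ℤ) + 1 = -k by push_cast; ring]
      · rintro n ⟨h1, h2, h3⟩
        obtain ⟨i, rfl⟩ := (hj.psi_iff n).1 h1
        have h4 := hj.strictMono.lt_iff_lt.1 h2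
        rcases (show i ≤ -((k + 1 : ℕ) : ℤ) by omega).lt_or_eq with h | rfl
        · exact absurd (hj.psi _) (h3 _ (hj.strictMono h) (hj.strictMono (by omega)))
        · rfl
  cases i with
  | ofNat k => exact hup k
  | negSucc k => exact hdown (k + 1)

/-- The first message after message `m` which arrives from the beginning of the service of
message `m` on. -/
def next (x : MessageFlow) (m : ℤ) : ℤ := pick fun w => x.IsNext m w

lemma IsNext.next_eq {m w : ℤ} (h : x.IsNext m w) : x.next m = w :=
  pick_eq h fun _ hj => hj.unique h

lemma Regular.isNext_next (h : x.Regular b) (m : ℤ) : x.IsNext m (x.next m) := by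
  obtain ⟨w, hw⟩ := h.exists_isNext m
  rwa [hw.next_eq]

/-- The services: the times at which they begin, the times from then on to the next arrival, and
their durations. -/
def cyc (x : MessageFlow) (i : ℤ) : ℝ × ℝ × ℝ :=
  (x.st (x.idx i), x.T (x.next (x.idx i)) - x.st (x.idx i), x.size (x.idx i))

section Measurability

lemma measurable_marked : Measurable marked := comap_measurable marked

@[fun_prop]
lemma measurable_T (n : ℤ) : Measurable fun x : MessageFlow => x.T n :=
  ((measurable_pi_apply n).comp measurable_marked).fst

@[fun_prop]
lemma measurable_size (n : ℤ) : Measurable fun x : MessageFlow => x.size n :=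
  ((measurable_pi_apply n).comp measurable_marked).snd.fst

@[fun_prop]
lemma measurable_dep (n : ℤ) : Measurable fun x : MessageFlow => x.dep n :=
  (measurable_T n).add ((measurable_pi_apply n).comp measurable_marked).snd.snd.fst

@[fun_prop]
lemma measurable_st (n : ℤ) : Measurable fun x : MessageFlow => x.st n :=
  (measurable_dep n).sub (measurable_size n)

lemma measurable_psi (n : ℤ) : Measurable fun x : MessageFlow => x.ψ n :=
  ((measurable_pi_apply n).comp measurable_marked).snd.snd.snd

lemma measurable_idxUp (k : ℕ) : Measurable fun x : MessageFlow => x.idxUp k := by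
  induction k with
  | zero =>
    refine measurable_pick fun n => measurableSet_setOfPred.2 ?_
    refine (measurable_psi n).and (Measurable.and ?_ (Measurable.forall fun l =>
      measurable_const.imp ((measurable_psi l).imp ?_)))
    · exact measurableSet_setOfPred.1 (measurableSet_le (by fun_prop) (by fun_prop))
    · exact measurableSet_setOfPred.1 (measurableSet_lt (by fun_prop) (by fun_prop))
  | succ k ih =>
    refine measurable_pick fun n => measurableSet_setOfPred.2 ?_
    refine (measurable_psi n).and (Measurable.and ?_ (Measurable.forall fun l =>
      Measurable.imp ?_ (measurable_const.imp (measurable_psi l).not)))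
    · exact measurableSet_setOfPred.1 (measurableSet_lt ih measurable_const)
    · exact measurableSet_setOfPred.1 (measurableSet_lt ih measurable_const)

lemma measurable_idxDown (k : ℕ) : Measurable fun x : MessageFlow => x.idxDown k := by
  induction k with
  | zero => exact measurable_idxUp 0
  | succ k ih =>
    refine measurable_pick fun n => measurableSet_setOfPred.2 ?_
    refine (measurable_psi n).and (Measurable.and ?_ (Measurable.forall fun l =>
      measurable_const.imp (Measurable.imp ?_ (measurable_psi l).not)))
    · exact measurableSet_setOfPred.1 (measurableSet_lt measurable_const ih)
    · exact measurableSet_setOfPred.1 (measurableSet_lt measurable_const ih)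

lemma measurable_idx (i : ℤ) : Measurable fun x : MessageFlow => x.idx i := by
  cases i with
  | ofNat k => exact measurable_idxUp k
  | negSucc k => exact measurable_idxDown (k + 1)

lemma measurable_next (m : ℤ) : Measurable fun x : MessageFlow => x.next m := by
  refine measurable_pick fun w => ?_
  have : {x : MessageFlow | x.IsNext m w} = {x | (m < w ∧ x.st m ≤ x.T w) ∧
      ∀ l, m < l → x.st m ≤ x.T l → w ≤ l} := by
    ext x
    simp only [IsNext, IsLeast, lowerBounds, mem_ofPred_eq, and_imp]
  rw [this]
  refine measurableSet_setOfPred.2 ((measurable_const.and ?_).and (Measurable.forall fun l =>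
    measurable_const.imp (Measurable.imp ?_ measurable_const)))
  · exact measurableSet_setOfPred.1 (measurableSet_le (by fun_prop) (by fun_prop))
  · exact measurableSet_setOfPred.1 (measurableSet_le (by fun_prop) (by fun_prop))

lemma measurable_apply_idx {β : Type*} [MeasurableSpace β] {f : MessageFlow → ℤ → β}
    (hf : ∀ n, Measurable fun x => f x n) (i : ℤ) :
    Measurable fun x : MessageFlow => f x (x.idx i) :=
  (measurable_from_prod_countable_left (f := fun p : MessageFlow × ℤ => f p.1 p.2) hf).comp
    (measurable_id.prodMk (measurable_idx i))

lemma measurable_cyc : Measurable cyc := by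
  refine measurable_pi_lambda _ fun i => ?_
  have h : ∀ n, Measurable fun x : MessageFlow => x.T (x.next n) := fun n =>
    (measurable_from_prod_countable_left (f := fun p : MessageFlow × ℤ => p.1.T p.2)
      fun n => measurable_T n).comp (measurable_id.prodMk (measurable_next n))
  exact measurable_apply_idx (f := fun x n => (x.st n, x.T (x.next n) - x.st n, x.size n))
    (fun n => (measurable_st n).prodMk (((h n).sub (measurable_st n)).prodMk (measurable_size n))) i

end Measurability

end MessageFlow

end AoI

end

/-! ### The sequence of services as a description of the whole system. -/

noncomputable section

namespace AoI

section Cycles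

/-- The beginning of service `i`. -/
def beg (y : ℤ → ℝ × ℝ × ℝ) (i : ℤ) : ℝ := (y i).1

/-- The first arrival after the beginning of service `i`. -/
def arr (y : ℤ → ℝ × ℝ × ℝ) (i : ℤ) : ℝ := (y i).1 + (y i).2.1

/-- The end of service `i`. -/
def dpt (y : ℤ → ℝ × ℝ × ℝ) (i : ℤ) : ℝ := (y i).1 + (y i).2.2

open Classical in
/-- The number of messages in the system at time `t`. -/
def num (y : ℤ → ℝ × ℝ × ℝ) (t : ℝ) : ℕ :=
  if ∃ i, arr y i ≤ t ∧ t < dpt y i then 2 else if ∃ i, beg y i ≤ t ∧ t < dpt y i then 1 else 0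

/-- A service begins when the previous one has ended and a message has arrived in the meantime. -/
structure IsCyc (y : ℤ → ℝ × ℝ × ℝ) : Prop where
  beg_succ : ∀ i, beg y (i + 1) = max (arr y i) (dpt y i)
  beg_le_arr : ∀ i, beg y i ≤ arr y i
  beg_lt_dpt : ∀ i, beg y i < dpt y i

variable {y : ℤ → ℝ × ℝ × ℝ}

lemma IsCyc.strictMono_beg (h : IsCyc y) : StrictMono (beg y) :=
  strictMono_int_of_lt_succ fun i => by
    rw [h.beg_succ]; exact (h.beg_lt_dpt i).trans_le (le_max_right _ _)

lemma IsCyc.dpt_le_beg (h : IsCyc y) {i k : ℤ} (hik : i < k) : dpt y i ≤ beg y k :=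
  ((le_max_right _ _).trans (h.beg_succ i).ge).trans (h.strictMono_beg.monotone (by omega))

lemma IsCyc.strictMono_dpt (h : IsCyc y) : StrictMono (dpt y) := fun _ k hik =>
  (h.dpt_le_beg hik).trans_lt (h.beg_lt_dpt k)

/-- Services do not overlap, so at time `t` no service other than `i` can be in progress. -/
lemma IsCyc.num_eq (h : IsCyc y) {i : ℤ} {t : ℝ} (h1 : beg y i ≤ t) (h2 : t < beg y (i + 1)) :
    num y t = if t < dpt y i then (if arr y i ≤ t then 2 else 1) else 0 := by
  have hu : ∀ k, beg y k ≤ t → t < dpt y k → k = i := by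
    intro k g1 g2
    rcases lt_trichotomy k i with hk | hk | hk
    · have := h.dpt_le_beg hk; linarith
    · exact hk
    · have := h.strictMono_beg.monotone (show i + 1 ≤ k by omega); linarith
  unfold num
  by_cases hd : t < dpt y i
  · rw [if_pos hd]
    by_cases ha : arr y i ≤ t
    · rw [if_pos ha, if_pos ⟨i, ha, hd⟩]
    · rw [if_neg ha, if_neg, if_pos ⟨i, h1, hd⟩]
      rintro ⟨k, g1, g2⟩
      obtain rfl := hu k ((h.beg_le_arr k).trans g1) g2
      exact ha g1
  · rw [if_neg hd, if_neg, if_neg]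
    · rintro ⟨k, g1, g2⟩
      obtain rfl := hu k g1 g2
      exact hd g2
    · rintro ⟨k, g1, g2⟩
      obtain rfl := hu k ((h.beg_le_arr k).trans g1) g2
      exact hd g2

/-- Change of labels. -/
def relabel (k : ℤ) (y : ℤ → ℝ × ℝ × ℝ) : ℤ → ℝ × ℝ × ℝ := fun i => y (i + k)

/-- Change of the origin of time. -/
def translate (t : ℝ) (y : ℤ → ℝ × ℝ × ℝ) : ℤ → ℝ × ℝ × ℝ := fun i => ((y i).1 - t, (y i).2)

end Cycles

namespace MessageFlow

variable {x : MessageFlow} {b : Bool}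

lemma Regular.depMono (h : x.Regular b) : x.DepMono := fun _ _ hm hl hml => h.dep_lt_dep hm hl hml

lemma IsCycleEnum.cyc_eq {j : ℤ → ℤ} (hj : x.IsCycleEnum j) (hd : x.DepMono) (i : ℤ) :
    x.cyc i = (x.st (j i), x.T (x.next (j i)) - x.st (j i), x.size (j i)) := by
  rw [cyc, hj.idx_eq hd]

lemma Regular.succ_enum (h : x.Regular b) {j : ℤ → ℤ} (hj : x.IsCycleEnum j) (i : ℤ) :
    x.next (j i) ≤ j (i + 1) ∧ x.st (j (i + 1)) = max (x.dep (j i)) (x.T (x.next (j i))) ∧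
    ∀ w', IsLeast {l | x.next (j i) < l ∧ x.dep (j i) ≤ x.T l} w' →
      x.next (j (i + 1)) = w' ∧ j (i + 1) = if b then x.next (j i) else w' - 1 := by
  obtain ⟨m', h1, h2, h3, h4, h5⟩ := h.succ _ _ (hj.psi i) (h.isNext_next _)
  have hlt : j i < m' := (h.isNext_next (j i)).1.1.trans_le h2
  have he : m' = j (i + 1) := by
    obtain ⟨k, rfl⟩ := (hj.psi_iff m').1 h1
    have h6 := hj.strictMono.lt_iff_lt.1 hlt
    rcases (show i + 1 ≤ k by omega).lt_or_eq with h' | rfl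
    · exact absurd (hj.psi _) (h3 _ (hj.strictMono (by omega)) (hj.strictMono h'))
    · rfl
  subst he
  exact ⟨h2, h4, fun w' hw' => ⟨(h5 w' hw').1.next_eq, (h5 w' hw').2⟩⟩

section

variable {j : ℤ → ℤ}

lemma IsCycleEnum.beg_cyc (hj : x.IsCycleEnum j) (hd : x.DepMono) (i : ℤ) :
    beg x.cyc i = x.st (j i) := by rw [beg, hj.cyc_eq hd]

lemma IsCycleEnum.arr_cyc (hj : x.IsCycleEnum j) (hd : x.DepMono) (i : ℤ) :
    arr x.cyc i = x.T (x.next (j i)) := by rw [arr, hj.cyc_eq hd]; simp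

lemma IsCycleEnum.dpt_cyc (hj : x.IsCycleEnum j) (hd : x.DepMono) (i : ℤ) :
    dpt x.cyc i = x.dep (j i) := by rw [dpt, hj.cyc_eq hd]; simp [st]

end

lemma Regular.isCyc (h : x.Regular b) : IsCyc x.cyc := by
  obtain ⟨j, hj⟩ := h.exists_enum
  refine ⟨fun i => ?_, fun i => ?_, fun i => ?_⟩
  · rw [hj.beg_cyc h.depMono, hj.arr_cyc h.depMono, hj.dpt_cyc h.depMono, (h.succ_enum hj i).2.1,
      max_comm]
  · rw [hj.beg_cyc h.depMono, hj.arr_cyc h.depMono]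
    exact (h.isNext_next _).1.2
  · rw [hj.beg_cyc h.depMono, hj.dpt_cyc h.depMono]
    exact st_lt_dep h.toIsInput _

lemma Regular.dpt_cyc_zero (h : x.Regular b) : dpt x.cyc 0 ≤ 0 := by
  obtain ⟨j, hj⟩ := h.exists_enum
  rw [hj.dpt_cyc h.depMono]; exact hj.nonpos

lemma Regular.dpt_cyc_one (h : x.Regular b) : 0 < dpt x.cyc 1 := by
  obtain ⟨j, hj⟩ := h.exists_enum
  rw [hj.dpt_cyc h.depMono]; exact hj.pos

lemma Regular.isEnumeration (h : x.Regular b) : IsEnumeration x.successEpochs (dpt x.cyc) := by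
  obtain ⟨j, hj⟩ := h.exists_enum
  refine ⟨h.isCyc.strictMono_dpt, ?_, h.dpt_cyc_zero, h.dpt_cyc_one⟩
  ext t
  constructor
  · rintro ⟨i, rfl⟩
    exact ⟨j i, hj.psi i, (hj.dpt_cyc h.depMono i).symm⟩
  · rintro ⟨n, hn, rfl⟩
    obtain ⟨i, rfl⟩ := (hj.psi_iff n).1 hn
    exact ⟨i, hj.dpt_cyc h.depMono i⟩

/-- The flag `b` does not occur in the formula: the number of messages depends on the policy only
through the services. This is what makes the two systems comparable. -/
lemma Regular.numInSystem_eq (h : x.Regular b) (t : ℝ) : x.numInSystem t = num x.cyc t := by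
  obtain ⟨j, hj⟩ := h.exists_enum
  have hd := h.depMono
  obtain ⟨i, hi, hg⟩ := exists_isGreatest_int (p := fun i => beg x.cyc i ≤ t) (by
      obtain ⟨n, hn⟩ := (h.tendsto_atTop.eventually_gt_atTop t).exists
      obtain ⟨m, -, hs⟩ := h.busy n
      obtain ⟨i, rfl⟩ := (hj.psi_iff m).1 hs.1
      refine ⟨i, fun l hl => ?_⟩
      by_contra hc
      have h1 := h.isCyc.dpt_le_beg (not_le.1 hc)
      rw [hj.dpt_cyc hd] at h1
      have := hs.2.2
      linarith) (by
      obtain ⟨n, hn⟩ := (h.tendsto_atBot.eventually_le_atBot t).exists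
      obtain ⟨m, -, hs⟩ := h.busy n
      obtain ⟨i, rfl⟩ := (hj.psi_iff m).1 hs.1
      exact ⟨i, by rw [hj.beg_cyc hd]; exact hs.2.1.trans hn⟩)
  have hi' : t < beg x.cyc (i + 1) := by
    by_contra hc
    have := hg (show i + 1 ∈ {i | beg x.cyc i ≤ t} from not_lt.1 hc)
    omega
  rw [h.isCyc.num_eq hi hi']
  have h1 : beg x.cyc i ≤ t := hi
  rw [hj.beg_cyc hd] at h1
  rw [hj.beg_cyc hd, (h.succ_enum hj i).2.1] at hi'
  rw [h.num_eq_ite _ _ t (hj.psi i) (h.isNext_next _) h1 hi', hj.dpt_cyc hd, hj.arr_cyc hd]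

lemma Regular.cyc_shift (h : x.Regular b) (t : ℝ) :
    ∃ k, (x.shift t).cyc = relabel k (translate t x.cyc) := by
  obtain ⟨j, hj⟩ := h.exists_enum
  -- The value of `L` plays no role, since `shift` moves all message labels by the same amount. The
  -- services are relabelled by `k`, the label of the last successful departure up to time `t`.
  set L := x.lastArrival t with hL
  have hdep : ∀ n, (x.shift t).dep n = x.dep (L + n) - t := fun n => by
    simp only [dep, shift]; ring
  have hψ : ∀ n, (x.shift t).ψ n = x.ψ (L + n) := fun n => rfl
  have hst : ∀ n, (x.shift t).st n = x.st (L + n) - t := fun n => by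
    rw [st, hdep, st]; simp only [shift]; ring
  have hmono : StrictMono fun i => x.dep (j i) := fun a c hac =>
    h.dep_lt_dep (hj.psi a) (hj.psi c) (hj.strictMono hac)
  obtain ⟨k, hk, hg⟩ := exists_isGreatest_int (p := fun i => x.dep (j i) ≤ t) (by
      obtain ⟨n, hn⟩ := (h.tendsto_atTop.eventually_gt_atTop t).exists
      obtain ⟨m, -, hs⟩ := h.busy n
      obtain ⟨i, rfl⟩ := (hj.psi_iff m).1 hs.1
      exact ⟨i, fun l hl => hmono.le_iff_le.1 (hl.trans (hn.le.trans hs.2.2.le))⟩) (by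
      obtain ⟨n, hn⟩ := (h.tendsto_atBot.eventually_le_atBot t).exists
      obtain ⟨m, -, hs⟩ := h.busy n
      obtain ⟨i, rfl⟩ := (hj.psi_iff m).1 hs.1
      refine ⟨i - 1, ?_⟩
      have := h.dep_le_st _ _ (hj.psi (i - 1)) (hj.psi i) (hj.strictMono (by omega))
      have := hs.2.1
      simp only [st] at *
      linarith)
  have hk' : t < x.dep (j (k + 1)) := by
    by_contra hc
    have := hg (show k + 1 ∈ {i | x.dep (j i) ≤ t} from not_lt.1 hc)
    omega
  have hk0 : x.dep (j k) ≤ t := hk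
  have hj' : (x.shift t).IsCycleEnum fun i => j (i + k) - L := by
    refine ⟨fun a c hac => ?_, fun n => ?_, ?_, ?_⟩
    · have := hj.strictMono (show a + k < c + k by omega)
      change j (a + k) - L < j (c + k) - L
      omega
    · rw [hψ, hj.psi_iff]
      constructor
      · rintro ⟨i, hi⟩
        exact ⟨i - k, by simp [hi]⟩
      · rintro ⟨i, hi⟩
        exact ⟨i + k, by simp only at hi; omega⟩
    · rw [hdep]; simp only [add_sub_cancel, zero_add]; linarith
    · rw [hdep]; simp only [add_sub_cancel]; rw [add_comm 1 k]; linarith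
  have hd' : (x.shift t).DepMono := fun m l hm hl hml => by
    rw [hdep, hdep]
    have := h.dep_lt_dep (m := L + m) (l := L + l) hm hl (by omega)
    linarith
  have hnext : ∀ n, (x.shift t).next n = x.next (L + n) - L := by
    intro n
    have h1 := h.isNext_next (L + n)
    refine IsNext.next_eq ⟨⟨by have := h1.1.1; omega, ?_⟩, fun l hl => ?_⟩
    · rw [hst]
      have := h1.1.2
      simp only [shift, ← hL, add_sub_cancel]
      linarith
    · have h2 : x.next (L + n) ≤ L + l := h1.2 ⟨by have := hl.1; omega, by
        have := hl.2
        rw [hst] at this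
        simp only [shift, ← hL] at this
        linarith⟩
      omega
  refine ⟨k, funext fun i => ?_⟩
  rw [hj'.cyc_eq hd', relabel, translate, hj.cyc_eq h.depMono, hst, hnext]
  simp only [shift, ← hL, add_sub_cancel, Prod.mk.injEq, true_and, and_true]
  ring

/-! ### The abstract step `cycleStep` is the actual dynamics. -/

section Environment

/-- The gaps between the arrivals from time `u` on, the first of which has label `w`. -/
def gapsFrom (x : MessageFlow) (u : ℝ) (w : ℤ) (k : ℕ) : ℝ :=
  x.T (w + k) - (if k = 0 then u else x.T (w + k - 1))

/-- The sizes of the messages with labels `≥ w`. -/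
def sizesFrom (x : MessageFlow) (w : ℤ) (k : ℕ) : ℝ := x.size (w + k)

/-- The environment of the service of message `m`. -/
def env (x : MessageFlow) (m : ℤ) : Env :=
  (x.size m, x.gapsFrom (x.st m) (x.next m), x.sizesFrom (x.next m))

lemma sum_gapsFrom (x : MessageFlow) (u : ℝ) (w : ℤ) (n : ℕ) :
    ∑ i ∈ Finset.range (n + 1), x.gapsFrom u w i = x.T (w + n) - u := by
  induction n with
  | zero => simp [gapsFrom]
  | succ n ih =>
    rw [Finset.sum_range_succ, ih, gapsFrom, if_neg (by omega)]
    push_cast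
    rw [show w + ((n : ℤ) + 1) - 1 = w + n by ring]
    ring

/-- The partial sums of the gaps telescope, so the level `v - u` is first reached by `w'`, the first
arrival from time `v` on. Under push-out the candidate is then the arrival just before `w'`, or `z`
if there is none. -/
lemma step_gapsFrom (b : Bool) (u v z : ℝ) (w w' : ℤ)
    (hw' : IsLeast {l | w ≤ l ∧ v ≤ x.T l} w') :
    step b (v - u) z (x.gapsFrom u w, x.sizesFrom w)
      = (if b then z else if w' = w then z else x.size (w' - 1), x.gapsFrom v w',
        x.sizesFrom w') := by
  obtain ⟨n, rfl⟩ : ∃ n : ℕ, w' = w + n := ⟨(w' - w).toNat, by have := hw'.1.1; omega⟩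
  have hhit : Hit (v - u) (x.gapsFrom u w) n := by
    refine ⟨by rw [sum_gapsFrom]; have := hw'.1.2; linarith, fun k hk => ?_⟩
    rw [sum_gapsFrom]
    by_contra hc
    have := hw'.2 (show w + (k : ℤ) ∈ {l | w ≤ l ∧ v ≤ x.T l} from ⟨by omega, by linarith⟩)
    omega
  rw [step, hhit.hitIndex_eq, stepAt, Prod.mk.injEq, Prod.mk.injEq]
  refine ⟨?_, ?_, ?_⟩
  · cases b
    · cases n with
      | zero => simp
      | succ n =>
        rw [if_neg (by simp), if_neg (by simp), if_neg (by omega)]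
        simp only [scons_succ, sizesFrom]
        congr 1; push_cast; ring
    · simp
  · funext k
    cases k with
    | zero => rw [scons_zero, sum_gapsFrom]; simp [gapsFrom]
    | succ k =>
      simp only [scons_succ, gapsFrom]
      rw [if_neg (by omega), if_neg (by omega)]
      congr 2
      · push_cast; ring
      · push_cast; ring
  · funext k
    simp only [sizesFrom]
    congr 1; push_cast; ring

lemma Regular.exists_isLeast_dep (h : x.Regular b) {j : ℤ → ℤ} (hj : x.IsCycleEnum j) (i : ℤ) :
    IsLeast {l | x.next (j i) < l ∧ x.dep (j i) ≤ x.T l} (x.next (j (i + 1))) := by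
  obtain ⟨w', hw'⟩ := h.exists_isLeast (x.next (j i)) (x.dep (j i))
  rwa [((h.succ_enum hj i).2.2 w' hw').1]

/-- The hypothesis `hu` asks only for the right beginning of the next service. So `u` and `ζ` may be
the true beginning and duration, as in `Regular.cycleStep_env`, or those of a service cut at time
`0`, as in `Regular.exists_level`. -/
lemma Regular.cycleStep_gapsFrom (h : x.Regular b) {j : ℤ → ℤ} (hj : x.IsCycleEnum j) (i : ℤ)
    (u ζ : ℝ) (hu : max (u + ζ) (x.T (x.next (j i))) = max (x.dep (j i)) (x.T (x.next (j i)))) :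
    (cycleStep b (ζ, x.gapsFrom u (x.next (j i)), x.sizesFrom (x.next (j i)))).2
      = x.env (j (i + 1)) := by
  obtain ⟨h1, h2, h3⟩ := h.succ_enum hj i
  have hw' := h.exists_isLeast_dep hj i
  obtain ⟨-, h4⟩ := h3 _ hw'
  set w := x.next (j i)
  set w' := x.next (j (i + 1)) with hw'_def
  have hg : (fun k => x.gapsFrom u w (k + 1)) = x.gapsFrom (x.T w) (w + 1) := by
    funext k
    simp only [gapsFrom]
    rw [if_neg (by omega)]
    push_cast
    rw [show w + ((k : ℤ) + 1) - 1 = w + k by ring, show w + 1 + (k : ℤ) = w + (k + 1) by ring]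
    split_ifs with hk
    · simp [hk]
    · congr 2; ring
  have hs : (fun k => x.sizesFrom w (k + 1)) = x.sizesFrom (w + 1) := by
    funext k
    simp only [sizesFrom]
    congr 1; push_cast; ring
  have hlev : max (ζ - x.gapsFrom u w 0) 0 = x.st (j (i + 1)) - x.T w := by
    rw [h2, ← hu]
    simp only [gapsFrom, if_true, Nat.cast_zero, add_zero]
    rw [← max_sub_sub_right, sub_self]
    congr 1; ring
  have hleast : IsLeast {l | w + 1 ≤ l ∧ x.st (j (i + 1)) ≤ x.T l} w' := by
    refine ⟨⟨hw'.1.1, ?_⟩, fun l hl => hw'.2 ⟨hl.1, ?_⟩⟩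
    · rw [h2]
      exact max_le hw'.1.2 (h.strictMono hw'.1.1).le
    · exact ((le_max_left _ _).trans h2.ge).trans hl.2
  simp only [cycleStep]
  rw [hg, hs, hlev, step_gapsFrom b _ _ _ _ _ hleast, env, Prod.mk.injEq]
  refine ⟨?_, rfl⟩
  cases b with
  | true =>
    simp only [if_true] at h4 ⊢
    rw [h4]; simp [sizesFrom]
  | false =>
    simp only [Bool.false_eq_true, if_false] at h4 ⊢
    rw [h4]
    split_ifs with hc
    · rw [hc]; simp [sizesFrom]
    · rfl

lemma Regular.cycleStep_env (h : x.Regular b) {j : ℤ → ℤ} (hj : x.IsCycleEnum j) (i : ℤ) :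
    cycleStep b (x.env (j i)) = ((x.cyc i).2, x.env (j (i + 1))) := by
  refine Prod.ext ?_ (h.cycleStep_gapsFrom hj i _ _ (by simp [st]))
  rw [hj.cyc_eq h.depMono]
  simp [cycleStep, env, gapsFrom]

lemma Regular.cycleSeq_env (h : x.Regular b) {j : ℤ → ℤ} (hj : x.IsCycleEnum j) (i : ℤ) (k : ℕ) :
    cycleSeq b (x.env (j i)) k = (x.cyc (i + k)).2 := by
  have hit : (fun e => (cycleStep b e).2)^[k] (x.env (j i)) = x.env (j (i + k)) := by
    induction k with
    | zero => simp
    | succ k ih =>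
      rw [Function.iterate_succ_apply', ih, h.cycleStep_env hj]
      push_cast; rw [add_assoc]
  rw [cycleSeq, hit, h.cycleStep_env hj]

end Environment

end MessageFlow

end AoI

end

/-! ### The state at time `0` as a function of the history. -/

noncomputable section

namespace AoI

section Level

/-- `q = (k, v, v')` describes the state at time `0` in terms of the history `h`: message `-k` has
left, `-v` is the first message arriving after its service has begun, `-v'` is the first message
after `-v` arriving after the end of this service, hence the first message arriving after the
beginning of the next service, and no other message has arrived since the end of that service. -/
def levelDep (b : Bool) (h : ℕ → ℝ × ℝ × ℝ × Prop) (q : ℕ × ℕ × ℕ) : ℝ :=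
  max (h q.1).2.2.1 (h q.2.1).1 + (h (if b then q.2.1 else q.2.2 + 1)).2.1

/-- Whether `q = (k, v, v')` describes the state at time `0`, in the sense explained at
`levelDep`. -/
def IsLevelTriple (b : Bool) (h : ℕ → ℝ × ℝ × ℝ × Prop) (q : ℕ × ℕ × ℕ) : Prop :=
  (h q.1).2.2.2 ∧
  (q.2.1 < q.1 ∧ (h q.1).2.2.1 - (h q.1).2.1 ≤ (h q.2.1).1 ∧
    ∀ u, q.2.1 < u → u < q.1 → (h u).1 < (h q.1).2.2.1 - (h q.1).2.1) ∧
  (q.2.2 < q.2.1 ∧ (h q.1).2.2.1 ≤ (h q.2.2).1 ∧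
    ∀ u, q.2.2 < u → u < q.2.1 → (h u).1 < (h q.1).2.2.1) ∧
  ∀ u, u < q.2.2 → (h u).1 < levelDep b h q

/-- The time from `0` to the beginning of the service in progress or of the next one, if this
service is the one of a message which has already arrived, and its residual duration. -/
def levelAt (b : Bool) (h : ℕ → ℝ × ℝ × ℝ × Prop) (q : ℕ × ℕ × ℕ) : ℝ × ℝ :=
  (max (levelDep b h q) 0,
    if 0 < levelDep b h q then (h (if b then q.2.2 else 0)).2.1
    else max 0 (max (levelDep b h q) (h q.2.2).1 + (h (if b then q.2.2 else 0)).2.1))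

/-- The quantities `levelAt`, as functions of the history alone. -/
def level (b : Bool) (h : ℕ → ℝ × ℝ × ℝ × Prop) : ℝ × ℝ := levelAt b h (pick (IsLevelTriple b h))

lemma measurable_levelDep (b : Bool) (q : ℕ × ℕ × ℕ) :
    Measurable fun h : ℕ → ℝ × ℝ × ℝ × Prop => levelDep b h q := by
  unfold levelDep; fun_prop

lemma measurable_level (b : Bool) : Measurable (level b) := by
  have h1 : Measurable fun h : ℕ → ℝ × ℝ × ℝ × Prop => pick (IsLevelTriple b h) := by
    refine measurable_pick fun q => measurableSet_setOfPred.2 ?_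
    have hd := measurable_levelDep b q
    unfold IsLevelTriple
    fun_prop
  have h2 : ∀ q, Measurable fun h : ℕ → ℝ × ℝ × ℝ × Prop => levelAt b h q := by
    intro q
    have hd := measurable_levelDep b q
    unfold levelAt
    refine Measurable.prodMk (by fun_prop) (Measurable.ite ?_ (by fun_prop) (by fun_prop))
    exact measurableSet_lt measurable_const hd
  exact (measurable_from_prod_countable_left
    (f := fun p : (ℕ → ℝ × ℝ × ℝ × Prop) × (ℕ × ℕ × ℕ) => levelAt b p.1 p.2) h2).comp
    (measurable_id.prodMk h1)

end Level

namespace MessageFlow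

variable {x : MessageFlow} {b : Bool}

/-- Take the last service whose first later arrival has a label `≤ 0`; the triple is built on the
service before it. The message of that earlier service has left by time `0`, so its success is
recorded in the history, whereas the success of the later one may not be. -/
lemma Regular.exists_isLevelTriple (h : x.Regular b) : ∃ q, IsLevelTriple b x.history q := by
  obtain ⟨j, hj⟩ := h.exists_enum
  have hlt : ∀ i, j i < x.next (j i) := fun i => (h.isNext_next _).1.1
  obtain ⟨i, hi, hg⟩ := exists_isGreatest_int (p := fun i => x.next (j i) ≤ 0) (by
      refine ⟨1, fun l hl => ?_⟩
      by_contra hc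
      have h1 := hj.strictMono (not_le.1 hc)
      have h2 := h.depMono _ _ (hj.psi 1) (hj.psi l) h1
      have h3 := h.dep_le_st _ _ (hj.psi 1) (hj.psi l) h1
      have h4 : x.T (x.next (j l)) ≤ x.T 0 := h.strictMono.monotone hl
      have h5 := (h.isNext_next (j l)).1.2
      have h6 := h.label_nonpos
      have h7 := hj.pos
      linarith) (by
      obtain ⟨m, hm, hs⟩ := h.busy 0
      obtain ⟨i, rfl⟩ := (hj.psi_iff m).1 hs.1
      exact ⟨i - 1, (h.succ_enum hj (i - 1)).1.trans (by simpa using hm)⟩)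
  have hi0 : x.next (j i) ≤ 0 := hi
  have hi1 : 0 < x.next (j (i + 1)) := by
    by_contra hc
    have := hg (show i + 1 ∈ {i | x.next (j i) ≤ 0} from not_lt.1 hc)
    omega
  obtain ⟨i', rfl⟩ : ∃ i', i = i' + 1 := ⟨i - 1, by ring⟩
  obtain ⟨h1, h2, h3⟩ := h.succ_enum hj i'
  have hw' := h.exists_isLeast_dep hj i'
  have hw'' := h.exists_isLeast_dep hj (i' + 1)
  have hjm := (h3 _ hw').2
  set m := j i'
  set w := x.next m with hw_def
  have hw : x.IsNext m w := h.isNext_next m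
  set m' := j (i' + 1)
  set w' := x.next m'
  set w'' := x.next (j (i' + 1 + 1))
  have hmw := hw.1.1
  have hww := hw'.1.1
  have hdep : x.dep m ≤ 0 := by
    have g1 := h.dep_le_st _ _ (hj.psi i') (hj.psi (i' + 1)) (hj.strictMono (by omega))
    have g2 := (h.isNext_next m').1.2
    have g3 : x.T w' ≤ x.T 0 := h.strictMono.monotone hi0
    have g4 := h.label_nonpos
    linarith
  obtain ⟨k, hk⟩ : ∃ k : ℕ, m = -k := ⟨(-m).toNat, by omega⟩
  obtain ⟨v, hv⟩ : ∃ v : ℕ, w = -v := ⟨(-w).toNat, by omega⟩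
  obtain ⟨v', hv'⟩ : ∃ v' : ℕ, w' = -v' := ⟨(-w').toNat, by omega⟩
  have hD : (x.history k).2.2.1 = x.dep m := by
    simp only [history, ← hk]; exact min_eq_left hdep
  have hlevel : levelDep b x.history (k, v, v') = x.dep m' := by
    have : x.dep m' = x.st m' + x.size m' := by simp [st]
    rw [this, h2, levelDep, hD]
    congr 1
    · simp only [history, ← hv]
    · cases b
      · simp only [Bool.false_eq_true, if_false] at hjm ⊢
        simp only [history]
        congr 1; push_cast; omega
      · simp only [if_true] at hjm ⊢
        simp only [history]
        congr 1; omega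
  refine ⟨(k, v, v'), ⟨?_, ?_⟩, ⟨by simp only; omega, ?_, ?_⟩, ⟨by simp only; omega, ?_, ?_⟩, ?_⟩
  · simp only [← hk]; exact hj.psi i'
  · simp only [← hk]; exact hdep
  · rw [hD]
    simp only [history, ← hk, ← hv]
    exact hw.1.2
  · intro u g1 g2
    rw [hD]
    simp only [history, ← hk]
    by_contra hc
    have := hw.2 (show -(u : ℤ) ∈ _ from ⟨by simp only at g2; omega, not_lt.1 hc⟩)
    simp only at g1
    omega
  · rw [hD]
    simp only [history, ← hv']
    exact hw'.1.2
  · intro u g1 g2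
    rw [hD]
    simp only [history]
    by_contra hc
    have := hw'.2 (show -(u : ℤ) ∈ _ from ⟨by simp only at g2; omega, not_lt.1 hc⟩)
    simp only at g1
    omega
  · intro u g1
    rw [hlevel]
    simp only [history]
    by_contra hc
    have := hw''.2 (show -(u : ℤ) ∈ _ from ⟨by simp only at g1; omega, not_lt.1 hc⟩)
    omega

/-- The services after time `0` in terms of the history up to time `0` and of the arrivals after
time `0`. -/
lemma Regular.exists_level (h : x.Regular b) :
    let a := (level b x.history).1
    let e := step b a (level b x.history).2 (x.gapsFrom 0 1, x.sizesFrom 1)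
    ∃ i, 0 ≤ a ∧ (∀ l < i, arr x.cyc l ≤ 0) ∧ arr x.cyc i = a + e.2.1 0 ∧
      beg x.cyc (i + 1) = a + max (e.2.1 0) e.1 ∧
      ∀ k : ℕ, (x.cyc (i + 1 + k)).2 = cycleSeq b (cycleStep b e).2 k := by
  intro a e
  obtain ⟨j, hj⟩ := h.exists_enum
  have hd := h.depMono
  obtain ⟨q, hqeq, hq⟩ : ∃ q, q = pick (IsLevelTriple b x.history) ∧
    IsLevelTriple b x.history q := ⟨_, rfl, pick_spec h.exists_isLevelTriple⟩
  have ha : a = (levelAt b x.history q).1 := by rw [hqeq]; rfl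
  have hz : (level b x.history).2 = (levelAt b x.history q).2 := by rw [hqeq]; rfl
  obtain ⟨k, v, v'⟩ := q
  obtain ⟨⟨hψ, hdep⟩, ⟨g1, g2, g3⟩, ⟨g4, g5, g6⟩, g7⟩ := hq
  simp only at hψ hdep g1 g2 g3 g4 g5 g6 g7
  obtain ⟨i', hi'⟩ := (hj.psi_iff _).1 hψ
  have hD : (x.history k).2.2.1 = x.dep (j i') := by
    rw [hi']; exact min_eq_left hdep
  have hsize : (x.history k).2.1 = x.size (j i') := by rw [hi']; rfl
  rw [hD, hsize] at g2 g3
  rw [hD] at g5 g6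
  -- Any competitor with a smaller label has also arrived already, so minimality can be verified
  -- inside the history.
  have hw : x.next (j i') = -v := by
    refine IsNext.next_eq ⟨⟨by omega, g2⟩, fun l hl => ?_⟩
    by_contra hc
    obtain ⟨u, rfl⟩ : ∃ u : ℕ, l = -u := ⟨(-l).toNat, by omega⟩
    exact absurd (g3 u (by omega) (by have := hl.1; omega)) (not_lt.2 hl.2)
  have hleast : IsLeast {l | x.next (j i') < l ∧ x.dep (j i') ≤ x.T l} (-v') := by
    rw [hw]
    refine ⟨⟨by omega, g5⟩, fun l hl => ?_⟩
    by_contra hc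
    obtain ⟨u, rfl⟩ : ∃ u : ℕ, l = -u := ⟨(-l).toNat, by omega⟩
    exact absurd (g6 u (by omega) (by have := hl.1; omega)) (not_lt.2 hl.2)
  obtain ⟨h1, h2, h3⟩ := h.succ_enum hj i'
  obtain ⟨hw', hjm⟩ := h3 _ hleast
  have hlevel : levelDep b x.history (k, v, v') = x.dep (j (i' + 1)) := by
    have : x.dep (j (i' + 1)) = x.st (j (i' + 1)) + x.size (j (i' + 1)) := by simp [st]
    rw [this, h2, levelDep, hD]
    congr 1
    · simp only [history, ← hw]
    · rw [hjm]
      cases b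
      · simp only [Bool.false_eq_true, if_false, history]
        congr 1; push_cast; ring
      · simp only [if_true, history]
        rw [hw]
  rw [hlevel] at g7
  obtain ⟨f1, f2, f3⟩ := h.succ_enum hj (i' + 1)
  have hw'' := h.exists_isLeast_dep hj (i' + 1)
  have hjm' := (f3 _ hw'').2
  -- Service `i` is the first one whose next arrival comes after time `0`.
  set i := i' + 1 + 1 with hi_def
  set w'' := x.next (j i) with hw''_def
  have hw''pos : 1 ≤ w'' := by
    by_contra hc
    obtain ⟨u, hu⟩ : ∃ u : ℕ, w'' = -u := ⟨(-w'').toNat, by omega⟩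
    have := hw''.1.1
    have h8 := hw''.1.2
    rw [hu] at h8
    exact absurd (g7 u (by omega)) (not_lt.2 h8)
  have hTpos : 0 < x.T w'' := h.label_pos.trans_le (h.strictMono.monotone hw''pos)
  set dm := x.dep (j (i' + 1)) with hdm
  have ha' : a = max dm 0 := by rw [ha, levelAt, hlevel]
  have hT0 : x.T (-v') ≤ 0 := (h.strictMono.monotone (by omega)).trans h.label_nonpos
  have hleast2 : IsLeast {l | 1 ≤ l ∧ a ≤ x.T l} w'' := by
    refine ⟨⟨hw''pos, ?_⟩, fun l hl => hw''.2 ⟨?_, ?_⟩⟩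
    · rw [ha']; exact max_le hw''.1.2 hTpos.le
    · have := hl.1; rw [hw']; omega
    · have := hl.2
      rw [ha'] at this
      exact (le_max_left _ _).trans this
  have he : e = (max (x.dep (j i)) 0 - a, x.gapsFrom a w'', x.sizesFrom w'') := by
    have hstep := step_gapsFrom b 0 a (level b x.history).2 1 w'' hleast2
    rw [sub_zero] at hstep
    refine hstep.trans (Prod.ext ?_ rfl)
    simp only
    rw [hz, levelAt, hlevel]
    have hdm2 : x.dep (j i) = x.st (j i) + x.size (j i) := by simp [st]
    rw [hw'] at f2 hjm'
    -- If `0 < dm`, service `i` begins after time `0` and has its full duration. Otherwise it began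
    -- at or before time `0` and only its remainder counts, taken to be `0` if it is already over.
    have key : (if b then (if 0 < dm then (x.history (if b then v' else 0)).2.1
          else max 0 (max dm (x.history v').1 + (x.history (if b then v' else 0)).2.1))
        else if w'' = 1 then (if 0 < dm then (x.history (if b then v' else 0)).2.1
          else max 0 (max dm (x.history v').1 + (x.history (if b then v' else 0)).2.1))
        else x.size (w'' - 1)) = if 0 < dm then x.size (j i) else max 0 (x.dep (j i)) := by
      cases b with
      | true =>
        simp only [if_true] at hjm' ⊢
        rw [hdm2, f2, hjm']
        rfl
      | false =>
        simp only [Bool.false_eq_true, if_false] at hjm' ⊢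
        split_ifs with c1 c2 c2
        · rw [hjm', c1]; simp [history]
        · rw [hdm2, f2, hjm', c1]; simp [history]
        · rw [hjm']
        -- When `dm ≤ 0` the level is `0`, which the arrival with label `1` already reaches, so this
        -- case is empty.
        · refine absurd (le_antisymm (hleast2.2 ⟨le_rfl, ?_⟩) hw''pos) c1
          rw [ha', max_eq_right (not_lt.1 c2)]
          exact h.label_pos.le
    rw [key, ha']
    split_ifs with c
    · rw [max_eq_left c.le, hdm2, f2, max_eq_left (hT0.trans c.le), max_eq_left]
      · ring
      · have := h.size_pos (j i); linarith
    · rw [max_eq_right (not_lt.1 c), sub_zero, max_comm]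
  have he0 : e.2.1 0 = x.T w'' - a := by rw [he]; simp [gapsFrom]
  -- Cutting service `i` at time `0` does not move the beginning of the next one, because the
  -- arrival `w''` comes after time `0`.
  have hmaxeq : max (a + (max (x.dep (j i)) 0 - a)) (x.T w'') = max (x.dep (j i)) (x.T w'') := by
    rw [add_sub_cancel, max_assoc, max_eq_right hTpos.le]
  obtain ⟨k1, k2, -⟩ := h.succ_enum hj i
  refine ⟨i, by rw [ha']; exact le_max_right _ _, fun l hl => ?_, ?_, ?_, fun n => ?_⟩
  · rw [hj.arr_cyc hd]
    refine (h.strictMono.monotone (show x.next (j l) ≤ 0 from ?_)).trans h.label_nonpos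
    rcases (show l ≤ i' + 1 by omega).lt_or_eq with hl' | rfl
    · have c1 := (h.succ_enum hj l).1
      have c2 := hj.strictMono.monotone (show l + 1 ≤ i' + 1 by omega)
      have c3 := (h.isNext_next (j (i' + 1))).1.1
      omega
    · omega
  · rw [hj.arr_cyc hd, he0]; ring
  · rw [hj.beg_cyc hd, k2, he0, he]
    simp only
    rw [← hmaxeq, ← max_add_add_left, max_comm]
    congr 1; ring
  · rw [← h.cycleSeq_env hj]
    congr 1
    rw [he]
    exact (h.cycleStep_gapsFrom hj i _ _ hmaxeq).symm

end MessageFlow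

end AoI

end

/-! ### Regeneration: independence of the services after time `0` from the history. -/

noncomputable section

namespace AoI

variable {lam : ℝ} {G : Measure ℝ}

/-- Stationary sequences of services whose marks, seen from the arrivals which begin an
inter-arrival period, are i.i.d. in the future. -/
structure IsCycleFlow {Ω : Type*} [MeasurableSpace Ω] (P : Measure Ω)
    (Y : Ω → ℤ → ℝ × ℝ × ℝ) (lam : ℝ) (G : Measure ℝ) : Prop where
  measurable : Measurable Y
  isCyc : ∀ᵐ ω ∂P, IsCyc (Y ω)
  dpt_zero : ∀ᵐ ω ∂P, dpt (Y ω) 0 ≤ 0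
  dpt_one : ∀ᵐ ω ∂P, 0 < dpt (Y ω) 1
  stationary : ∀ (t : ℝ) (φ : (ℤ → ℝ × ℝ × ℝ) → ℝ≥0∞), Measurable φ →
    ∫⁻ ω, ∑' k, φ (relabel k (translate t (Y ω))) ∂P = ∫⁻ ω, ∑' k, φ (relabel k (Y ω)) ∂P
  regen : ∃ m : ℝ≥0∞, m ≠ ∞ ∧ ∀ f : (ℕ → ℝ × ℝ) → ℝ≥0∞, Measurable f →
    ∫⁻ c, f c ∂(Measure.infinitePi fun _ : ℕ => cycleLaw lam G) ≠ ∞ →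
    ∫⁻ ω, ∑' i : ℤ, (Ioc 0 1).indicator (fun _ => f fun k => (Y ω (i + 1 + k)).2)
      (arr (Y ω) i) ∂P = m * ∫⁻ c, f c ∂(Measure.infinitePi fun _ : ℕ => cycleLaw lam G)

section Level

/-- At the level, the duration is independent of fresh arrivals; its law is arbitrary, since it may
be that of a residual service. For each value of it `lintegral_cycleStep` separates the first gap
from the next environment. -/
lemma lintegral_step_cycleStep (hlam : 0 < lam) [IsProbabilityMeasure G] (b : Bool) {u : ℝ}
    (hu : 0 ≤ u) (z : ℝ) {F : ℝ × ℝ → ℝ≥0∞} (hF : Measurable F) {g : Env → ℝ≥0∞}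
    (hg : Measurable g) (hg' : ∫⁻ v, g v ∂(envLaw lam G) ≠ ∞) :
    ∫⁻ D, F ((step b u z D).1, (step b u z D).2.1 0) * g (cycleStep b (step b u z D)).2
        ∂(arrivalLaw lam G)
      = (∫⁻ D, F ((step b u z D).1, (step b u z D).2.1 0) ∂(arrivalLaw lam G)) *
        ∫⁻ v, g v ∂(envLaw lam G) := by
  have := isProbabilityMeasure_arrivalLaw hlam (G := G)
  have := isProbabilityMeasure_envLaw hlam (G := G)
  have hm : Measurable fun D => step b u z D :=
    (measurable_step b).comp (by fun_prop :
      Measurable fun D : (ℕ → ℝ) × (ℕ → ℝ) => (u, z, D))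
  have hlaw : (arrivalLaw lam G).map (fun D => step b u z D)
      = ((arrivalLaw lam G).map fun D => (step b u z D).1).prod (arrivalLaw lam G) := by
    have := Measure.isProbabilityMeasure_map (μ := arrivalLaw lam G) hm.fst.aemeasurable
    refine (Measure.prod_eq fun s t hs ht => ?_).symm
    have ht' : ∫⁻ D, t.indicator 1 D ∂(arrivalLaw lam G) = arrivalLaw lam G t :=
      lintegral_indicator_one ht
    rw [← lintegral_indicator_one (hs.prod ht), lintegral_map (measurable_one.indicator
      (hs.prod ht)) hm, ← lintegral_indicator_one hs,
      lintegral_map (measurable_one.indicator hs) hm.fst, ← ht',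
      ← lintegral_step_eq_mul hlam b hu z (measurable_one.indicator hs)
        (measurable_one.indicator ht) (by rw [ht']; exact measure_ne_top _ _)]
    refine lintegral_congr fun D => ?_
    rw [← indicator_prod_one]
  have hmc := measurable_cycleStep b
  have h1 : ∀ H : Env → ℝ≥0∞, Measurable H → ∫⁻ D, H (step b u z D) ∂(arrivalLaw lam G)
      = ∫⁻ σ, ∫⁻ D, H (σ, D) ∂(arrivalLaw lam G)
        ∂((arrivalLaw lam G).map fun D => (step b u z D).1) := by
    intro H hH
    rw [← lintegral_map hH hm, hlaw, lintegral_prod _ hH.aemeasurable]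
  rw [h1 (fun v => F (v.1, v.2.1 0) * g (cycleStep b v).2)
    ((hF.comp (by fun_prop)).mul (hg.comp hmc.snd)), h1 (fun v => F (v.1, v.2.1 0))
    (hF.comp (by fun_prop)), ← lintegral_mul_const' _ _ hg']
  refine lintegral_congr fun σ => ?_
  have hFσ : Measurable fun e => F (σ, e) := hF.comp (by fun_prop)
  have h3 := lintegral_cycleStep hlam (G := G) b σ hFσ (g := fun _ => 1) measurable_const
  simp only [mul_one, lintegral_one, measure_univ] at h3
  refine (lintegral_cycleStep hlam (G := G) b σ hFσ hg).trans ?_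
  rw [← h3]

variable {Ω : Type*} [MeasurableSpace Ω] {P : Measure Ω} [IsProbabilityMeasure P]
  {X : Ω → MessageFlow}

/-- The arrivals after time `0`. -/
def arrivals (x : MessageFlow) : (ℕ → ℝ) × (ℕ → ℝ) := (x.gapsFrom 0 1, x.sizesFrom 1)

lemma measurable_arrivals : Measurable arrivals := by
  unfold arrivals MessageFlow.gapsFrom MessageFlow.sizesFrom
  refine Measurable.prodMk (measurable_pi_lambda _ fun k => ?_) (measurable_pi_lambda _ fun k => ?_)
  · split_ifs
    · fun_prop
    · fun_prop
  · fun_prop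

lemma measurable_history : Measurable MessageFlow.history := by
  refine measurable_pi_lambda _ fun k => ?_
  have h1 := MessageFlow.measurable_psi (-k)
  unfold MessageFlow.history
  exact (by fun_prop : Measurable fun x : MessageFlow => x.T (-k)).prodMk
    ((by fun_prop : Measurable fun x : MessageFlow => x.size (-k)).prodMk
    ((by fun_prop : Measurable fun x : MessageFlow => min (x.dep (-k)) 0).prodMk (by fun_prop)))

lemma map_arrivals (hX : IsStationarySystem P X lam G) :
    P.map (fun ω => arrivals (X ω)) = arrivalLaw lam G := by
  have hXm := hX.measurable
  have hga : ∀ i : ℕ, Measurable fun ω => (X ω).gap (Sum.inl i) := fun i => by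
    simp only [MessageFlow.gap]
    split_ifs
    · fun_prop
    · fun_prop
  have hgap : ∀ x : MessageFlow, x.gapsFrom 0 1 = fun k => x.gap (Sum.inl k) := by
    intro x; funext k
    simp only [MessageFlow.gapsFrom, MessageFlow.gap]
    rw [add_comm (1 : ℤ) k, add_sub_cancel_right]
  have hg : P.map (fun ω => (X ω).gapsFrom 0 1) = Measure.infinitePi fun _ : ℕ => expMeasure lam := by
    have h1 : iIndepFun (fun (k : ℕ) ω => (X ω).gap (Sum.inl k)) P :=
      hX.input.gap_indep.precomp Sum.inl_injective
    have h2 := (iIndepFun_iff_map_fun_eq_infinitePi_map hga).1 h1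
    simp_rw [hgap]
    rw [h2]
    congr 1; funext k
    exact (hX.input.gap_law _).map_eq
  have hs : P.map (fun ω => (X ω).sizesFrom 1) = Measure.infinitePi fun _ : ℕ => G := by
    have h1 : iIndepFun (fun (k : ℕ) ω => (X ω).size (1 + k)) P :=
      hX.input.size_indep.precomp (g := fun k : ℕ => (1 + k : ℤ)) fun a c hac => by simpa using hac
    have h2 := (iIndepFun_iff_map_fun_eq_infinitePi_map (fun k => by fun_prop)).1 h1
    refine h2.trans ?_
    congr 1; funext k
    exact (hX.input.size_law _).map_eq
  have hind : IndepFun (fun ω => (X ω).gapsFrom 0 1) (fun ω => (X ω).sizesFrom 1) P := by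
    have hgm : Measurable fun (T : ℤ → ℝ) (k : ℕ) => T (1 + k) - (if k = 0 then 0 else T (1 + k - 1)) := by
      refine measurable_pi_lambda _ fun k => ?_
      split_ifs <;> fun_prop
    have hsm : Measurable fun (T : ℤ → ℝ) (k : ℕ) => T (1 + k) := by fun_prop
    exact hX.input.indep.comp hgm hsm
  have hm := measurable_arrivals.comp hXm
  rw [arrivalLaw, ← hg, ← hs]
  exact (indepFun_iff_map_prod_eq_prod_map_map hm.fst.aemeasurable hm.snd.aemeasurable).1 hind

lemma map_history_arrivals (hX : IsStationarySystem P X lam G) :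
    P.map (fun ω => ((X ω).history, arrivals (X ω)))
      = (P.map fun ω => (X ω).history).prod (arrivalLaw lam G) := by
  have hXm := hX.measurable
  have hm : Measurable fun f : ℕ → ℝ × ℝ =>
      ((fun k => (f k).1 - (if k = 0 then 0 else (f (k - 1)).1) : ℕ → ℝ),
        (fun k => (f k).2 : ℕ → ℝ)) := by
    refine Measurable.prodMk (measurable_pi_lambda _ fun k => ?_) (by fun_prop)
    split_ifs <;> fun_prop
  have hind : IndepFun (fun ω => (X ω).history) (fun ω => arrivals (X ω)) P := by
    have h := hX.nonanticipating.comp measurable_id hm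
    have he : (fun ω => arrivals (X ω)) = (fun f : ℕ → ℝ × ℝ =>
        ((fun k => (f k).1 - (if k = 0 then 0 else (f (k - 1)).1) : ℕ → ℝ),
          (fun k => (f k).2 : ℕ → ℝ))) ∘ fun ω => (X ω).futureInput := by
     funext ω
     refine Prod.ext (α := ℕ → ℝ) (β := ℕ → ℝ) (funext fun k => ?_) (funext fun k => ?_)
     · simp only [arrivals, MessageFlow.gapsFrom, MessageFlow.futureInput, Function.comp_apply]
       cases k with
       | zero => simp
       | succ k =>
         simp only [Nat.succ_ne_zero, if_false, Nat.add_sub_cancel]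
         congr 2 <;> (push_cast; ring)
     · simp only [arrivals, MessageFlow.sizesFrom, MessageFlow.futureInput, Function.comp_apply]
       rw [add_comm]
    rw [he]
    exact h
  rw [← map_arrivals hX]
  exact (indepFun_iff_map_prod_eq_prod_map_map (measurable_history.comp hXm).aemeasurable
    (measurable_arrivals.comp hXm).aemeasurable).1 hind

/-- The state of the system at time `0`, up to the first arrival to come, and the subsequent
services, as functions of the history and of the arrivals after time `0`. -/
def levelEnv (b : Bool) (p : (ℕ → ℝ × ℝ × ℝ × Prop) × ((ℕ → ℝ) × (ℕ → ℝ))) : Env :=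
  step b (level b p.1).1 (level b p.1).2 p.2

lemma measurable_levelEnv (b : Bool) : Measurable (levelEnv b) :=
  (measurable_step b).comp (((measurable_level b).comp measurable_fst).fst.prodMk
    (((measurable_level b).comp measurable_fst).snd.prodMk measurable_snd))

/-- The waiting time and the residual duration of the service given by `level`, and the time from
the beginning of the service to the next arrival. -/
def levelState (b : Bool) (p : (ℕ → ℝ × ℝ × ℝ × Prop) × ((ℕ → ℝ) × (ℕ → ℝ))) : ℝ × ℝ × ℝ :=
  ((level b p.1).1, (levelEnv b p).1, (levelEnv b p).2.1 0)

lemma measurable_levelState (b : Bool) : Measurable (levelState b) := by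
  have h1 := measurable_levelEnv b
  exact ((measurable_level b).comp measurable_fst).fst.prodMk (h1.fst.prodMk
    ((measurable_pi_apply 0).comp h1.snd.fst))

/-- The marks of the services which follow the one described by `levelState`. -/
def levelSeq (b : Bool) (p : (ℕ → ℝ × ℝ × ℝ × Prop) × ((ℕ → ℝ) × (ℕ → ℝ))) : ℕ → ℝ × ℝ :=
  cycleSeq b (cycleStep b (levelEnv b p)).2

lemma measurable_levelSeq (b : Bool) : Measurable (levelSeq b) :=
  (measurable_cycleSeq b).comp ((measurable_cycleStep b).comp (measurable_levelEnv b)).snd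

/-- The law of the first service depends on the history in an unknown way, but the marks of the
following ones do not. For a fixed history this is `lintegral_step_cycleStep` together with
`map_cycleSeq`. -/
lemma map_levelState_levelSeq (hlam : 0 < lam) [IsProbabilityMeasure G] (b : Bool)
    (L : Measure (ℕ → ℝ × ℝ × ℝ × Prop)) [IsProbabilityMeasure L] :
    (L.prod (arrivalLaw lam G)).map (fun p => (levelState b p, levelSeq b p))
      = ((L.prod (arrivalLaw lam G)).map (levelState b)).prod
        (Measure.infinitePi fun _ : ℕ => cycleLaw lam G) := by
  have := isProbabilityMeasure_arrivalLaw hlam (G := G)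
  have := isProbabilityMeasure_envLaw hlam (G := G)
  have := isProbabilityMeasure_cycleLaw hlam (G := G)
  have hm1 := measurable_levelState b
  have hm2 := measurable_levelSeq b
  have := Measure.isProbabilityMeasure_map (μ := L.prod (arrivalLaw lam G)) hm1.aemeasurable
  refine (Measure.prod_eq fun s t hs ht => ?_).symm
  have hmt : MeasurableSet (cycleSeq b ⁻¹' t) := measurable_cycleSeq b ht
  have hν : ∫⁻ v, (cycleSeq b ⁻¹' t).indicator 1 v ∂(envLaw lam G)
      = (Measure.infinitePi fun _ : ℕ => cycleLaw lam G) t := by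
    rw [lintegral_indicator_one hmt, ← map_cycleSeq hlam b, Measure.map_apply
      (measurable_cycleSeq b) ht]
  rw [← hν, Measure.map_apply hm1 hs, Measure.map_apply (hm1.prodMk hm2) (hs.prod ht),
    ← lintegral_indicator_one (hm1 hs), ← lintegral_indicator_one ((hm1.prodMk hm2) (hs.prod ht)),
    lintegral_prod _ (measurable_one.indicator (hm1 hs)).aemeasurable,
    lintegral_prod _ (measurable_one.indicator ((hm1.prodMk hm2) (hs.prod ht))).aemeasurable,
    ← lintegral_mul_const' _ _ (by rw [hν]; exact measure_ne_top _ _)]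
  refine lintegral_congr fun h => ?_
  have hu : 0 ≤ (level b h).1 := le_max_right _ _
  have h1 := lintegral_step_cycleStep hlam (G := G) b hu (level b h).2
      (F := fun q => s.indicator (1 : ℝ × ℝ × ℝ → ℝ≥0∞) ((level b h).1, q))
      ((measurable_one.indicator hs).comp (by fun_prop)) (measurable_one.indicator hmt)
      (by rw [hν]; exact measure_ne_top _ _)
  refine Eq.trans (lintegral_congr fun D => ?_) h1
  refine (indicator_prod_one (s := s) (t := t) (i := levelState b (h, D))
    (j := levelSeq b (h, D))).trans ?_
  rfl

/-- The `k`-th arrival time which begins an inter-arrival period, if the first service begins at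
time `s`. -/
def arrAt (s : ℝ) (c : ℕ → ℝ × ℝ) (k : ℕ) : ℝ :=
  s + ∑ l ∈ Finset.range k, max (c l).1 (c l).2 + (c k).1

lemma measurable_arrAt (k : ℕ) : Measurable fun p : ℝ × (ℕ → ℝ × ℝ) => arrAt p.1 p.2 k := by
  unfold arrAt; fun_prop

/-- `arrAt s c k` involves the marks up to index `k` only, while `f` sees the later ones. -/
lemma lintegral_arrAt {μ : Measure (ℝ × ℝ)} [IsProbabilityMeasure μ] (k : ℕ) (s : ℝ)
    {f : (ℕ → ℝ × ℝ) → ℝ≥0∞} (hf : Measurable f)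
    (hf' : ∫⁻ c, f c ∂(Measure.infinitePi fun _ : ℕ => μ) ≠ ∞) {A : Set ℝ} (hA : MeasurableSet A) :
    ∫⁻ c, A.indicator (fun _ => f fun l => c (k + 1 + l)) (arrAt s c k)
        ∂(Measure.infinitePi fun _ : ℕ => μ)
      = (Measure.infinitePi fun _ : ℕ => μ) {c | arrAt s c k ∈ A} *
        ∫⁻ c, f c ∂(Measure.infinitePi fun _ : ℕ => μ) := by
  have hms : ∀ k (s : ℝ), Measurable fun c : ℕ → ℝ × ℝ => arrAt s c k := fun k s =>
    (measurable_arrAt k).comp (by fun_prop : Measurable fun c : ℕ → ℝ × ℝ => (s, c))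
  have hmi : ∀ k (s : ℝ), Measurable fun c : ℕ → ℝ × ℝ =>
      A.indicator (fun _ => f fun l => c (k + 1 + l)) (arrAt s c k) := fun k s =>
    (hf.comp (by fun_prop : Measurable fun (c : ℕ → ℝ × ℝ) l => c (k + 1 + l))).indicator
      (hms k s hA)
  have h1 : ∀ k s, (Measure.infinitePi fun _ : ℕ => μ) {c | arrAt s c k ∈ A}
      = ∫⁻ c, A.indicator (fun _ => 1) (arrAt s c k) ∂(Measure.infinitePi fun _ : ℕ => μ) := by
    intro k s
    change (Measure.infinitePi fun _ : ℕ => μ) ((fun c => arrAt s c k) ⁻¹' A) = _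
    rw [← lintegral_indicator_one (hms k s hA)]
    rfl
  rw [h1]
  have hmi1 : ∀ k (s : ℝ), Measurable fun c : ℕ → ℝ × ℝ =>
      A.indicator (fun _ => (1 : ℝ≥0∞)) (arrAt s c k) := fun k s =>
    measurable_const.indicator (hms k s hA)
  induction k generalizing s with
  | zero =>
    rw [lintegral_infinitePi_scons _ (hmi 0 s), lintegral_infinitePi_scons _ (hmi1 0 s),
      ← lintegral_mul_const' _ _ hf']
    refine lintegral_congr fun q => ?_
    have e1 : ∀ c : ℕ → ℝ × ℝ, arrAt s (scons q c) 0 = s + q.1 := fun c => by simp [arrAt]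
    have e2 : ∀ (c : ℕ → ℝ × ℝ), (fun l => scons q c (0 + 1 + l)) = c := fun c => by
      funext l; rw [show 0 + 1 + l = l + 1 by ring]; rfl
    simp only [e1, e2]
    by_cases hq : s + q.1 ∈ A
    · simp [indicator_of_mem hq]
    · simp [indicator_of_notMem hq]
  | succ k ih =>
    rw [lintegral_infinitePi_scons _ (hmi (k + 1) s), lintegral_infinitePi_scons _ (hmi1 (k + 1) s),
      ← lintegral_mul_const' _ _ hf']
    refine lintegral_congr fun q => ?_
    have e1 : ∀ c : ℕ → ℝ × ℝ, arrAt s (scons q c) (k + 1) = arrAt (s + max q.1 q.2) c k := by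
      intro c
      rw [arrAt, arrAt, Finset.sum_range_succ']
      simp only [scons_succ, scons_zero]
      ring
    have e2 : ∀ (c : ℕ → ℝ × ℝ), (fun l => scons q c (k + 1 + 1 + l)) = fun l => c (k + 1 + l) :=
      fun c => by
        funext l; rw [show k + 1 + 1 + l = (k + 1 + l) + 1 by ring]; rfl
    simp only [e1, e2]
    exact ih _

/-- The `k`-th of these arrivals comes after a sum of `k` independent exponential gaps, so the
probability that it lies in `(0, 1]` decays geometrically, uniformly in `s`. -/
lemma tsum_arrAt_le (hlam : 0 < lam) [IsProbabilityMeasure G] {s : ℝ} (hs : 0 ≤ s) :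
    ∑' k, (Measure.infinitePi fun _ : ℕ => cycleLaw lam G) {c | arrAt s c k ∈ Ioc 0 1}
      ≤ ENNReal.ofReal (Real.exp 2) * (1 - expRatio lam)⁻¹ := by
  have := isProbabilityMeasure_expMeasure hlam
  have := isProbabilityMeasure_cycleLaw hlam (G := G)
  have hmap : (Measure.infinitePi fun _ : ℕ => cycleLaw lam G).map (fun c k => (c k).1)
      = Measure.infinitePi fun _ : ℕ => expMeasure lam := by
    rw [Measure.infinitePi_map_pi (μ := fun _ : ℕ => cycleLaw lam G) (f := fun _ q => q.1)
      fun _ => measurable_fst]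
    congr 1; funext k
    simp [cycleLaw]
  rw [← ENNReal.tsum_geometric, ← ENNReal.tsum_mul_left]
  refine ENNReal.tsum_le_tsum fun k => ?_
  refine le_trans ?_ (infinitePi_exp_sum_lt_le hlam 2 k)
  rw [← hmap, Measure.map_apply (by fun_prop) (measurableSet_lt (by fun_prop) measurable_const)]
  have hpos : ∀ᵐ c ∂(Measure.infinitePi fun _ : ℕ => cycleLaw lam G), 0 < (c k).1 := by
    have h1 : ∀ᵐ q ∂(cycleLaw lam G), 0 < q.1 :=
      (Measure.quasiMeasurePreserving_fst (μ := expMeasure lam) (ν := G)).ae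
        (ae_expMeasure_pos hlam)
    exact (measurePreserving_eval_infinitePi (fun _ : ℕ => cycleLaw lam G)
      k).quasiMeasurePreserving.ae h1
  refine measure_mono_ae ?_
  filter_upwards [hpos] with c hc hk
  have h1 : arrAt s c k ≤ 1 := hk.2
  have h2 : ∑ l ∈ Finset.range k, (c l).1 ≤ ∑ l ∈ Finset.range k, max (c l).1 (c l).2 :=
    Finset.sum_le_sum fun l _ => le_max_left _ _
  change ∑ l ∈ Finset.range k, (c l).1 < 2
  unfold arrAt at h1
  linarith

end Level

end AoI

end

/-! ### The two stationary systems are cycle flows. -/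

noncomputable section

namespace AoI

variable {lam : ℝ} {G : Measure ℝ}

/-- Services before `i` are located at or before time `0` and contribute nothing; those after `i`
are reconstructed from their marks by the recursion for the beginnings. -/
lemma tsum_arr_eq {y : ℤ → ℝ × ℝ × ℝ} (hy : IsCyc y) {i : ℤ} {s : ℝ} {c : ℕ → ℝ × ℝ}
    (h1 : ∀ l < i, arr y l ≤ 0) (h2 : beg y (i + 1) = s)
    (h3 : ∀ k : ℕ, (y (i + 1 + k)).2 = c k) (f : (ℕ → ℝ × ℝ) → ℝ≥0∞) :
    ∑' i : ℤ, (Ioc 0 1).indicator (fun _ => f fun k => (y (i + 1 + k)).2) (arr y i)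
      = (Ioc 0 1).indicator (fun _ => f c) (arr y i) +
        ∑' k, (Ioc 0 1).indicator (fun _ => f fun l => c (k + 1 + l)) (arrAt s c k) := by
  have hbeg : ∀ k : ℕ, beg y (i + 1 + k) = s + ∑ l ∈ Finset.range k, max (c l).1 (c l).2 := by
    intro k
    induction k with
    | zero => simpa using h2
    | succ k ih =>
      rw [Finset.sum_range_succ, ← add_assoc, ← ih, ← h3 k]
      push_cast
      rw [← add_assoc, hy.beg_succ, arr, dpt, beg, max_add_add_left]
  have harr : ∀ k : ℕ, arr y (i + 1 + k) = arrAt s c k := fun k => by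
    rw [arrAt, ← hbeg, ← h3 k]; rfl
  have hinj : Function.Injective fun k : ℕ => i + k := fun a b hab => by
    simpa using hab
  rw [← hinj.tsum_eq, tsum_eq_zero_add' ENNReal.summable]
  · congr 1
    · have : (fun k : ℕ => (y (i + 1 + k)).2) = c := funext h3
      simp [this]
    · refine tsum_congr fun k => ?_
      have e1 : i + ((k + 1 : ℕ) : ℤ) = i + 1 + k := by push_cast; ring
      have e2 : (fun l : ℕ => (y (i + ((k + 1 : ℕ) : ℤ) + 1 + l)).2) = fun l => c (k + 1 + l) := by
        funext l
        rw [← h3]; congr 2; push_cast; ring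
      rw [e2, e1, harr]
  · intro l hl
    by_contra hc
    have hli : l < i := by
      by_contra h
      exact hc ⟨(l - i).toNat, by simp; omega⟩
    refine hl (indicator_of_notMem (fun h => ?_) _)
    exact absurd h.1 (not_lt.2 (h1 l hli))

section System

variable {Ω : Type*} [MeasurableSpace Ω] {P : Measure Ω} [IsProbabilityMeasure P]
  {X : Ω → MessageFlow} {b : Bool}

/-- The first gap from the level on is exponential, hence positive, and the level itself is
nonnegative. `tsum_arrAt_le` needs this sign. -/
lemma ae_levelState_nonneg (hlam : 0 < lam) [IsProbabilityMeasure G] (b : Bool)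
    (L : Measure (ℕ → ℝ × ℝ × ℝ × Prop)) [IsProbabilityMeasure L] :
    ∀ᵐ v ∂((L.prod (arrivalLaw lam G)).map (levelState b)), 0 ≤ v.1 + max v.2.2 v.2.1 := by
  have := isProbabilityMeasure_arrivalLaw hlam (G := G)
  have := isProbabilityMeasure_expMeasure hlam
  have hS : MeasurableSet {v : ℝ × ℝ × ℝ | 0 ≤ v.1 + max v.2.2 v.2.1} :=
    measurableSet_le measurable_const (by fun_prop)
  rw [ae_map_iff (measurable_levelState b).aemeasurable hS,
    Measure.ae_prod_iff_ae_ae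
      (p := fun p => 0 ≤ (levelState b p).1 + max (levelState b p).2.2 (levelState b p).2.1)
      (measurable_levelState b hS)]
  refine Eventually.of_forall fun h => ?_
  have hu : 0 ≤ (level b h).1 := le_max_right _ _
  have hB : MeasurableSet {D : (ℕ → ℝ) × (ℕ → ℝ) | D.1 0 ≤ 0} :=
    measurableSet_le (by fun_prop) measurable_const
  have h0 : arrivalLaw lam G {D | D.1 0 ≤ 0} = 0 := by
    have h1 : ∀ᵐ E ∂(Measure.infinitePi fun _ : ℕ => expMeasure lam), 0 < E 0 :=
      (measurePreserving_eval_infinitePi (fun _ : ℕ => expMeasure lam)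
        0).quasiMeasurePreserving.ae (ae_expMeasure_pos hlam)
    have h2 : ∀ᵐ D ∂(arrivalLaw lam G), 0 < D.1 0 :=
      (Measure.quasiMeasurePreserving_fst (μ := Measure.infinitePi fun _ : ℕ => expMeasure lam)
        (ν := Measure.infinitePi fun _ : ℕ => G)).ae h1
    simpa [ae_iff] using h2
  have h1 := lintegral_step_eq_mul hlam (G := G) b hu (level b h).2
    (f := fun _ => 1) measurable_const (measurable_one.indicator hB)
    (by rw [lintegral_indicator_one hB]; exact measure_ne_top _ _)
  rw [lintegral_indicator_one hB, h0, mul_zero] at h1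
  simp only [one_mul] at h1
  have hm : Measurable fun D => step b (level b h).1 (level b h).2 D :=
    (measurable_step b).comp (by fun_prop :
      Measurable fun D : (ℕ → ℝ) × (ℕ → ℝ) => ((level b h).1, (level b h).2, D))
  have hmi : Measurable fun D : (ℕ → ℝ) × (ℕ → ℝ) =>
      {D : (ℕ → ℝ) × (ℕ → ℝ) | D.1 0 ≤ 0}.indicator (1 : (ℕ → ℝ) × (ℕ → ℝ) → ℝ≥0∞)
        (step b (level b h).1 (level b h).2 D).2 := (measurable_one.indicator hB).comp hm.snd
  rw [lintegral_eq_zero_iff hmi] at h1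
  filter_upwards [h1] with D hD
  have hD' : 0 < (step b (level b h).1 (level b h).2 D).2.1 0 := by
    by_contra hc
    simp [not_lt.1 hc] at hD
  exact add_nonneg hu (hD'.le.trans (le_max_left _ _))

/-- Services are located at their first later arrival and not at their end. The message served next
arrives at that moment or later; so if the location is after time `0`, no size in the history enters
the marks that follow. At the end of a service the stored message could be an old one. -/
theorem IsStationarySystem.isCycleFlow (hlam : 0 < lam) [IsProbabilityMeasure G]
    (hX : IsStationarySystem P X lam G) (hr : ∀ᵐ ω ∂P, (X ω).Regular b) :
    IsCycleFlow P (fun ω => (X ω).cyc) lam G := by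
  have hXm := hX.measurable
  have hcm := MessageFlow.measurable_cyc
  have := isProbabilityMeasure_arrivalLaw hlam (G := G)
  have := isProbabilityMeasure_cycleLaw hlam (G := G)
  refine ⟨hcm.comp hXm, hr.mono fun ω h => h.isCyc, hr.mono fun ω h => h.dpt_cyc_zero,
    hr.mono fun ω h => h.dpt_cyc_one, fun t φ hφ => ?_, ?_⟩
  · have hφ' : Measurable fun y => ∑' k, φ (relabel k y) :=
      Measurable.tsum fun k => hφ.comp (measurable_pi_lambda _ fun i =>
        measurable_pi_apply (i + k))
    have h1 := ((hX.stationary t).comp (hφ'.comp hcm)).lintegral_eq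
    refine Eq.trans ?_ h1
    refine lintegral_congr_ae (hr.mono fun ω h => ?_)
    obtain ⟨k, hk⟩ := h.cyc_shift t
    simp only [Function.comp_apply, hk]
    -- The relabelling `k` depends on the realisation; the sum over all labels absorbs it.
    rw [← (Equiv.addRight k).tsum_eq]
    refine tsum_congr fun l => ?_
    congr 1
    funext i
    simp [relabel, add_assoc]
  · set M := Measure.infinitePi fun _ : ℕ => cycleLaw lam G
    set L := P.map fun ω => (X ω).history
    have hhm := measurable_history.comp hXm
    have : IsProbabilityMeasure L := Measure.isProbabilityMeasure_map hhm.aemeasurable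
    set V := (L.prod (arrivalLaw lam G)).map (levelState b)
    have : IsProbabilityMeasure V :=
      Measure.isProbabilityMeasure_map (measurable_levelState b).aemeasurable
    have hmi : ∀ k, Measurable fun v : ℝ × ℝ × ℝ =>
        M {c | arrAt (v.1 + max v.2.2 v.2.1) c k ∈ Ioc 0 1} := by
      intro k
      have h1 : MeasurableSet {p : (ℝ × ℝ × ℝ) × (ℕ → ℝ × ℝ) |
          arrAt (p.1.1 + max p.1.2.2 p.1.2.1) p.2 k ∈ Ioc 0 1} :=
        ((measurable_arrAt k).comp (by fun_prop : Measurable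
          fun p : (ℝ × ℝ × ℝ) × (ℕ → ℝ × ℝ) => (p.1.1 + max p.1.2.2 p.1.2.1, p.2)))
          measurableSet_Ioc
      exact measurable_measure_prodMk_left h1
    -- The constant is the expected number of locations in `(0, 1]`: the first term counts the
    -- service `i` of `Regular.exists_level`, the series counts the services after it.
    refine ⟨V {v | v.1 + v.2.2 ∈ Ioc 0 1} +
      ∫⁻ v, ∑' k, M {c | arrAt (v.1 + max v.2.2 v.2.1) c k ∈ Ioc 0 1} ∂V, ?_, ?_⟩
    · refine ENNReal.add_ne_top.2 ⟨measure_ne_top _ _, ne_top_of_le_ne_top (b :=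
        ENNReal.ofReal (Real.exp 2) * (1 - expRatio lam)⁻¹) ?_ ?_⟩
      · refine ENNReal.mul_ne_top ENNReal.ofReal_ne_top (ENNReal.inv_ne_top.2 ?_)
        exact (tsub_pos_of_lt (expRatio_lt_one hlam)).ne'
      · refine (lintegral_mono_ae (g := fun _ => ENNReal.ofReal (Real.exp 2) *
          (1 - expRatio lam)⁻¹) ?_).trans (by simp)
        filter_upwards [ae_levelState_nonneg hlam (G := G) b L] with v hv
        exact tsum_arrAt_le hlam hv
    · intro f hf hf'
      have hp : Measurable fun ω => (levelState b ((X ω).history, arrivals (X ω)),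
          levelSeq b ((X ω).history, arrivals (X ω))) :=
        ((measurable_levelState b).prodMk (measurable_levelSeq b)).comp
          (hhm.prodMk (measurable_arrivals.comp hXm))
      have hlaw : P.map (fun ω => (levelState b ((X ω).history, arrivals (X ω)),
          levelSeq b ((X ω).history, arrivals (X ω)))) = V.prod M := by
        rw [← map_levelState_levelSeq hlam (G := G) b L, ← map_history_arrivals hX]
        exact (Measure.map_map ((measurable_levelState b).prodMk (measurable_levelSeq b))
          (hhm.prodMk (measurable_arrivals.comp hXm))).symm
      have hF1 : Measurable fun p : (ℝ × ℝ × ℝ) × (ℕ → ℝ × ℝ) =>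
          (Ioc (0 : ℝ) 1).indicator (fun _ => f p.2) (p.1.1 + p.1.2.2) := by
        have : Measurable fun p : (ℝ × ℝ × ℝ) × (ℕ → ℝ × ℝ) => p.1.1 + p.1.2.2 := by fun_prop
        exact (hf.comp measurable_snd).indicator (this measurableSet_Ioc)
      have hF2 : ∀ k, Measurable fun p : (ℝ × ℝ × ℝ) × (ℕ → ℝ × ℝ) =>
          (Ioc (0 : ℝ) 1).indicator (fun _ => f fun l => p.2 (k + 1 + l))
            (arrAt (p.1.1 + max p.1.2.2 p.1.2.1) p.2 k) := by
        intro k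
        have h1 : Measurable fun p : (ℝ × ℝ × ℝ) × (ℕ → ℝ × ℝ) =>
            arrAt (p.1.1 + max p.1.2.2 p.1.2.1) p.2 k :=
          (measurable_arrAt k).comp (by fun_prop : Measurable
            fun p : (ℝ × ℝ × ℝ) × (ℕ → ℝ × ℝ) => (p.1.1 + max p.1.2.2 p.1.2.1, p.2))
        exact (hf.comp (by fun_prop : Measurable fun (p : (ℝ × ℝ × ℝ) × (ℕ → ℝ × ℝ)) l =>
          p.2 (k + 1 + l))).indicator (h1 measurableSet_Ioc)
      have hF : Measurable fun p : (ℝ × ℝ × ℝ) × (ℕ → ℝ × ℝ) =>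
          (Ioc (0 : ℝ) 1).indicator (fun _ => f p.2) (p.1.1 + p.1.2.2) +
            ∑' k, (Ioc (0 : ℝ) 1).indicator (fun _ => f fun l => p.2 (k + 1 + l))
              (arrAt (p.1.1 + max p.1.2.2 p.1.2.1) p.2 k) := hF1.add (Measurable.tsum hF2)
      calc _ = ∫⁻ p, ((Ioc (0 : ℝ) 1).indicator (fun _ => f p.2) (p.1.1 + p.1.2.2) +
            ∑' k, (Ioc (0 : ℝ) 1).indicator (fun _ => f fun l => p.2 (k + 1 + l))
              (arrAt (p.1.1 + max p.1.2.2 p.1.2.1) p.2 k)) ∂(V.prod M) := by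
            rw [← hlaw, lintegral_map hF hp]
            refine lintegral_congr_ae (hr.mono fun ω h => ?_)
            obtain ⟨i, g1, g2, g3, g4, g5⟩ := h.exists_level
            refine (tsum_arr_eq h.isCyc g2 g4 g5 f).trans ?_
            simp only [g3]
            rfl
        _ = _ := by
            rw [lintegral_prod _ hF.aemeasurable, add_mul]
            have e1 : ∀ v : ℝ × ℝ × ℝ, ∫⁻ c, ((Ioc (0 : ℝ) 1).indicator (fun _ => f c)
                (v.1 + v.2.2) + ∑' k, (Ioc (0 : ℝ) 1).indicator (fun _ => f fun l => c (k + 1 + l))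
                (arrAt (v.1 + max v.2.2 v.2.1) c k)) ∂M
                = ({v : ℝ × ℝ × ℝ | v.1 + v.2.2 ∈ Ioc 0 1}.indicator 1 v +
                  ∑' k, M {c | arrAt (v.1 + max v.2.2 v.2.1) c k ∈ Ioc 0 1}) * ∫⁻ c, f c ∂M := by
              intro v
              have hv : Measurable fun c : ℕ → ℝ × ℝ => (v, c) := measurable_prodMk_left
              have g1 : Measurable fun c : ℕ → ℝ × ℝ =>
                  (Ioc (0 : ℝ) 1).indicator (fun _ => f c) (v.1 + v.2.2) := hF1.comp hv
              have g2 : ∀ k, Measurable fun c : ℕ → ℝ × ℝ =>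
                  (Ioc (0 : ℝ) 1).indicator (fun _ => f fun l => c (k + 1 + l))
                    (arrAt (v.1 + max v.2.2 v.2.1) c k) := fun k => (hF2 k).comp hv
              rw [lintegral_add_left g1, add_mul, lintegral_tsum fun k => (g2 k).aemeasurable,
                ← ENNReal.tsum_mul_right]
              congr 1
              · by_cases hv : v.1 + v.2.2 ∈ Ioc (0 : ℝ) 1
                · rw [indicator_of_mem (s := {v : ℝ × ℝ × ℝ | v.1 + v.2.2 ∈ Ioc 0 1}) hv]
                  simp [indicator_of_mem hv]
                · rw [indicator_of_notMem (s := {v : ℝ × ℝ × ℝ | v.1 + v.2.2 ∈ Ioc 0 1}) hv]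
                  simp [indicator_of_notMem hv]
              · exact tsum_congr fun k => lintegral_arrAt k _ hf hf' measurableSet_Ioc
            simp only [e1]
            have hV : MeasurableSet {v : ℝ × ℝ × ℝ | v.1 + v.2.2 ∈ Ioc 0 1} :=
              (by fun_prop : Measurable fun v : ℝ × ℝ × ℝ => v.1 + v.2.2) measurableSet_Ioc
            rw [lintegral_mul_const' _ _ hf', lintegral_add_left (measurable_one.indicator hV),
              lintegral_indicator_one hV, add_mul]

end System

end AoI

end

/-! ### Palm calculus for the services: from one-sided to two-sided i.i.d. marks. -/

noncomputable section

namespace AoI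

lemma infinitePi_map_precomp {ι κ α : Type*} [MeasurableSpace α] (μ : Measure α)
    [IsProbabilityMeasure μ] {g : κ → ι} (hg : Function.Injective g) :
    (Measure.infinitePi fun _ : ι => μ).map (fun c k => c (g k))
      = Measure.infinitePi fun _ : κ => μ := by
  have h1 : iIndepFun (fun (i : ι) (c : ι → α) => c i) (Measure.infinitePi fun _ : ι => μ) :=
    iIndepFun_infinitePi (X := fun _ => id) fun _ => measurable_id
  have h2 := (iIndepFun_iff_map_fun_eq_infinitePi_map
    (fun k => measurable_pi_apply (g k))).1 (h1.precomp hg)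
  refine h2.trans ?_
  congr 1; funext k
  exact Measure.infinitePi_map_eval _ _

section Deterministic

variable {y : ℤ → ℝ × ℝ × ℝ}

@[simp] lemma beg_relabel (k i : ℤ) : beg (relabel k y) i = beg y (i + k) := rfl
@[simp] lemma arr_relabel (k i : ℤ) : arr (relabel k y) i = arr y (i + k) := rfl
@[simp] lemma dpt_relabel (k i : ℤ) : dpt (relabel k y) i = dpt y (i + k) := rfl

@[simp] lemma beg_translate (t : ℝ) (i : ℤ) : beg (translate t y) i = beg y i - t := rfl

@[simp] lemma arr_translate (t : ℝ) (i : ℤ) : arr (translate t y) i = arr y i - t := by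
  simp only [arr, translate]; ring

@[simp] lemma dpt_translate (t : ℝ) (i : ℤ) : dpt (translate t y) i = dpt y i - t := by
  simp only [dpt, translate]; ring

lemma relabel_relabel (k l : ℤ) : relabel k (relabel l y) = relabel (k + l) y := by
  funext i; simp [relabel, add_assoc]

lemma translate_translate (s t : ℝ) : translate s (translate t y) = translate (s + t) y := by
  funext i; refine Prod.ext ?_ rfl
  simp only [translate]; ring

@[simp] lemma translate_zero : translate 0 y = y := by
  funext i; simp [translate]

lemma IsCyc.relabel (h : IsCyc y) (k : ℤ) : IsCyc (relabel k y) :=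
  ⟨fun i => by
    rw [beg_relabel, show i + 1 + k = i + k + 1 by ring]; exact h.beg_succ _,
    fun i => h.beg_le_arr _, fun i => h.beg_lt_dpt _⟩

lemma num_congr {y z : ℤ → ℝ × ℝ × ℝ} {s t : ℝ}
    (h2 : (∃ i, arr y i ≤ s ∧ s < dpt y i) ↔ ∃ i, arr z i ≤ t ∧ t < dpt z i)
    (h1 : (∃ i, beg y i ≤ s ∧ s < dpt y i) ↔ ∃ i, beg z i ≤ t ∧ t < dpt z i) :
    num y s = num z t := by
  classical
  unfold num
  exact if_congr h2 rfl (if_congr h1 rfl rfl)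

lemma num_translate (s t : ℝ) : num (translate s y) t = num y (t + s) := by
  refine num_congr (exists_congr fun i => ?_) (exists_congr fun i => ?_)
  · rw [arr_translate, dpt_translate, sub_le_iff_le_add, lt_sub_iff_add_lt]
  · rw [beg_translate, dpt_translate, sub_le_iff_le_add, lt_sub_iff_add_lt]

lemma num_relabel (k : ℤ) (t : ℝ) : num (relabel k y) t = num y t :=
  num_congr ((Equiv.addRight k).exists_congr fun _ => Iff.rfl)
    ((Equiv.addRight k).exists_congr fun _ => Iff.rfl)

/-- The marks of the services. -/
def marks (y : ℤ → ℝ × ℝ × ℝ) (i : ℤ) : ℝ × ℝ := (y i).2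

/-- The beginning of service `i`, seen from the beginning of service `0`. -/
def begFrom (c : ℤ → ℝ × ℝ) (i : ℤ) : ℝ :=
  ∑ l ∈ Finset.Ico 0 i, max (c l).1 (c l).2 - ∑ l ∈ Finset.Ico i 0, max (c l).1 (c l).2

lemma begFrom_zero (c : ℤ → ℝ × ℝ) : begFrom c 0 = 0 := by simp [begFrom]

lemma begFrom_succ (c : ℤ → ℝ × ℝ) (i : ℤ) :
    begFrom c (i + 1) = begFrom c i + max (c i).1 (c i).2 := by
  unfold begFrom
  rcases le_or_gt 0 i with hi | hi
  · rw [Finset.Ico_eq_empty (a := i + 1) (by omega), Finset.Ico_eq_empty (a := i) (by omega),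
      ← Order.succ_eq_add_one, ← Finset.insert_Ico_right_eq_Ico_succ hi,
      Finset.sum_insert (by simp)]
    simp; ring
  · rw [Finset.Ico_eq_empty (b := i + 1) (by omega), Finset.Ico_eq_empty (b := i) (by omega),
      ← Finset.insert_Ico_add_one_left_eq_Ico hi, Finset.sum_insert (by simp)]
    simp

/-- The services with given marks, the end of service `0` being the origin of time. -/
def services (c : ℤ → ℝ × ℝ) (i : ℤ) : ℝ × ℝ × ℝ := (begFrom c i - (c 0).2, c i)

lemma measurable_services : Measurable services := by
  refine measurable_pi_lambda _ fun i => ?_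
  unfold services begFrom
  fun_prop

@[simp] lemma marks_services (c : ℤ → ℝ × ℝ) : marks (services c) = c := rfl

@[simp] lemma dpt_services_zero (c : ℤ → ℝ × ℝ) : dpt (services c) 0 = 0 := by
  simp [dpt, services, begFrom_zero]

lemma services_beg_succ (c : ℤ → ℝ × ℝ) (i : ℤ) :
    beg (services c) (i + 1) = max (arr (services c) i) (dpt (services c) i) := by
  simp only [beg, arr, dpt, services, begFrom_succ, max_add_add_left]; ring

lemma isCyc_services {c : ℤ → ℝ × ℝ} (hc : ∀ i, 0 < (c i).1 ∧ 0 < (c i).2) : IsCyc (services c) :=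
  ⟨services_beg_succ c, fun i => by
    simp only [beg, arr, services]; linarith [(hc i).1], fun i => by
    simp only [beg, dpt, services]; linarith [(hc i).2]⟩

/-- Each beginning is the previous one plus a function of the previous mark, so the recursion can be
run upwards and downwards from service `0`. -/
lemma eq_of_beg_succ {y z : ℤ → ℝ × ℝ × ℝ}
    (hy : ∀ i, beg y (i + 1) = max (arr y i) (dpt y i))
    (hz : ∀ i, beg z (i + 1) = max (arr z i) (dpt z i)) (hm : marks y = marks z)
    (h0 : dpt y 0 = dpt z 0) : y = z := by
  have hm' : ∀ i, (y i).2 = (z i).2 := fun i => congrFun hm i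
  have hb : ∀ i, beg y i = beg z i := by
    intro i
    induction i with
    | zero =>
      have := hm' 0
      simp only [dpt, this] at h0
      simp only [beg]; linarith
    | succ i ih =>
      rw [hy, hz]
      simp only [beg] at ih
      simp only [arr, dpt, hm', ih]
    | pred i ih =>
      have h1 := hy (-i - 1)
      have h2 := hz (-i - 1)
      rw [sub_add_cancel, arr, dpt, max_add_add_left] at h1 h2
      rw [hm' (-i - 1)] at h1
      simp only [beg] at *
      linarith
  funext i
  exact Prod.ext (hb i) (hm' i)

lemma translate_relabel_eq_services (hy : ∀ i, beg y (i + 1) = max (arr y i) (dpt y i)) (k : ℤ) :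
    translate (dpt y k) (relabel k y) = services fun i => marks y (i + k) := by
  refine eq_of_beg_succ (fun i => ?_) (services_beg_succ _) rfl (by simp)
  rw [beg_translate, arr_translate, dpt_translate, max_sub_sub_right, beg_relabel,
    show i + 1 + k = i + k + 1 by ring, hy]
  rfl

lemma translate_eq_services (hy : ∀ i, beg y (i + 1) = max (arr y i) (dpt y i)) :
    translate (dpt y 0) y = services (marks y) := by
  refine eq_of_beg_succ (fun i => ?_) (services_beg_succ _) rfl (by simp)
  rw [beg_translate, arr_translate, dpt_translate, max_sub_sub_right, hy]

end Deterministic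

section Measurability

@[fun_prop]
lemma measurable_relabel (k : ℤ) : Measurable (relabel k) :=
  measurable_pi_lambda _ fun i => measurable_pi_apply (i + k)

lemma measurable_translate : Measurable fun p : ℝ × (ℤ → ℝ × ℝ × ℝ) => translate p.1 p.2 := by
  unfold translate
  fun_prop

@[fun_prop]
lemma Measurable.translate {α : Type*} [MeasurableSpace α] {f : α → ℝ} {g : α → ℤ → ℝ × ℝ × ℝ}
    (hf : Measurable f) (hg : Measurable g) : Measurable fun a => translate (f a) (g a) :=
  measurable_translate.comp (hf.prodMk hg)

@[fun_prop]
lemma measurable_beg (i : ℤ) : Measurable fun y => beg y i := by unfold beg; fun_prop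
@[fun_prop]
lemma measurable_arr (i : ℤ) : Measurable fun y => arr y i := by unfold arr; fun_prop
@[fun_prop]
lemma measurable_dpt (i : ℤ) : Measurable fun y => dpt y i := by unfold dpt; fun_prop
@[fun_prop]
lemma measurable_marks : Measurable marks := by unfold marks; fun_prop

lemma measurableSet_isCyc : MeasurableSet {y | IsCyc y} := by
  have : {y | IsCyc y} = {y | (∀ i, beg y (i + 1) = max (arr y i) (dpt y i)) ∧
      (∀ i, beg y i ≤ arr y i) ∧ ∀ i, beg y i < dpt y i} := by
    ext y; exact ⟨fun h => ⟨h.1, h.2, h.3⟩, fun h => ⟨h.1, h.2.1, h.2.2⟩⟩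
  rw [this]
  refine measurableSet_setOfPred.2 ((Measurable.forall fun i => ?_).and
    ((Measurable.forall fun i => ?_).and (Measurable.forall fun i => ?_)))
  · exact measurableSet_setOfPred.1 (measurableSet_eq_fun (by fun_prop) (by fun_prop))
  · exact measurableSet_setOfPred.1 (measurableSet_le (by fun_prop) (by fun_prop))
  · exact measurableSet_setOfPred.1 (measurableSet_lt (by fun_prop) (by fun_prop))

end Measurability

section Palm

variable {Ω : Type*} [MeasurableSpace Ω] {P : Measure Ω}
  {Y : Ω → ℤ → ℝ × ℝ × ℝ} {lam : ℝ} {G : Measure ℝ}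

/-- The intensity measure of the services together with a distinguished service, which gets the
label `0`. -/
def labelMeasure (P : Measure Ω) (Y : Ω → ℤ → ℝ × ℝ × ℝ) : Measure (ℤ → ℝ × ℝ × ℝ) :=
  Measure.sum fun k : ℤ => P.map fun ω => relabel k (Y ω)

instance [SFinite P] : SFinite (labelMeasure P Y) :=
  inferInstanceAs (SFinite (Measure.sum fun k : ℤ => P.map fun ω => relabel k (Y ω)))

lemma lintegral_labelMeasure (hY : Measurable Y) {φ : (ℤ → ℝ × ℝ × ℝ) → ℝ≥0∞} (hφ : Measurable φ) :
    ∫⁻ y, φ y ∂(labelMeasure P Y) = ∫⁻ ω, ∑' k, φ (relabel k (Y ω)) ∂P := by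
  rw [labelMeasure, lintegral_sum_measure, lintegral_tsum fun k => by fun_prop]
  exact tsum_congr fun k => lintegral_map hφ (by fun_prop)

lemma lintegral_labelMeasure_relabel (hY : Measurable Y) (j : ℤ) {φ : (ℤ → ℝ × ℝ × ℝ) → ℝ≥0∞}
    (hφ : Measurable φ) :
    ∫⁻ y, φ (relabel j y) ∂(labelMeasure P Y) = ∫⁻ y, φ y ∂(labelMeasure P Y) := by
  rw [lintegral_labelMeasure hY (by fun_prop), lintegral_labelMeasure hY hφ]
  refine lintegral_congr fun ω => ?_
  rw [← (Equiv.addLeft j).tsum_eq fun k => φ (relabel k (Y ω))]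
  simp [relabel_relabel]

lemma IsCycleFlow.lintegral_translate (h : IsCycleFlow P Y lam G) (t : ℝ)
    {φ : (ℤ → ℝ × ℝ × ℝ) → ℝ≥0∞} (hφ : Measurable φ) :
    ∫⁻ y, φ (translate t y) ∂(labelMeasure P Y) = ∫⁻ y, φ y ∂(labelMeasure P Y) := by
  rw [lintegral_labelMeasure h.measurable (by fun_prop), lintegral_labelMeasure h.measurable hφ,
    ← h.stationary t φ hφ]
  rfl

lemma IsCycleFlow.ae_isCyc (h : IsCycleFlow P Y lam G) : ∀ᵐ y ∂(labelMeasure P Y), IsCyc y := by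
  refine Measure.ae_sum_iff.2 fun k => ?_
  have hm := h.measurable
  rw [ae_map_iff (by fun_prop) measurableSet_isCyc]
  exact h.isCyc.mono fun ω hω => hω.relabel k

lemma lintegral_indicator_sub (s : ℝ) :
    ∫⁻ t, (Ioc (0 : ℝ) 1).indicator (1 : ℝ → ℝ≥0∞) (s - t) = 1 := by
  rw [lintegral_sub_left_eq_self fun t => (Ioc (0 : ℝ) 1).indicator (1 : ℝ → ℝ≥0∞) t,
    lintegral_indicator_one measurableSet_Ioc]
  simp

/-- Any point of a service may be used as its location. -/
lemma IsCycleFlow.lintegral_eq_of_location [SFinite P] (h : IsCycleFlow P Y lam G)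
    {φ : (ℤ → ℝ × ℝ × ℝ) → ℝ≥0∞} (hφ : Measurable φ) :
    ∫⁻ y, φ y ∂(labelMeasure P Y)
      = ∫⁻ y, (Ioc 0 1).indicator (1 : ℝ → ℝ≥0∞) (arr y 0) * (∫⁻ t, φ (translate t y))
          ∂(labelMeasure P Y) := by
  have hI : Measurable ((Ioc (0 : ℝ) 1).indicator (1 : ℝ → ℝ≥0∞)) :=
    measurable_one.indicator measurableSet_Ioc
  -- Insert the factor `1`, written as the integral over `t` of the indicator that the location
  -- translated by `t` falls into `(0, 1]`.
  calc ∫⁻ y, φ y ∂(labelMeasure P Y)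
      = ∫⁻ y, (∫⁻ t, φ y * (Ioc 0 1).indicator (1 : ℝ → ℝ≥0∞) (arr (translate t y) 0))
          ∂(labelMeasure P Y) := by
        refine lintegral_congr fun y => ?_
        rw [lintegral_const_mul _ (by fun_prop)]
        simp_rw [arr_translate]
        rw [lintegral_indicator_sub, mul_one]
    -- After exchanging the integrals, the integrand is a function of `translate t y`, so the
    -- invariance of the measure removes the translation from the location and leaves it in `φ`.
    _ = ∫⁻ t, ∫⁻ y, φ (translate (-t) (translate t y)) *
          (Ioc 0 1).indicator (1 : ℝ → ℝ≥0∞) (arr (translate t y) 0) ∂(labelMeasure P Y) := by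
        simp_rw [translate_translate, neg_add_cancel, translate_zero]
        exact lintegral_lintegral_swap (by fun_prop)
    _ = ∫⁻ t, ∫⁻ y, φ (translate (-t) y) *
          (Ioc 0 1).indicator (1 : ℝ → ℝ≥0∞) (arr y 0) ∂(labelMeasure P Y) := by
        refine lintegral_congr fun t => ?_
        exact h.lintegral_translate t (φ := fun y => φ (translate (-t) y) *
          (Ioc 0 1).indicator (1 : ℝ → ℝ≥0∞) (arr y 0)) (by fun_prop)
    _ = ∫⁻ t, ∫⁻ y, φ (translate t y) *
          (Ioc 0 1).indicator (1 : ℝ → ℝ≥0∞) (arr y 0) ∂(labelMeasure P Y) :=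
        lintegral_neg_eq_self fun t => ∫⁻ y, φ (translate t y) *
          (Ioc 0 1).indicator (1 : ℝ → ℝ≥0∞) (arr y 0) ∂(labelMeasure P Y)
    _ = _ := by
        have hF : Measurable fun p : ℝ × (ℤ → ℝ × ℝ × ℝ) => φ (translate p.1 p.2) *
          (Ioc 0 1).indicator (1 : ℝ → ℝ≥0∞) (arr p.2 0) := by fun_prop
        rw [lintegral_lintegral_swap (f := fun t y => φ (translate t y) *
          (Ioc 0 1).indicator (1 : ℝ → ℝ≥0∞) (arr y 0)) hF.aemeasurable]
        refine lintegral_congr fun y => ?_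
        rw [lintegral_mul_const _ (by fun_prop), mul_comm]

/-- The law of the marks seen from an arrival which begins an inter-arrival period. -/
def marksMeasure (P : Measure Ω) (Y : Ω → ℤ → ℝ × ℝ × ℝ) : Measure (ℤ → ℝ × ℝ) :=
  ((labelMeasure P Y).restrict {y | arr y 0 ∈ Ioc 0 1}).map marks

lemma lintegral_marksMeasure (f : (ℤ → ℝ × ℝ) → ℝ≥0∞) (hf : Measurable f) :
    ∫⁻ c, f c ∂(marksMeasure P Y)
      = ∫⁻ y, (Ioc 0 1).indicator (1 : ℝ → ℝ≥0∞) (arr y 0) * f (marks y) ∂(labelMeasure P Y) := by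
  have hS : MeasurableSet {y | arr y 0 ∈ Ioc 0 1} := measurable_arr 0 measurableSet_Ioc
  rw [marksMeasure, lintegral_map hf (by fun_prop), ← lintegral_indicator hS]
  refine lintegral_congr fun y => ?_
  by_cases hy : arr y 0 ∈ Ioc 0 1
  · rw [indicator_of_mem (s := {y | arr y 0 ∈ Ioc 0 1}) hy, indicator_of_mem hy]; simp
  · rw [indicator_of_notMem (s := {y | arr y 0 ∈ Ioc 0 1}) hy, indicator_of_notMem hy]; simp

/-- Shifting the marks by relabelling moves the location from `arr y 0` to `arr y (-j)`. Marks are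
unaffected by translation, so by `IsCycleFlow.lintegral_eq_of_location` both locations give the same
integral. -/
lemma IsCycleFlow.lintegral_marksMeasure_shift [SFinite P] (h : IsCycleFlow P Y lam G) (j : ℤ)
    {f : (ℤ → ℝ × ℝ) → ℝ≥0∞} (hf : Measurable f) :
    ∫⁻ c, f (fun i => c (i + j)) ∂(marksMeasure P Y) = ∫⁻ c, f c ∂(marksMeasure P Y) := by
  have hI : Measurable ((Ioc (0 : ℝ) 1).indicator (1 : ℝ → ℝ≥0∞)) :=
    measurable_one.indicator measurableSet_Ioc
  rw [lintegral_marksMeasure _ (by fun_prop), lintegral_marksMeasure _ hf]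
  calc _ = ∫⁻ y, (fun y => (Ioc 0 1).indicator (1 : ℝ → ℝ≥0∞) (arr y (-j)) * f (marks y))
        (relabel j y) ∂(labelMeasure P Y) := by
        refine lintegral_congr fun y => ?_
        simp only [arr_relabel, neg_add_cancel]
        rfl
    _ = _ := by
        have hF : Measurable fun y => (Ioc 0 1).indicator (1 : ℝ → ℝ≥0∞) (arr y (-j)) *
          f (marks y) := by fun_prop
        rw [lintegral_labelMeasure_relabel h.measurable j hF,
          h.lintegral_eq_of_location (by fun_prop)]
        refine lintegral_congr fun y => ?_
        congr 1
        have : ∀ t, marks (translate t y) = marks y := fun t => rfl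
        simp_rw [this, arr_translate]
        rw [lintegral_mul_const _ (by fun_prop), lintegral_indicator_sub, one_mul]

/-- Regeneration describes the marks with labels `≥ 1`, and shift invariance carries any finite set
of labels there. -/
theorem IsCycleFlow.marksMeasure_eq (hlam : 0 < lam) [SFinite P] [IsProbabilityMeasure G]
    (h : IsCycleFlow P Y lam G) : ∃ m : ℝ≥0∞, m ≠ ∞ ∧
      marksMeasure P Y = m • Measure.infinitePi fun _ : ℤ => cycleLaw lam G := by
  have := isProbabilityMeasure_cycleLaw hlam (G := G)
  obtain ⟨m, hm, hreg⟩ := h.regen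
  refine ⟨m, hm, ?_⟩
  have hm1 : Measurable fun (c : ℤ → ℝ × ℝ) (k : ℕ) => c (1 + k) := by fun_prop
  have hpos : ∀ B : Set (ℕ → ℝ × ℝ), MeasurableSet B →
      marksMeasure P Y {c | (fun k : ℕ => c (1 + k)) ∈ B}
        = m * (Measure.infinitePi fun _ : ℕ => cycleLaw lam G) B := by
    intro B hB
    have hf : Measurable (B.indicator (1 : (ℕ → ℝ × ℝ) → ℝ≥0∞)) := measurable_one.indicator hB
    have h1 := hreg _ hf (by rw [lintegral_indicator_one hB]; exact measure_ne_top _ _)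
    rw [lintegral_indicator_one hB] at h1
    have hB' : MeasurableSet {c : ℤ → ℝ × ℝ | (fun k : ℕ => c (1 + k)) ∈ B} := hm1 hB
    rw [← h1, ← lintegral_indicator_one hB', lintegral_marksMeasure _ (measurable_one.indicator
      hB'), lintegral_labelMeasure h.measurable]
    · refine lintegral_congr fun ω => tsum_congr fun i => ?_
      simp only [arr_relabel, zero_add]
      by_cases hi : arr (Y ω) i ∈ Ioc 0 1
      · rw [indicator_of_mem hi, indicator_of_mem hi, Pi.one_apply, one_mul]
        have : (fun k : ℕ => marks (relabel i (Y ω)) (1 + k)) = fun k : ℕ => (Y ω (i + 1 + k)).2 := by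
          funext k
          simp only [marks, relabel]
          congr 2; ring
        rw [← this]; rfl
      · rw [indicator_of_notMem hi, indicator_of_notMem hi, zero_mul]
    · have hI : Measurable ((Ioc (0 : ℝ) 1).indicator (1 : ℝ → ℝ≥0∞)) :=
        measurable_one.indicator measurableSet_Ioc
      exact (hI.comp (measurable_arr 0)).mul ((measurable_one.indicator hB').comp
        measurable_marks)
  have hcyl : ∀ (s : Finset ℤ) (t : ℤ → Set (ℝ × ℝ)), (∀ i, MeasurableSet (t i)) →
      marksMeasure P Y ((s : Set ℤ).pi t) = m * ∏ i ∈ s, cycleLaw lam G (t i) := by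
    intro s t ht
    -- The shift by `N` moves all labels of `s` to labels `≥ 1`.
    obtain ⟨N, hN⟩ : ∃ N : ℤ, ∀ i ∈ s, 1 ≤ i + N := by
      obtain ⟨a, ha⟩ := s.bddBelow
      exact ⟨1 - a, fun i hi => by have := ha hi; omega⟩
    have hS : MeasurableSet ((s : Set ℤ).pi t) := MeasurableSet.pi s.countable_toSet fun i _ => ht i
    set B : Set (ℕ → ℝ × ℝ) := {d | ∀ i ∈ s, d (i + N - 1).toNat ∈ t i} with hB
    have hBm : MeasurableSet B := by
      have : B = ⋂ i ∈ s, (fun d : ℕ → ℝ × ℝ => d (i + N - 1).toNat) ⁻¹' t i := by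
        ext d; simp [hB]
      rw [this]
      exact Finset.measurableSet_biInter _ fun i _ => measurable_pi_apply _ (ht i)
    have hsub : ∀ c : ℤ → ℝ × ℝ, ((fun k : ℕ => c (1 + k)) ∈ B ↔
        (fun i => c (i + N)) ∈ (s : Set ℤ).pi t) := by
      intro c
      simp only [hB, mem_ofPred_eq, Set.mem_pi, Finset.mem_coe]
      refine forall₂_congr fun i hi => ?_
      have := hN i hi
      rw [show (1 : ℤ) + ((i + N - 1).toNat : ℤ) = i + N by omega]
    have hshift : Measurable fun (c : ℤ → ℝ × ℝ) (i : ℤ) => c (i + N) := by fun_prop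
    have h1 := h.lintegral_marksMeasure_shift N (measurable_one.indicator hS :
      Measurable ((s : Set ℤ).pi t |>.indicator (1 : (ℤ → ℝ × ℝ) → ℝ≥0∞)))
    rw [lintegral_indicator_one hS] at h1
    have h2 : ∫⁻ c, ((s : Set ℤ).pi t).indicator (1 : (ℤ → ℝ × ℝ) → ℝ≥0∞) (fun i => c (i + N))
        ∂(marksMeasure P Y) = marksMeasure P Y {c | (fun k : ℕ => c (1 + k)) ∈ B} := by
      have hB' : MeasurableSet {c : ℤ → ℝ × ℝ | (fun k : ℕ => c (1 + k)) ∈ B} := hm1 hBm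
      rw [← lintegral_indicator_one hB']
      refine lintegral_congr fun c => ?_
      by_cases hc : (fun i => c (i + N)) ∈ (s : Set ℤ).pi t
      · have hc' : c ∈ {c : ℤ → ℝ × ℝ | (fun k : ℕ => c (1 + k)) ∈ B} := (hsub c).2 hc
        rw [indicator_of_mem hc, indicator_of_mem hc']; rfl
      · have hc' : c ∉ {c : ℤ → ℝ × ℝ | (fun k : ℕ => c (1 + k)) ∈ B} :=
          fun h => hc ((hsub c).1 h)
        rw [indicator_of_notMem hc, indicator_of_notMem hc']
    rw [← h1, h2, hpos B hBm]
    congr 1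
    have h3 := infinitePi_map_precomp (cycleLaw lam G) (g := fun k : ℕ => (1 + k - N : ℤ))
      fun a b hab => by simpa using hab
    rw [← h3, Measure.map_apply (by fun_prop) hBm, ← Measure.infinitePi_pi
      (fun _ : ℤ => cycleLaw lam G) fun i _ => ht i]
    congr 1
    ext c
    have := hsub fun i => c (i - N)
    simpa using this
  -- That `m ≠ 0` only follows later, from the total mass of `P`; here both sides vanish if `m = 0`.
  rcases eq_or_ne m 0 with rfl | hm0
  · rw [zero_smul]
    have := hcyl ∅ (fun _ => univ) fun _ => MeasurableSet.univ
    simpa using this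
  · have h1 : m⁻¹ • marksMeasure P Y = Measure.infinitePi fun _ : ℤ => cycleLaw lam G := by
      refine Measure.eq_infinitePi _ fun s t ht => ?_
      rw [Measure.smul_apply, hcyl s t ht, smul_eq_mul, ← mul_assoc,
        ENNReal.inv_mul_cancel hm0 hm, one_mul]
    rw [← h1, smul_smul, ENNReal.mul_inv_cancel hm0 hm, one_smul]

/-- The intensity measure in terms of i.i.d. marks. -/
theorem IsCycleFlow.exists_lintegral_eq (hlam : 0 < lam) [SFinite P] [IsProbabilityMeasure G]
    (h : IsCycleFlow P Y lam G) : ∃ m : ℝ≥0∞, m ≠ ∞ ∧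
      ∀ φ : (ℤ → ℝ × ℝ × ℝ) → ℝ≥0∞, Measurable φ →
        ∫⁻ y, φ y ∂(labelMeasure P Y) = m * ∫⁻ c, (∫⁻ t, φ (translate t (services c)))
          ∂(Measure.infinitePi fun _ : ℤ => cycleLaw lam G) := by
  obtain ⟨m, hm, hΛ⟩ := h.marksMeasure_eq hlam
  refine ⟨m, hm, fun φ hφ => ?_⟩
  have hs := measurable_services
  have hF : Measurable fun c : ℤ → ℝ × ℝ => ∫⁻ t, φ (translate t (services c)) :=
    Measurable.lintegral_prod_right (f := fun c t => φ (translate t (services c)))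
      (by fun_prop)
  rw [h.lintegral_eq_of_location hφ, ← smul_eq_mul, ← lintegral_smul_measure, ← hΛ,
    lintegral_marksMeasure _ hF]
  refine lintegral_congr_ae (h.ae_isCyc.mono fun y hy => ?_)
  simp only
  congr 1
  -- Recentring at the end of service `0` changes `t` by a constant, to which Lebesgue measure is
  -- insensitive.
  rw [← translate_eq_services hy.beg_succ]
  simp_rw [translate_translate]
  exact (lintegral_add_right_eq_self (fun t => φ (translate t y)) (dpt y 0)).symm

end Palm

end AoI

end

/-! ### Past and future at the end of a service. -/

noncomputable section

namespace AoI

section Join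

variable {α : Type*}

/-- The two-sided sequence made of a sequence for the negative labels and a sequence for the other
ones. -/
def join (a d : ℕ → α) : ℤ → α
  | .ofNat k => d k
  | .negSucc k => a k

lemma join_eq (c : ℤ → α) : join (fun k : ℕ => c (-(k + 1))) (fun k : ℕ => c k) = c := by
  funext i
  cases i with
  | ofNat k => rfl
  | negSucc k => rw [Int.negSucc_eq]; rfl

variable [MeasurableSpace α]

lemma measurable_join : Measurable fun p : (ℕ → α) × (ℕ → α) => join p.1 p.2 := by
  refine measurable_pi_lambda _ fun i => ?_
  cases i with
  | ofNat k => exact (measurable_pi_apply k).comp measurable_snd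
  | negSucc k => exact (measurable_pi_apply k).comp measurable_fst

@[fun_prop]
lemma Measurable.join {β : Type*} [MeasurableSpace β] {f g : β → ℕ → α} (hf : Measurable f)
    (hg : Measurable g) : Measurable fun b => join (f b) (g b) :=
  measurable_join.comp (hf.prodMk hg)

lemma indepFun_precomp_infinitePi {ι κ κ' : Type*} (μ : Measure α) [IsProbabilityMeasure μ]
    {g : κ → ι} {h : κ' → ι} (hgh : Disjoint (range g) (range h)) :
    IndepFun (fun (c : ι → α) k => c (g k)) (fun (c : ι → α) k => c (h k))
      (Measure.infinitePi fun _ : ι => μ) := by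
  have h1 : iIndepFun (fun (i : ι) (c : ι → α) => c i) (Measure.infinitePi fun _ : ι => μ) :=
    iIndepFun_infinitePi (X := fun _ => id) fun _ => measurable_id
  have h2 := indep_iSup_of_disjoint (fun i => (measurable_pi_apply i).comap_le) h1 hgh
  refine indep_of_indep_of_le_left (indep_of_indep_of_le_right h2 ?_) ?_
  · rw [MeasurableSpace.pi, MeasurableSpace.comap_iSup]
    refine iSup_le fun k => ?_
    rw [MeasurableSpace.comap_comp]
    exact le_iSup₂_of_le (h k) ⟨k, rfl⟩ le_rfl
  · rw [MeasurableSpace.pi, MeasurableSpace.comap_iSup]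
    refine iSup_le fun k => ?_
    rw [MeasurableSpace.comap_comp]
    exact le_iSup₂_of_le (g k) ⟨k, rfl⟩ le_rfl

/-- Separates the marks before service `0`, its own mark and the marks after it, which are the
ingredients of the past and the future at its end. -/
lemma lintegral_infinitePi_join (μ : Measure α) [IsProbabilityMeasure μ] {F : (ℤ → α) → ℝ≥0∞}
    (hF : Measurable F) :
    ∫⁻ c, F c ∂(Measure.infinitePi fun _ : ℤ => μ)
      = ∫⁻ a, (∫⁻ q, (∫⁻ d, F (join a (scons q d)) ∂(Measure.infinitePi fun _ : ℕ => μ)) ∂μ)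
        ∂(Measure.infinitePi fun _ : ℕ => μ) := by
  have hind : IndepFun (fun (c : ℤ → α) (k : ℕ) => c (-(k + 1))) (fun (c : ℤ → α) (k : ℕ) => c k)
      (Measure.infinitePi fun _ : ℤ => μ) := by
    refine indepFun_precomp_infinitePi μ (Set.disjoint_left.2 ?_)
    rintro _ ⟨k, rfl⟩ ⟨l, hl⟩
    simp only at hl
    omega
  have hm1 : Measurable fun (c : ℤ → α) (k : ℕ) => c (-(k + 1)) := by fun_prop
  have hm2 : Measurable fun (c : ℤ → α) (k : ℕ) => c k := by fun_prop
  have h1 := (indepFun_iff_map_prod_eq_prod_map_map hm1.aemeasurable hm2.aemeasurable).1 hind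
  rw [infinitePi_map_precomp μ fun a b hab => by simpa using hab,
    infinitePi_map_precomp μ fun a b hab => by simpa using hab] at h1
  have h2 : ∀ a, ∫⁻ d, F (join a d) ∂(Measure.infinitePi fun _ : ℕ => μ)
      = ∫⁻ q, (∫⁻ d, F (join a (scons q d)) ∂(Measure.infinitePi fun _ : ℕ => μ)) ∂μ := fun a =>
    lintegral_infinitePi_scons μ (F := fun d => F (join a d)) (by fun_prop)
  simp_rw [← h2]
  rw [← lintegral_prod (fun p : (ℕ → α) × (ℕ → α) => F (join p.1 p.2)) (by fun_prop), ← h1,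
    lintegral_map (by fun_prop) (by fun_prop)]
  simp_rw [join_eq]

end Join

section Paths

variable {y z : ℤ → ℝ × ℝ × ℝ}

lemma measurable_num : Measurable fun p : (ℤ → ℝ × ℝ × ℝ) × ℝ => num p.1 p.2 := by
  classical
  have h : ∀ f : (ℤ → ℝ × ℝ × ℝ) → ℤ → ℝ, (∀ i, Measurable fun y => f y i) →
      MeasurableSet {p : (ℤ → ℝ × ℝ × ℝ) × ℝ | ∃ i, f p.1 i ≤ p.2 ∧ p.2 < dpt p.1 i} := by
    intro f hf
    refine measurableSet_setOfPred.2 (Measurable.exists fun i => Measurable.and ?_ ?_)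
    · exact measurableSet_setOfPred.1 (measurableSet_le ((hf i).comp measurable_fst)
        measurable_snd)
    · exact measurableSet_setOfPred.1 (measurableSet_lt measurable_snd (by fun_prop))
  unfold num
  exact Measurable.ite (h arr fun i => by fun_prop) measurable_const
    (Measurable.ite (h beg fun i => by fun_prop) measurable_const measurable_const)

@[fun_prop]
lemma Measurable.num {α : Type*} [MeasurableSpace α] {f : α → ℤ → ℝ × ℝ × ℝ} {g : α → ℝ}
    (hf : Measurable f) (hg : Measurable g) : Measurable fun a => num (f a) (g a) :=
  measurable_num.comp (hf.prodMk hg)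

/-- The past of the number of messages in the system, seen from the end of service `n`. -/
def servicesPast (n : ℤ) (y : ℤ → ℝ × ℝ × ℝ) : (ℕ → ℝ × ℕ) × (ℝ≥0 → ℕ) :=
  past (fun n y => dpt y n) (fun t y => num y t) n y

/-- The future of the number of messages in the system, seen from the end of service `n`. -/
def servicesFuture (n : ℤ) (y : ℤ → ℝ × ℝ × ℝ) : (ℕ → ℝ × ℕ) × (ℝ≥0 → ℕ) :=
  future (fun n y => dpt y n) (fun t y => num y t) n y

@[fun_prop]
lemma measurable_servicesPast (n : ℤ) : Measurable (servicesPast n) := by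
  unfold servicesPast past embedded
  fun_prop

@[fun_prop]
lemma measurable_servicesFuture (n : ℤ) : Measurable (servicesFuture n) := by
  unfold servicesFuture future embedded
  fun_prop

lemma servicesPast_translate (t : ℝ) (n : ℤ) :
    servicesPast n (translate t y) = servicesPast n y := by
  simp only [servicesPast, past, embedded, num_translate, dpt_translate]
  refine Prod.ext (funext fun k => ?_) (funext fun u => ?_)
  · simp
  · simp only; congr 1; ring

lemma servicesFuture_translate (t : ℝ) (n : ℤ) :
    servicesFuture n (translate t y) = servicesFuture n y := by
  simp only [servicesFuture, future, embedded, num_translate, dpt_translate]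
  refine Prod.ext (funext fun k => ?_) (funext fun u => ?_)
  · simp
  · simp only; congr 1; ring

lemma servicesPast_relabel (k n : ℤ) : servicesPast n (relabel k y) = servicesPast (n + k) y := by
  simp only [servicesPast, past, embedded, num_relabel, dpt_relabel]
  refine Prod.ext (funext fun l => ?_) rfl
  simp only [show n - (l : ℤ) + k = n + k - l by ring]

lemma servicesFuture_relabel (k n : ℤ) :
    servicesFuture n (relabel k y) = servicesFuture (n + k) y := by
  simp only [servicesFuture, future, embedded, num_relabel, dpt_relabel]
  refine Prod.ext (funext fun l => ?_) rfl
  simp only [show n + (l : ℤ) + k = n + k + l by ring]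

/-- From time `0` on only services ending after time `0` are visible, and these have labels `≥ 1`.
Monotonicity replaces `IsCyc` because `futureFrom` uses a service `0` of duration zero. -/
lemma servicesFuture_congr (hy : Monotone (dpt y)) (hz : Monotone (dpt z)) (hy0 : dpt y 0 = 0)
    (hz0 : dpt z 0 = 0) (h : ∀ i, 1 ≤ i → y i = z i) : servicesFuture 0 y = servicesFuture 0 z := by
  have hd : ∀ k : ℕ, dpt y k = dpt z k := by
    intro k
    rcases Nat.eq_zero_or_pos k with rfl | hk
    · simp [hy0, hz0]
    · rw [dpt, dpt, h k (by omega)]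
  have hlt : ∀ {y : ℤ → ℝ × ℝ × ℝ} {t : ℝ} {i : ℤ}, Monotone (dpt y) → dpt y 0 = 0 → 0 ≤ t →
      t < dpt y i → 1 ≤ i := by
    intro y t i h1 h2 h3 h4
    by_contra hc
    have := h1 (show i ≤ 0 by omega)
    linarith
  have hn : ∀ t, 0 ≤ t → num y t = num z t := by
    intro t ht
    refine num_congr (exists_congr fun i => ?_) (exists_congr fun i => ?_)
    · refine ⟨fun h' => ?_, fun h' => ?_⟩
      · rwa [arr, dpt, ← h i (hlt hy hy0 ht h'.2)]
      · rwa [arr, dpt, h i (hlt hz hz0 ht h'.2)]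
    · refine ⟨fun h' => ?_, fun h' => ?_⟩
      · rwa [beg, dpt, ← h i (hlt hy hy0 ht h'.2)]
      · rwa [beg, dpt, h i (hlt hz hz0 ht h'.2)]
  refine Prod.ext (funext fun k => ?_) (funext fun u => ?_)
  · simp only [servicesFuture, future, embedded, zero_add]
    rw [hy0, hz0, hn _ (by rw [← hy0]; exact hy (by omega)), hd]
  · simp only [servicesFuture, future, hy0, hz0, zero_add]
    exact hn _ u.2

/-- Up to time `0` the services with labels `≥ 2` have not begun, and the arrival belonging to
service `0` is invisible if it comes after time `0`. Service `1` may begin exactly at time `0`, but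
then it does so in both sequences; the strict inequalities keep its own arrival out of sight. -/
lemma servicesPast_congr (hy : IsCyc y) (hz : IsCyc z) (hy0 : dpt y 0 = 0) (hz0 : dpt z 0 = 0)
    (hy1 : beg y 1 < arr y 1) (hz1 : beg z 1 < arr z 1) (hb : beg y 0 = beg z 0)
    (ha : arr y 0 = arr z 0 ∨ 0 < arr y 0 ∧ 0 < arr z 0) (h : ∀ i < 0, y i = z i) :
    servicesPast 0 y = servicesPast 0 z := by
  have hlt : ∀ {y z : ℤ → ℝ × ℝ × ℝ}, IsCyc y → IsCyc z → dpt y 0 = 0 → dpt z 0 = 0 →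
      beg y 1 < arr y 1 → beg y 0 = beg z 0 → (arr y 0 = arr z 0 ∨ 0 < arr y 0 ∧ 0 < arr z 0) →
      (∀ i < 0, y i = z i) → ∀ t ≤ 0,
      ((∃ i, arr y i ≤ t ∧ t < dpt y i) → ∃ i, arr z i ≤ t ∧ t < dpt z i) ∧
      ((∃ i, beg y i ≤ t ∧ t < dpt y i) → ∃ i, beg z i ≤ t ∧ t < dpt z i) := by
    clear * -
    intro y z hy hz hy0 hz0 hy1 hb ha h t ht
    have hb1 : beg y 1 = max (arr y 0) 0 := by rw [← hy0]; exact hy.beg_succ 0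
    have hb1' : beg z 1 = max (arr z 0) 0 := by rw [← hz0]; exact hz.beg_succ 0
    have h0 : 0 ≤ beg y 1 := by rw [hb1]; exact le_max_right _ _
    have h2 : ∀ i, 1 < i → 0 < beg y i := fun i hi => h0.trans_lt (hy.strictMono_beg hi)
    constructor
    · rintro ⟨i, h3, h4⟩
      rcases lt_trichotomy i 0 with hi | rfl | hi
      · exact ⟨i, by rwa [arr, ← h i hi], by rwa [dpt, ← h i hi]⟩
      · rcases ha with ha | ha
        · exact ⟨0, by rwa [← ha], by rwa [hz0, ← hy0]⟩
        · linarith [ha.1]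
      · exfalso
        rcases (show 1 ≤ i by omega).eq_or_lt with rfl | hi'
        · linarith
        · linarith [h2 i hi', hy.beg_le_arr i]
    · rintro ⟨i, h3, h4⟩
      rcases lt_trichotomy i 0 with hi | rfl | hi
      · exact ⟨i, by rwa [beg, ← h i hi], by rwa [dpt, ← h i hi]⟩
      · exact ⟨0, by rwa [← hb], by rwa [hz0, ← hy0]⟩
      · rcases (show 1 ≤ i by omega).eq_or_lt with rfl | hi'
        · have ht0 : t = 0 := le_antisymm ht (h0.trans h3)
          subst ht0
          have h5 : arr y 0 ≤ 0 := by
            rw [hb1] at h3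
            exact (le_max_left _ _).trans h3
          have h6 : arr z 0 ≤ 0 := by
            rcases ha with ha | ha
            · rwa [← ha]
            · linarith [ha.1]
          have h7 : beg z 1 = 0 := by rw [hb1', max_eq_right h6]
          exact ⟨1, h7.le, by rw [← h7]; exact hz.beg_lt_dpt 1⟩
        · linarith [h2 i hi']
  have hn : ∀ t ≤ 0, num y t = num z t := by
    intro t ht
    have h1 := hlt hy hz hy0 hz0 hy1 hb ha h t ht
    have h2 := hlt hz hy hz0 hy0 hz1 hb.symm (ha.imp Eq.symm And.symm)
      (fun i hi => (h i hi).symm) t ht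
    exact num_congr ⟨h1.1, h2.1⟩ ⟨h1.2, h2.2⟩
  have hd : ∀ k : ℕ, dpt y (-k) = dpt z (-k) := by
    intro k
    rcases Nat.eq_zero_or_pos k with rfl | hk
    · simp [hy0, hz0]
    · rw [dpt, dpt, h (-k) (by omega)]
  refine Prod.ext (funext fun k => ?_) (funext fun u => ?_)
  · simp only [servicesPast, past, embedded, zero_sub]
    rw [hy0, hz0, hn _ (by rw [← hy0]; exact hy.strictMono_dpt.monotone (by omega)), hd]
  · simp only [servicesPast, past, hy0, hz0, zero_sub]
    exact hn _ (by simp)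

end Paths

end AoI

end

/-! ### The semi-Markov property for i.i.d. marks. -/

noncomputable section

namespace AoI

variable {lam : ℝ} {G : Measure ℝ}

section Memoryless

lemma setLIntegral_Ioi_expMeasure (hlam : 0 < lam) {a : ℝ} (ha : 0 ≤ a) {g : ℝ → ℝ≥0∞}
    (hg : Measurable g) :
    ∫⁻ x in Ioi a, g (x - a) ∂(expMeasure lam)
      = ∫⁻ _ in Ioi a, (∫⁻ e, g e ∂(expMeasure lam)) ∂(expMeasure lam) := by
  have : NullSingletonClass (expMeasure lam) := ⟨expMeasure_singleton⟩
  rw [Measure.restrict_congr_set Ioi_ae_eq_Ici, ← lintegral_indicator measurableSet_Ici,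
    setLIntegral_const, mul_comm]
  exact lintegral_expMeasure_memoryless hlam ha hg

/-- The marks of a service, up to the residual waiting time for an arrival if the server becomes
idle. -/
def trunc (q : ℝ × ℝ) : ℝ × ℝ := (if q.1 ≤ q.2 then q.1 else q.2 + 1, q.2)

@[fun_prop]
lemma measurable_trunc : Measurable trunc :=
  (Measurable.ite (measurableSet_le measurable_fst measurable_snd) measurable_fst
    (measurable_snd.add_const 1)).prodMk measurable_snd

/-- If `A ≤ σ`, the residual waiting time is `0`. If `A > σ`, all that `trunc` retains of `A` is
this fact, and `A - σ` is a fresh exponential variable; `σ + 1` merely marks the case. -/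
lemma lintegral_trunc (hlam : 0 < lam) [IsProbabilityMeasure G] (hG : ∀ᵐ σ ∂G, 0 ≤ σ)
    {g : (ℝ × ℝ) × ℝ → ℝ≥0∞} (hg : Measurable g) :
    ∫⁻ q, g (trunc q, max (q.1 - q.2) 0) ∂(cycleLaw lam G)
      = ∫⁻ q, (∫⁻ e, g (trunc q, e)
        ∂(if q.1 ≤ q.2 then Measure.dirac 0 else expMeasure lam)) ∂(cycleLaw lam G) := by
  have := isProbabilityMeasure_expMeasure hlam
  have hF : Measurable fun q : ℝ × ℝ => ∫⁻ e, g (trunc q, e)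
      ∂(if q.1 ≤ q.2 then Measure.dirac 0 else expMeasure lam) := by
    have : (fun q : ℝ × ℝ => ∫⁻ e, g (trunc q, e)
      ∂(if q.1 ≤ q.2 then Measure.dirac 0 else expMeasure lam)) = fun q : ℝ × ℝ =>
        if q.1 ≤ q.2 then g (trunc q, 0) else ∫⁻ e, g (trunc q, e) ∂(expMeasure lam) := by
      funext q
      split_ifs
      · rw [lintegral_dirac' _ (by fun_prop)]
      · rfl
    rw [this]
    refine Measurable.ite (measurableSet_le measurable_fst measurable_snd) (by fun_prop) ?_
    exact Measurable.lintegral_prod_right (f := fun q e => g (trunc q, e)) (by fun_prop)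
  rw [cycleLaw, lintegral_prod_symm _ (by fun_prop), lintegral_prod_symm _ hF.aemeasurable]
  refine lintegral_congr_ae (hG.mono fun σ hσ => ?_)
  simp only
  rw [← lintegral_add_compl _ (measurableSet_Iic (a := σ)),
    ← lintegral_add_compl (fun A => ∫⁻ e, g (trunc (A, σ), e)
      ∂(if A ≤ σ then Measure.dirac 0 else expMeasure lam)) (measurableSet_Iic (a := σ)), compl_Iic]
  congr 1
  · refine setLIntegral_congr_fun measurableSet_Iic fun A hA => ?_
    have hA' : A ≤ σ := hA
    rw [if_pos hA', lintegral_dirac' _ (by fun_prop), max_eq_right (by linarith)]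
  · have h1 : ∀ A ∈ Ioi σ, g (trunc (A, σ), max (A - σ) 0) = g ((σ + 1, σ), A - σ) := by
      intro A hA
      have hA' : σ < A := hA
      rw [max_eq_left (by linarith), trunc, if_neg (not_le.2 hA')]
    have h2 : ∀ A ∈ Ioi σ, ∫⁻ e, g (trunc (A, σ), e)
        ∂(if A ≤ σ then Measure.dirac 0 else expMeasure lam)
          = ∫⁻ e, g ((σ + 1, σ), e) ∂(expMeasure lam) := by
      intro A hA
      have hA' : σ < A := hA
      simp only [trunc, if_neg (not_le.2 hA')]
    rw [setLIntegral_congr_fun measurableSet_Ioi h1, setLIntegral_congr_fun measurableSet_Ioi h2]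
    exact setLIntegral_Ioi_expMeasure hlam hσ (g := fun e => g ((σ + 1, σ), e)) (by fun_prop)

end Memoryless

section Canonical

lemma monotone_dpt_services {c : ℤ → ℝ × ℝ} (hc : ∀ i, 0 ≤ (c i).2) :
    Monotone (dpt (services c)) :=
  monotone_int_of_le_succ fun i => by
    have h1 := services_beg_succ c i
    have h2 := hc (i + 1)
    have h3 := le_max_right (arr (services c) i) (dpt (services c) i)
    rw [← h1] at h3
    have h4 : dpt (services c) (i + 1) = beg (services c) (i + 1) + (c (i + 1)).2 := rfl
    linarith

/-- The future after the end of a service, if the next service begins after time `e` and `d` are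
the marks of the next services. -/
def futureFrom (p : ℝ × (ℕ → ℝ × ℝ)) : (ℕ → ℝ × ℕ) × (ℝ≥0 → ℕ) :=
  servicesFuture 0 (services (join (fun _ => (1, 1)) (scons (p.1, 0) p.2)))

@[fun_prop]
lemma measurable_futureFrom : Measurable futureFrom :=
  (measurable_servicesFuture 0).comp (measurable_services.comp (by fun_prop))

/-- The past before the end of a service, if `a` are the marks of the previous services and `q`
are the marks of this service. -/
def pastFrom (p : (ℕ → ℝ × ℝ) × (ℝ × ℝ)) : (ℕ → ℝ × ℕ) × (ℝ≥0 → ℕ) :=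
  servicesPast 0 (services (join p.1 (scons p.2 fun _ => (1, 1))))

@[fun_prop]
lemma measurable_pastFrom : Measurable pastFrom :=
  (measurable_servicesPast 0).comp (measurable_services.comp (by fun_prop))

lemma join_scons_zero (a d : ℕ → ℝ × ℝ) (q : ℝ × ℝ) : join a (scons q d) 0 = q := rfl

lemma join_pos {p : ℝ × ℝ → Prop} {a d : ℕ → ℝ × ℝ} (ha : ∀ k, p (a k)) (hd : ∀ k, p (d k))
    (i : ℤ) : p (join a d i) := by
  cases i with
  | ofNat k => exact hd k
  | negSucc k => exact ha k

lemma scons_pos {p : ℝ × ℝ → Prop} {d : ℕ → ℝ × ℝ} {q : ℝ × ℝ} (hq : p q) (hd : ∀ k, p (d k))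
    (k : ℕ) : p (scons q d k) := by
  cases k with
  | zero => exact hq
  | succ k => exact hd k

/-- Marks which are positive numbers. -/
def PosMark (q : ℝ × ℝ) : Prop := 0 < q.1 ∧ 0 < q.2

/-- After the end of service `0` its mark matters only through the residual waiting time, which may
be paired with duration `0`. Earlier marks do not matter at all, whence the dummies in `futureFrom`.
-/
lemma servicesFuture_eq {a d : ℕ → ℝ × ℝ} {q : ℝ × ℝ} (ha : ∀ k, PosMark (a k)) (hq : PosMark q)
    (hd : ∀ k, PosMark (d k)) :
    servicesFuture 0 (services (join a (scons q d))) = futureFrom (max (q.1 - q.2) 0, d) := by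
  refine servicesFuture_congr (monotone_dpt_services fun i => ?_) (monotone_dpt_services fun i => ?_)
    (by simp) (by simp) ?_
  · exact join_pos (p := fun q => 0 ≤ q.2) (fun k => (ha k).2.le)
      (scons_pos (p := fun q => 0 ≤ q.2) hq.2.le fun k => (hd k).2.le) i
  · exact join_pos (p := fun q => 0 ≤ q.2) (fun k => zero_le_one)
      (scons_pos (p := fun q => 0 ≤ q.2) le_rfl fun k => (hd k).2.le) i
  · intro i hi
    obtain ⟨k, rfl⟩ : ∃ k : ℕ, i = k + 1 := ⟨(i - 1).toNat, by omega⟩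
    clear hi
    refine Prod.ext ?_ rfl
    change beg _ _ = beg _ _
    induction k with
    | zero =>
      rw [Nat.cast_zero, services_beg_succ, services_beg_succ, dpt_services_zero,
        dpt_services_zero]
      simp [arr, services, join_scons_zero, begFrom_zero, sub_eq_add_neg, add_comm]
    | succ k ih =>
      rw [Nat.cast_succ, services_beg_succ, services_beg_succ]
      simp only [beg] at ih
      simp only [arr, dpt, ih]
      rfl

lemma begFrom_congr {c c' : ℤ → ℝ × ℝ} (h : ∀ l < 0, c l = c' l) {i : ℤ} (hi : i ≤ 0) :
    begFrom c i = begFrom c' i := by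
  unfold begFrom
  rw [Finset.Ico_eq_empty (by omega)]
  simp only [Finset.sum_empty, zero_sub, neg_inj]
  refine Finset.sum_congr rfl fun l hl => ?_
  rw [h l (Finset.mem_Ico.1 hl).2]

/-- An arrival after the end of service `0` is not seen before it, so `q` may be truncated. The
later marks become dummies, positive ones so that `IsCyc` holds. -/
lemma servicesPast_eq {a d : ℕ → ℝ × ℝ} {q : ℝ × ℝ} (ha : ∀ k, PosMark (a k)) (hq : PosMark q)
    (hd : ∀ k, PosMark (d k)) :
    servicesPast 0 (services (join a (scons q d))) = pastFrom (a, trunc q) := by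
  have hq' : PosMark (trunc q) := by
    unfold trunc
    refine ⟨?_, hq.2⟩
    simp only
    split_ifs
    · exact hq.1
    · linarith [hq.2]
  have hp := join_pos (p := PosMark) ha (scons_pos hq hd)
  have hp' := join_pos (p := PosMark) ha
    (scons_pos (d := fun _ => (1, 1)) hq' fun _ => ⟨zero_lt_one, zero_lt_one⟩)
  have hneg : ∀ l < 0, join a (scons q d) l = join a (scons (trunc q) fun _ => (1, 1)) l := by
    intro l hl
    cases l with
    | ofNat k => exact absurd hl (by simp)
    | negSucc k => rfl
  refine servicesPast_congr (isCyc_services hp) (isCyc_services hp') (by simp) (by simp) ?_ ?_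
    ?_ ?_ ?_
  · simp only [beg, arr, services]; linarith [(hp 1).1]
  · simp only [beg, arr, services]; linarith [(hp' 1).1]
  · simp [beg, services, begFrom_zero, join_scons_zero, trunc]
  · simp only [arr, services, begFrom_zero, join_scons_zero, trunc]
    by_cases h : q.1 ≤ q.2
    · left; rw [if_pos h]
    · right; rw [if_neg h]
      constructor <;> linarith
  · intro i hi
    refine Prod.ext ?_ (hneg i hi)
    simp only [services, join_scons_zero, begFrom_congr hneg hi.le, trunc]

/-- A message is left behind exactly if one arrived during the service. It then enters service at
once and the next arrival is still to come, so the count is 1 and not 2. -/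
lemma num_services_zero {c : ℤ → ℝ × ℝ} (hc : ∀ i, PosMark (c i)) :
    num (services c) 0 = if (c 0).1 ≤ (c 0).2 then 1 else 0 := by
  have h := isCyc_services hc
  have h0 : beg (services c) 1 = max ((c 0).1 - (c 0).2) 0 := by
    have h1 := services_beg_succ c 0
    rw [dpt_services_zero] at h1
    rw [show (1 : ℤ) = 0 + 1 by norm_num, h1]
    simp [arr, services, begFrom_zero, sub_eq_add_neg, add_comm]
  by_cases hq : (c 0).1 ≤ (c 0).2
  · rw [max_eq_right (by linarith)] at h0
    have h1 := h.beg_lt_dpt 1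
    have h2 := h.dpt_le_beg (show (1 : ℤ) < 1 + 1 by norm_num)
    have h3 : arr (services c) 1 = beg (services c) 1 + (c 1).1 := rfl
    have h4 := (hc 1).1
    rw [h.num_eq (i := 1) h0.le (by linarith), if_pos (by linarith), if_pos hq,
      if_neg (by linarith)]
  · rw [max_eq_left (by linarith)] at h0
    have h1 := h.beg_lt_dpt 0
    rw [dpt_services_zero] at h1
    rw [h.num_eq (i := 0) h1.le (by rw [zero_add, h0]; linarith), dpt_services_zero,
      if_neg (lt_irrefl _), if_neg hq]

/-- The transition law of the semi-Markov process. -/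
def transition (lam : ℝ) (G : Measure ℝ) : Kernel ℕ ((ℕ → ℝ × ℕ) × (ℝ≥0 → ℕ)) :=
  Kernel.ofFunOfCountable fun n =>
    ((if n = 0 then expMeasure lam else Measure.dirac 0).prod
      (Measure.infinitePi fun _ : ℕ => cycleLaw lam G)).map futureFrom

lemma isMarkovKernel_transition (hlam : 0 < lam) [IsProbabilityMeasure G] :
    IsMarkovKernel (transition lam G) := by
  have := isProbabilityMeasure_expMeasure hlam
  have := isProbabilityMeasure_cycleLaw hlam (G := G)
  refine ⟨fun n => ?_⟩
  have : IsProbabilityMeasure (if n = 0 then expMeasure lam else Measure.dirac 0) := by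
    split_ifs <;> infer_instance
  exact Measure.isProbabilityMeasure_map measurable_futureFrom.aemeasurable

lemma ae_posMark_cycleLaw (hlam : 0 < lam) [IsProbabilityMeasure G] (hG : G (Iic 0) = 0) :
    ∀ᵐ q ∂(cycleLaw lam G), PosMark q := by
  have := isProbabilityMeasure_expMeasure hlam
  have h1 : ∀ᵐ q ∂(cycleLaw lam G), 0 < q.1 :=
    (Measure.quasiMeasurePreserving_fst (μ := expMeasure lam) (ν := G)).ae (ae_expMeasure_pos hlam)
  have h2 : ∀ᵐ σ ∂G, 0 < σ := by
    rw [ae_iff]; simpa [Iic, not_lt] using hG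
  have h3 : ∀ᵐ q ∂(cycleLaw lam G), 0 < q.2 :=
    (Measure.quasiMeasurePreserving_snd (μ := expMeasure lam) (ν := G)).ae h2
  filter_upwards [h1, h3] with q hq hq' using ⟨hq, hq'⟩

lemma ae_posMark_infinitePi (hlam : 0 < lam) [IsProbabilityMeasure G] (hG : G (Iic 0) = 0)
    {ι : Type*} [Countable ι] :
    ∀ᵐ c ∂(Measure.infinitePi fun _ : ι => cycleLaw lam G), ∀ i, PosMark (c i) := by
  have := isProbabilityMeasure_cycleLaw hlam (G := G)
  refine ae_all_iff.2 fun i => ?_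
  exact (measurePreserving_eval_infinitePi (fun _ : ι => cycleLaw lam G)
    i).quasiMeasurePreserving.ae (ae_posMark_cycleLaw hlam hG)

/-- For fixed earlier marks the past is a function of `trunc q`, and the future is a function of the
residual waiting time and of the later marks. By `lintegral_trunc` the two are linked only by
whether `q.1 ≤ q.2`, that is, by the number of messages left behind. -/
theorem lintegral_servicesPast_servicesFuture_zero (hlam : 0 < lam) [IsProbabilityMeasure G]
    (hG : G (Iic 0) = 0)
    {H : ((ℕ → ℝ × ℕ) × (ℝ≥0 → ℕ)) × ((ℕ → ℝ × ℕ) × (ℝ≥0 → ℕ)) → ℝ≥0∞} (hH : Measurable H) :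
    ∫⁻ c, H (servicesPast 0 (services c), servicesFuture 0 (services c))
        ∂(Measure.infinitePi fun _ : ℤ => cycleLaw lam G)
      = ∫⁻ c, (∫⁻ w, H (servicesPast 0 (services c), w)
          ∂(transition lam G (num (services c) 0)))
        ∂(Measure.infinitePi fun _ : ℤ => cycleLaw lam G) := by
  have := isProbabilityMeasure_expMeasure hlam
  have := isProbabilityMeasure_cycleLaw hlam (G := G)
  have := isMarkovKernel_transition hlam (G := G)
  have hs := measurable_services
  have hF : Measurable fun c : ℤ → ℝ × ℝ => ∫⁻ w, H (servicesPast 0 (services c), w)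
      ∂(transition lam G (num (services c) 0)) := by
    have h1 : Measurable fun p : ℕ × ((ℕ → ℝ × ℕ) × (ℝ≥0 → ℕ)) =>
        ∫⁻ w, H (p.2, w) ∂(transition lam G p.1) :=
      Measurable.lintegral_kernel_prod_right' (κ := (transition lam G).comap Prod.fst
        measurable_fst) (f := fun r : (ℕ × ((ℕ → ℝ × ℕ) × (ℝ≥0 → ℕ))) × _ => H (r.1.2, r.2))
        (by fun_prop)
    exact h1.comp (by fun_prop : Measurable fun c : ℤ → ℝ × ℝ =>
      (num (services c) 0, servicesPast 0 (services c)))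
  rw [lintegral_infinitePi_join _ (by fun_prop), lintegral_infinitePi_join _ hF]
  have hpos := ae_posMark_infinitePi hlam hG (ι := ℕ)
  refine lintegral_congr_ae (hpos.mono fun a ha => ?_)
  simp only
  set M := Measure.infinitePi fun _ : ℕ => cycleLaw lam G
  have hg : Measurable fun p : (ℝ × ℝ) × ℝ => ∫⁻ d, H (pastFrom (a, p.1), futureFrom (p.2, d)) ∂M :=
    Measurable.lintegral_prod_right
      (f := fun (p : (ℝ × ℝ) × ℝ) d => H (pastFrom (a, p.1), futureFrom (p.2, d))) (by fun_prop)
  have hG' : ∀ᵐ σ ∂G, 0 ≤ σ := by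
    have : ∀ᵐ σ ∂G, 0 < σ := by rw [ae_iff]; simpa [Iic, not_lt] using hG
    exact this.mono fun _ h => h.le
  refine Eq.trans (lintegral_congr_ae ?_) ((lintegral_trunc hlam hG' hg).trans
    (lintegral_congr_ae ?_))
  · filter_upwards [ae_posMark_cycleLaw hlam hG] with q hq
    refine lintegral_congr_ae (hpos.mono fun d hd => ?_)
    simp only
    rw [servicesPast_eq ha hq hd, servicesFuture_eq ha hq hd]
  · filter_upwards [ae_posMark_cycleLaw hlam hG] with q hq
    have h1 : ∀ᵐ d ∂M, ∫⁻ w, H (servicesPast 0 (services (join a (scons q d))), w)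
        ∂(transition lam G (num (services (join a (scons q d))) 0))
        = ∫⁻ e, ∫⁻ d, H (pastFrom (a, trunc q), futureFrom (e, d)) ∂M
          ∂(if q.1 ≤ q.2 then Measure.dirac 0 else expMeasure lam) := by
      filter_upwards [hpos] with d hd
      rw [servicesPast_eq ha hq hd, num_services_zero (join_pos ha (scons_pos hq hd)),
        join_scons_zero]
      have h2 : transition lam G (if q.1 ≤ q.2 then 1 else 0)
          = ((if q.1 ≤ q.2 then Measure.dirac 0 else expMeasure lam).prod M).map futureFrom := by
        change Measure.map futureFrom (Measure.prod _ _) = _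
        congr 2
        split_ifs <;> simp_all
      have : SFinite (if q.1 ≤ q.2 then Measure.dirac 0 else expMeasure lam) := by
        split_ifs <;> infer_instance
      rw [h2, lintegral_map (by fun_prop) (by fun_prop), lintegral_prod _ (by fun_prop)]
    rw [lintegral_congr_ae h1]
    simp

end Canonical

end AoI

end

/-! ### The inversion formula and the law under `P`. -/

noncomputable section

namespace AoI

/-- The change of labels commutes with the successor, as both sequences list the same points in
order, and the position of time `0` makes it fix label `0`. -/
lemma IsEnumeration.unique {A : Set ℝ} {s t : ℤ → ℝ} (hs : IsEnumeration A s)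
    (ht : IsEnumeration A t) : s = t := by
  have h1 : ∀ i, ∃ j, t j = s i := fun i => by
    have : s i ∈ range t := by rw [ht.2.1, ← hs.2.1]; exact ⟨i, rfl⟩
    exact this
  choose f hf using h1
  have hf1 : ∀ i, f (i + 1) = f i + 1 := by
    intro i
    obtain ⟨j, hj⟩ : t (f i + 1) ∈ range s := by rw [hs.2.1, ← ht.2.1]; exact ⟨_, rfl⟩
    have h2 : s i < s j := by rw [hj, ← hf]; exact ht.1 (by omega)
    have h3 : s (i + 1) ≤ s j := hs.1.monotone (by have := hs.1.lt_iff_lt.1 h2; omega)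
    rw [hj, ← hf, ht.1.le_iff_le] at h3
    have h4 : s i < s (i + 1) := hs.1 (by omega)
    rw [← hf, ← hf, ht.1.lt_iff_lt] at h4
    omega
  have hf0 : f 0 = 0 := by
    have h2 : t (f 0) < t 1 := by rw [hf]; exact hs.2.2.1.trans_lt ht.2.2.2
    have h3 : t 0 < t (f 0 + 1) := by
      rw [← hf1, zero_add, hf]; exact ht.2.2.1.trans_lt hs.2.2.2
    have := ht.1.lt_iff_lt.1 h2
    have := ht.1.lt_iff_lt.1 h3
    omega
  have hfi : ∀ i, f i = i := by
    intro i
    induction i with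
    | zero => exact hf0
    | succ i ih => rw [hf1, ih]
    | pred i ih =>
      have := hf1 (-i - 1)
      rw [sub_add_cancel] at this
      omega
  funext i
  rw [← hf, hfi]

lemma IsEnumeration.enumeration_eq {A : Set ℝ} {s : ℤ → ℝ} (hs : IsEnumeration A s) :
    enumeration A = s := by
  have h : ∃ s, IsEnumeration A s := ⟨s, hs⟩
  rw [enumeration, dif_pos h]
  exact h.choose_spec.unique hs

section CondDistrib

variable {Ω 𝓧 𝓨 : Type*} [MeasurableSpace Ω] [MeasurableSpace 𝓧] [MeasurableSpace 𝓨]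

lemma hasCondDistrib_of_lintegral {Q : Measure Ω} [IsFiniteMeasure Q] {U : Ω → 𝓧} {V : Ω → 𝓨}
    {κ : Kernel 𝓧 𝓨} [IsMarkovKernel κ] (hU : AEMeasurable U Q) (hV : AEMeasurable V Q)
    (h : ∀ H : 𝓧 × 𝓨 → ℝ≥0∞, Measurable H →
      ∫⁻ ω, H (U ω, V ω) ∂Q = ∫⁻ ω, (∫⁻ w, H (U ω, w) ∂(κ (U ω))) ∂Q) :
    HasCondDistrib V U κ Q := by
  refine ⟨hU.prodMk hV, Measure.ext_of_lintegral _ fun H hH => ?_⟩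
  have hm : Measurable fun u => ∫⁻ w, H (u, w) ∂(κ u) := hH.lintegral_kernel_prod_right'
  rw [lintegral_map' hH.aemeasurable (hU.prodMk hV), h H hH, Measure.lintegral_compProd hH,
    lintegral_map' hm.aemeasurable hU]

end CondDistrib

section Window

variable {lam : ℝ} {G : Measure ℝ}

/-- The indicator function of `[0, d)`. -/
def window (d t : ℝ) : ℝ≥0∞ := if 0 ≤ t ∧ t < d then 1 else 0

@[fun_prop]
lemma Measurable.window {α : Type*} [MeasurableSpace α] {f g : α → ℝ} (hf : Measurable f)
    (hg : Measurable g) : Measurable fun a => window (f a) (g a) := by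
  unfold AoI.window
  exact Measurable.ite ((measurableSet_le measurable_const hg).inter (measurableSet_lt hg hf))
    measurable_const measurable_const

lemma lintegral_shift_infinitePi (hlam : 0 < lam) [IsProbabilityMeasure G] (n : ℤ)
    {f : (ℤ → ℝ × ℝ) → ℝ≥0∞} (hf : Measurable f) :
    ∫⁻ c, f (fun i => c (i + n)) ∂(Measure.infinitePi fun _ : ℤ => cycleLaw lam G)
      = ∫⁻ c, f c ∂(Measure.infinitePi fun _ : ℤ => cycleLaw lam G) := by
  have := isProbabilityMeasure_cycleLaw hlam (G := G)
  have h := infinitePi_map_precomp (cycleLaw lam G) (g := fun i : ℤ => i + n)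
    fun a b hab => by simpa using hab
  conv_rhs => rw [← h]
  rw [lintegral_map hf (by fun_prop)]

lemma servicesPast_services (n : ℤ) (c : ℤ → ℝ × ℝ) :
    servicesPast n (services c) = servicesPast 0 (services fun i => c (i + n)) := by
  have h := translate_relabel_eq_services (services_beg_succ c) n
  rw [marks_services] at h
  rw [← h, servicesPast_translate, servicesPast_relabel, zero_add]

lemma servicesFuture_services (n : ℤ) (c : ℤ → ℝ × ℝ) :
    servicesFuture n (services c) = servicesFuture 0 (services fun i => c (i + n)) := by
  have h := translate_relabel_eq_services (services_beg_succ c) n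
  rw [marks_services] at h
  rw [← h, servicesFuture_translate, servicesFuture_relabel, zero_add]

lemma present_servicesPast (n : ℤ) (y : ℤ → ℝ × ℝ × ℝ) :
    present (servicesPast n y) = num y (dpt y n) := by
  simp [present, servicesPast, past]

lemma num_services_dpt (n : ℤ) (c : ℤ → ℝ × ℝ) :
    num (services c) (dpt (services c) n) = num (services fun i => c (i + n)) 0 := by
  rw [← present_servicesPast, servicesPast_services, present_servicesPast, dpt_services_zero]

theorem lintegral_servicesPast_servicesFuture (hlam : 0 < lam) [IsProbabilityMeasure G]
    (hG : G (Iic 0) = 0) (n : ℤ)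
    {H : ((ℕ → ℝ × ℕ) × (ℝ≥0 → ℕ)) × ((ℕ → ℝ × ℕ) × (ℝ≥0 → ℕ)) → ℝ≥0∞} (hH : Measurable H) :
    ∫⁻ c, H (servicesPast n (services c), servicesFuture n (services c))
        ∂(Measure.infinitePi fun _ : ℤ => cycleLaw lam G)
      = ∫⁻ c, (∫⁻ w, H (servicesPast n (services c), w)
          ∂(transition lam G (present (servicesPast n (services c)))))
        ∂(Measure.infinitePi fun _ : ℤ => cycleLaw lam G) := by
  have := isMarkovKernel_transition hlam (G := G)
  have hs := measurable_services
  have hF : Measurable fun p => ∫⁻ w, H (p, w) ∂(transition lam G (present p)) :=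
    Measurable.lintegral_kernel_prod_right' (κ := (transition lam G).comap present
        measurable_present) hH
  simp_rw [servicesPast_services n, servicesFuture_services n]
  rw [lintegral_shift_infinitePi hlam n (f := fun c => H (servicesPast 0 (services c),
    servicesFuture 0 (services c))) (by fun_prop), lintegral_shift_infinitePi hlam n
    (f := fun c => ∫⁻ w, H (servicesPast 0 (services c), w)
      ∂(transition lam G (present (servicesPast 0 (services c))))) (hF.comp (by fun_prop)),
    lintegral_servicesPast_servicesFuture_zero hlam hG hH]
  simp_rw [present_servicesPast, dpt_services_zero]

/-- The mean number of successful departures per unit of time. -/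
def intensity (lam : ℝ) (G : Measure ℝ) : ℝ≥0∞ :=
  (∫⁻ c, (∫⁻ t, window (dpt (services c) 1) t)
    ∂(Measure.infinitePi fun _ : ℤ => cycleLaw lam G))⁻¹

variable {Ω : Type*} [MeasurableSpace Ω] {P : Measure Ω}
  {Y : Ω → ℤ → ℝ × ℝ × ℝ}

/-- Almost surely exactly one relabelling puts time `0` between the ends of services `0` and `1`, so
weighting by this event recovers `P` from `labelMeasure P Y`. -/
lemma IsCycleFlow.lintegral_eq_of_labelMeasure (h : IsCycleFlow P Y lam G) {m : ℝ≥0∞}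
    (hm : ∀ φ : (ℤ → ℝ × ℝ × ℝ) → ℝ≥0∞, Measurable φ →
        ∫⁻ y, φ y ∂(labelMeasure P Y) = m * ∫⁻ c, (∫⁻ t, φ (translate t (services c)))
          ∂(Measure.infinitePi fun _ : ℤ => cycleLaw lam G))
    {χ : (ℤ → ℝ × ℝ × ℝ) → ℝ≥0∞} (hχ : Measurable χ) :
    ∫⁻ ω, χ (Y ω) ∂P = m * ∫⁻ c, (∫⁻ t, window (dpt (services c) 1) t *
        χ (translate t (services c))) ∂(Measure.infinitePi fun _ : ℤ => cycleLaw lam G) := by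
  have hw : ∀ y : ℤ → ℝ × ℝ × ℝ, window (dpt y 1 - dpt y 0) (-dpt y 0)
      = if dpt y 0 ≤ 0 ∧ 0 < dpt y 1 then 1 else 0 := by
    intro y
    unfold window
    refine if_congr ?_ rfl rfl
    constructor <;> rintro ⟨h1, h2⟩ <;> constructor <;> linarith
  have h1 : ∫⁻ ω, χ (Y ω) ∂P
      = ∫⁻ y, window (dpt y 1 - dpt y 0) (-dpt y 0) * χ y ∂(labelMeasure P Y) := by
    rw [lintegral_labelMeasure h.measurable (by fun_prop)]
    refine lintegral_congr_ae ?_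
    filter_upwards [h.isCyc, h.dpt_zero, h.dpt_one] with ω g1 g2 g3
    rw [tsum_eq_single 0]
    · rw [hw, dpt_relabel, dpt_relabel, if_pos ⟨by simpa using g2, by simpa using g3⟩, one_mul]
      congr 1
      funext i; simp [relabel]
    · intro k hk
      rw [hw, dpt_relabel, dpt_relabel, if_neg, zero_mul]
      rintro ⟨g4, g5⟩
      have h3 : dpt (Y ω) (0 + k) < dpt (Y ω) 1 := g4.trans_lt g3
      have h4 : dpt (Y ω) 0 < dpt (Y ω) (1 + k) := g2.trans_lt g5
      rw [g1.strictMono_dpt.lt_iff_lt] at h3 h4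
      omega
  rw [h1, hm _ (by fun_prop)]
  simp_rw [dpt_translate, sub_sub_sub_cancel_right, dpt_services_zero, sub_zero, zero_sub, neg_neg]

variable [IsProbabilityMeasure P]

/-- The inversion formula applied to the constant `1` forces `m` to be the inverse of the mean
distance between departures, a quantity that involves only `lam` and `G`. -/
theorem IsCycleFlow.intensity_spec (h : IsCycleFlow P Y lam G) (hlam : 0 < lam)
    [IsProbabilityMeasure G] :
    intensity lam G ≠ 0 ∧ intensity lam G ≠ ∞ ∧
    ∀ φ : (ℤ → ℝ × ℝ × ℝ) → ℝ≥0∞, Measurable φ →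
        ∫⁻ y, φ y ∂(labelMeasure P Y) = intensity lam G *
          ∫⁻ c, (∫⁻ t, φ (translate t (services c)))
            ∂(Measure.infinitePi fun _ : ℤ => cycleLaw lam G) := by
  obtain ⟨m, hm, hφ⟩ := h.exists_lintegral_eq hlam
  have h1 := h.lintegral_eq_of_labelMeasure hφ (χ := fun _ => 1) measurable_const
  simp only [mul_one, lintegral_one, measure_univ] at h1
  have h2 : m = intensity lam G := ENNReal.eq_inv_of_mul_eq_one_left h1.symm
  rw [← h2]
  refine ⟨?_, hm, hφ⟩
  rintro rfl
  simp at h1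

theorem IsCycleFlow.lintegral_eq (h : IsCycleFlow P Y lam G) (hlam : 0 < lam)
    [IsProbabilityMeasure G] {χ : (ℤ → ℝ × ℝ × ℝ) → ℝ≥0∞} (hχ : Measurable χ) :
    ∫⁻ ω, χ (Y ω) ∂P = intensity lam G * ∫⁻ c, (∫⁻ t, window (dpt (services c) 1) t *
        χ (translate t (services c))) ∂(Measure.infinitePi fun _ : ℤ => cycleLaw lam G) :=
  h.lintegral_eq_of_labelMeasure (h.intensity_spec hlam).2.2 hχ

/-- In `IsCycleFlow.lintegral_eq` the right-hand side contains only `lam` and `G`. Nothing about the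
policy is left. -/
theorem IsCycleFlow.map_eq {Ω' : Type*} [MeasurableSpace Ω'] {P' : Measure Ω'}
    [IsProbabilityMeasure P'] {Y' : Ω' → ℤ → ℝ × ℝ × ℝ} (h : IsCycleFlow P Y lam G)
    (h' : IsCycleFlow P' Y' lam G) (hlam : 0 < lam) [IsProbabilityMeasure G] :
    P.map Y = P'.map Y' := by
  refine Measure.ext_of_lintegral _ fun χ hχ => ?_
  rw [lintegral_map hχ h.measurable, lintegral_map hχ h'.measurable, h.lintegral_eq hlam hχ,
    h'.lintegral_eq hlam hχ]

/-- The process is semi-Markov after time `0`. -/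
theorem IsCycleFlow.lintegral_after_zero (h : IsCycleFlow P Y lam G) (hlam : 0 < lam)
    [IsProbabilityMeasure G] (hG : G (Iic 0) = 0) {n : ℤ} (hn : 1 ≤ n)
    {H : (ℝ × ((ℕ → ℝ × ℕ) × (ℝ≥0 → ℕ))) × ((ℕ → ℝ × ℕ) × (ℝ≥0 → ℕ)) → ℝ≥0∞}
    (hH : Measurable H) :
    ∫⁻ ω, H ((dpt (Y ω) n, servicesPast n (Y ω)), servicesFuture n (Y ω)) ∂P
      = ∫⁻ ω, (∫⁻ w, H ((dpt (Y ω) n, servicesPast n (Y ω)), w)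
          ∂(transition lam G (present (servicesPast n (Y ω))))) ∂P := by
  have := isMarkovKernel_transition hlam (G := G)
  have hs := measurable_services
  obtain ⟨k, rfl⟩ : ∃ k : ℕ, n = k + 1 := ⟨(n - 1).toNat, by omega⟩
  clear hn
  set n : ℤ := k + 1 with hn
  have hF : Measurable fun p : ℝ × ((ℕ → ℝ × ℕ) × (ℝ≥0 → ℕ)) =>
      ∫⁻ w, H (p, w) ∂(transition lam G (present p.2)) :=
    Measurable.lintegral_kernel_prod_right' (κ := (transition lam G).comap presentAt
        measurable_presentAt) hH
  rw [h.lintegral_eq hlam (χ := fun y => H ((dpt y n, servicesPast n y), servicesFuture n y))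
    (by fun_prop), h.lintegral_eq hlam (χ := fun y => ∫⁻ w, H ((dpt y n, servicesPast n y), w)
      ∂(transition lam G (present (servicesPast n y))))
      (hF.comp (by fun_prop : Measurable fun y => (dpt y n, servicesPast n y)))]
  congr 1
  -- As `n = k + 1`, departures `0` and `1` belong to the past at departure `n`. So the window
  -- around time `0` and the position of departure `n` are functions of that past and of `t`, and
  -- the identity for i.i.d. marks survives the weighting.
  have hDn : ∀ c, dpt (services c) n = ((servicesPast n (services c)).1 (k + 1)).1 := by
    intro c
    simp only [servicesPast, past]
    rw [show n - ((k + 1 : ℕ) : ℤ) = 0 by push_cast; omega, dpt_services_zero, sub_zero]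
  have hD1 : ∀ c, dpt (services c) 1 = ((servicesPast n (services c)).1 (k + 1)).1 -
      ((servicesPast n (services c)).1 k).1 := by
    intro c
    rw [← hDn]
    simp only [servicesPast, past]
    rw [show n - (k : ℤ) = 1 by omega]
    ring
  simp_rw [dpt_translate, servicesPast_translate, servicesFuture_translate, hD1, hDn]
  have hg : Measurable fun p : ((ℕ → ℝ × ℕ) × (ℝ≥0 → ℕ)) × ((ℕ → ℝ × ℕ) × (ℝ≥0 → ℕ)) =>
      ∫⁻ t, window ((p.1.1 (k + 1)).1 - (p.1.1 k).1) t *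
        H (((p.1.1 (k + 1)).1 - t, p.1), p.2) :=
    Measurable.lintegral_prod_right
      (f := fun (p : ((ℕ → ℝ × ℕ) × (ℝ≥0 → ℕ)) × ((ℕ → ℝ × ℕ) × (ℝ≥0 → ℕ))) t =>
        window ((p.1.1 (k + 1)).1 - (p.1.1 k).1) t * H (((p.1.1 (k + 1)).1 - t, p.1), p.2))
      (by fun_prop)
  refine (lintegral_servicesPast_servicesFuture hlam hG n hg).trans (lintegral_congr fun c => ?_)
  set p := servicesPast n (services c)
  rw [lintegral_lintegral_swap (f := fun w t => window ((p.1 (k + 1)).1 - (p.1 k).1) t *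
    H (((p.1 (k + 1)).1 - t, p), w)) (Measurable.aemeasurable (by fun_prop))]
  exact lintegral_congr fun t => lintegral_const_mul _ (by fun_prop)

end Window

end AoI

end

/-! ### The Palm probability and the conclusions for the two systems. -/

noncomputable section

namespace AoI

section Palm

variable {lam : ℝ} {G : Measure ℝ} {Ω : Type*} [MeasurableSpace Ω] {P : Measure Ω}

lemma palm_congr {s s' : ℤ → Ω → ℝ} (h : ∀ᵐ ω ∂P, ∀ n, s n ω = s' n ω) : palm P s = palm P s' := by
  have h1 : ∀ m, {ω | s m ω ∈ Ioc 0 1} =ᵐ[P] {ω | s' m ω ∈ Ioc 0 1} := fun m => by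
    filter_upwards [h] with ω hω
    change (s m ω ∈ Ioc 0 1) = (s' m ω ∈ Ioc 0 1)
    rw [hω]
  unfold palm
  simp_rw [fun m => measure_congr (h1 m), fun m => Measure.restrict_congr_set (h1 m)]

/-- Lets statements that hold `P`-almost surely be used under the Palm probability. -/
lemma quasiMeasurePreserving_palm (s : ℤ → Ω → ℝ) :
    Measure.QuasiMeasurePreserving Prod.fst (palm P s) P := by
  refine ⟨measurable_fst, Measure.AbsolutelyContinuous.mk fun N hN h0 => ?_⟩
  have hm : ∀ m : ℤ, Measurable fun ω : Ω => (ω, m) := fun m => by fun_prop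
  rw [Measure.map_apply measurable_fst hN, palm, Measure.smul_apply,
    Measure.sum_apply _ (measurable_fst hN)]
  have h1 : ∀ m : ℤ, ((P.restrict {ω | s m ω ∈ Ioc 0 1}).map fun ω => (ω, m)) (Prod.fst ⁻¹' N)
      = 0 := fun m => by
    rw [Measure.map_apply (hm m) (measurable_fst hN)]
    exact measure_mono_null (fun ω hω => hω)
      (Measure.absolutelyContinuous_of_le Measure.restrict_le_self h0)
  simp only [h1, tsum_zero, smul_zero]

variable {Y : Ω → ℤ → ℝ × ℝ × ℝ}

/-- The services seen from the point at the origin of the Palm probability. -/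
def palmServices (Y : Ω → ℤ → ℝ × ℝ × ℝ) (p : Ω × ℤ) : ℤ → ℝ × ℝ × ℝ :=
  translate (dpt (Y p.1) p.2) (relabel p.2 (Y p.1))

lemma measurable_palmServices (hY : Measurable Y) : Measurable (palmServices Y) :=
  measurable_from_prod_countable_left fun k =>
    (by fun_prop : Measurable fun ω => translate (dpt (Y ω) k) (relabel k (Y ω)))

variable [IsProbabilityMeasure P]

/-- The intensity formula is now used with the end of service `0` as location: the indicator that it
lies in `(0, 1]` integrates to one over `t`, and only the i.i.d. marks remain. -/
theorem IsCycleFlow.map_palmServices (h : IsCycleFlow P Y lam G) (hlam : 0 < lam)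
    [IsProbabilityMeasure G] :
    (palm P fun n ω => dpt (Y ω) n).map (palmServices Y)
      = (Measure.infinitePi fun _ : ℤ => cycleLaw lam G).map services := by
  have := isProbabilityMeasure_cycleLaw hlam (G := G)
  obtain ⟨h0, htop, hφ⟩ := h.intensity_spec hlam
  have hY := h.measurable
  have hs := measurable_services
  have hI : Measurable ((Ioc (0 : ℝ) 1).indicator (1 : ℝ → ℝ≥0∞)) :=
    measurable_one.indicator measurableSet_Ioc
  have hS : ∀ m, MeasurableSet {ω | dpt (Y ω) m ∈ Ioc 0 1} := fun m =>
    (by fun_prop : Measurable fun ω => dpt (Y ω) m) measurableSet_Ioc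
  have hm : ∀ m : ℤ, Measurable fun ω : Ω => (ω, m) := fun m => by fun_prop
  have key : ∀ χ : (ℤ → ℝ × ℝ × ℝ) → ℝ≥0∞, Measurable χ →
      ∑' m : ℤ, ∫⁻ ω in {ω | dpt (Y ω) m ∈ Ioc 0 1}, χ (palmServices Y (ω, m)) ∂P
        = intensity lam G * ∫⁻ c, χ (services c)
          ∂(Measure.infinitePi fun _ : ℤ => cycleLaw lam G) := by
    intro χ hχ
    have h1 := hφ (fun y => (Ioc (0 : ℝ) 1).indicator (1 : ℝ → ℝ≥0∞) (dpt y 0) *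
      χ (translate (dpt y 0) y)) (by fun_prop)
    simp_rw [dpt_translate, translate_translate, sub_add_cancel, dpt_services_zero,
      translate_zero] at h1
    rw [lintegral_labelMeasure hY (by fun_prop), lintegral_tsum fun k => by fun_prop] at h1
    refine Eq.trans (tsum_congr fun m => ?_) (h1.trans ?_)
    · rw [← lintegral_indicator (hS m)]
      refine lintegral_congr fun ω => ?_
      rw [dpt_relabel, zero_add]
      by_cases hω : dpt (Y ω) m ∈ Ioc 0 1
      · rw [indicator_of_mem (s := {ω | dpt (Y ω) m ∈ Ioc 0 1}) hω, indicator_of_mem hω,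
          Pi.one_apply, one_mul]
        rfl
      · rw [indicator_of_notMem (s := {ω | dpt (Y ω) m ∈ Ioc 0 1}) hω, indicator_of_notMem hω,
          zero_mul]
    · congr 1
      refine lintegral_congr fun c => ?_
      rw [lintegral_mul_const _ (by fun_prop), lintegral_indicator_sub, one_mul]
  -- The normalising constant of `palm` is the case of a constant `χ`.
  have hmass : ∑' m : ℤ, P {ω | dpt (Y ω) m ∈ Ioc 0 1} = intensity lam G := by
    have h1 := key (fun _ => 1) measurable_const
    simp only [lintegral_one, measure_univ, mul_one, Measure.restrict_apply_univ] at h1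
    exact h1
  refine Measure.ext_of_lintegral _ fun χ hχ => ?_
  have hp := measurable_palmServices hY
  rw [lintegral_map hχ hp, lintegral_map hχ hs, palm, lintegral_smul_measure,
    lintegral_sum_measure, hmass]
  refine (congrArg _ ((tsum_congr fun m => lintegral_map (hχ.comp hp) (hm m)).trans
    (key χ hχ))).trans ?_
  rw [smul_eq_mul, ← mul_assoc, ENNReal.inv_mul_cancel h0 htop, one_mul]

lemma IsCycleFlow.isProbabilityMeasure_palm (h : IsCycleFlow P Y lam G) (hlam : 0 < lam)
    [IsProbabilityMeasure G] : IsProbabilityMeasure (palm P fun n ω => dpt (Y ω) n) := by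
  have := isProbabilityMeasure_cycleLaw hlam (G := G)
  have h1 := h.map_palmServices hlam
  have h2 : IsProbabilityMeasure ((palm P fun n ω => dpt (Y ω) n).map (palmServices Y)) := by
    rw [h1]
    exact Measure.isProbabilityMeasure_map measurable_services.aemeasurable
  refine ⟨?_⟩
  have h3 := h2.measure_univ
  rwa [Measure.map_apply (measurable_palmServices h.measurable) MeasurableSet.univ,
    preimage_univ] at h3

end Palm

section System

variable {lam : ℝ} {G : Measure ℝ} {Ω : Type*} [MeasurableSpace Ω] {P : Measure Ω}
  {X : Ω → MessageFlow} {b : Bool}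

lemma MessageFlow.Regular.S_eq {Ω : Type*} {X : Ω → MessageFlow} {ω : Ω} (h : (X ω).Regular b) (n : ℤ) :
    S X n ω = dpt (X ω).cyc n := by
  rw [S, h.isEnumeration.enumeration_eq]

lemma palm_S_eq (hr : ∀ᵐ ω ∂P, (X ω).Regular b) :
    palm P (S X) = palm P fun n ω => dpt (X ω).cyc n :=
  palm_congr (hr.mono fun _ h n => h.S_eq n)

lemma ae_palm_eq (hr : ∀ᵐ ω ∂P, (X ω).Regular b) :
    ∀ᵐ p ∂(palm P fun n ω => dpt (X ω).cyc n),
      (∀ n, palmPoints (S X) n p = dpt (palmServices (fun ω => (X ω).cyc) p) n) ∧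
      ∀ t, palmProcess (S X) (xi X) t p = num (palmServices (fun ω => (X ω).cyc) p) t := by
  filter_upwards [(quasiMeasurePreserving_palm _).ae hr] with p hp
  constructor
  · intro n
    rw [palmPoints, hp.S_eq, hp.S_eq, palmServices, dpt_translate, dpt_relabel, add_comm]
  · intro t
    rw [palmProcess, hp.S_eq, xi, hp.numInSystem_eq, palmServices, num_translate, num_relabel,
      add_comm]

variable [IsProbabilityMeasure P]

theorem IsStationarySystem.xiIsSemiMarkov (hlam : 0 < lam) [IsProbabilityMeasure G]
    (hG : G (Iic 0) = 0) (hX : IsStationarySystem P X lam G)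
    (hr : ∀ᵐ ω ∂P, (X ω).Regular b) : XiIsSemiMarkov P X (transition lam G) := by
  have hY := hX.isCycleFlow hlam hr
  have hYm := hY.measurable
  have hpr := hY.isProbabilityMeasure_palm hlam
  have := isMarkovKernel_transition hlam (G := G)
  refine ⟨?_, by rwa [palm_S_eq hr], ?_, ?_⟩
  · filter_upwards [hr] with ω h
    have : (fun n => S X n ω) = dpt (X ω).cyc := funext fun n => h.S_eq n
    rw [this]
    exact h.isEnumeration
  · rw [palm_S_eq hr]
    intro n
    set Z := palmServices fun ω => (X ω).cyc
    have hZ : Measurable Z := measurable_palmServices hYm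
    have hae : ∀ᵐ p ∂(palm P fun n ω => dpt (X ω).cyc n),
        past (palmPoints (S X)) (palmProcess (S X) (xi X)) n p = servicesPast n (Z p) ∧
        future (palmPoints (S X)) (palmProcess (S X) (xi X)) n p = servicesFuture n (Z p) := by
      filter_upwards [ae_palm_eq hr] with p ⟨h1, h2⟩
      simp only [past, future, servicesPast, servicesFuture, embedded, h1, h2]
      exact ⟨rfl, rfl⟩
    refine hasCondDistrib_of_lintegral
      ⟨fun p => servicesPast n (Z p), by fun_prop, hae.mono fun p h => h.1⟩
      ⟨fun p => servicesFuture n (Z p), by fun_prop, hae.mono fun p h => h.2⟩ fun H hH => ?_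
    have hF : Measurable fun p => ∫⁻ w, H (p, w) ∂(transition lam G (present p)) :=
      Measurable.lintegral_kernel_prod_right' (κ := (transition lam G).comap present
        measurable_present) hH
    have hF' : Measurable fun y => ∫⁻ w, H (servicesPast n y, w)
        ∂(transition lam G (present (servicesPast n y))) := hF.comp (measurable_servicesPast n)
    have h1 := lintegral_servicesPast_servicesFuture hlam hG n hH
    -- Both sides depend on the marks through `services` only, so the identity passes to the Palm
    -- probability by `IsCycleFlow.map_palmServices`.
    rw [← lintegral_map (f := fun y => H (servicesPast n y, servicesFuture n y)) (by fun_prop)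
      measurable_services, ← lintegral_map (f := fun y => ∫⁻ w, H (servicesPast n y, w)
      ∂(transition lam G (present (servicesPast n y)))) hF'
      measurable_services, ← hY.map_palmServices hlam, lintegral_map (by fun_prop) hZ,
      lintegral_map hF' hZ] at h1
    refine Eq.trans (lintegral_congr_ae (hae.mono fun p h => ?_)) (h1.trans
      (lintegral_congr_ae (hae.mono fun p h => ?_)))
    · simp only [h.1, h.2]
    · simp only [h.1, Kernel.comap_apply]
  · intro n hn
    have hae : ∀ᵐ ω ∂P, S X n ω = dpt (X ω).cyc n ∧
        past (S X) (xi X) n ω = servicesPast n (X ω).cyc ∧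
        future (S X) (xi X) n ω = servicesFuture n (X ω).cyc := by
      filter_upwards [hr] with ω h
      have h1 : ∀ t, xi X t ω = num (X ω).cyc t := fun t => h.numInSystem_eq t
      refine ⟨h.S_eq n, ?_, ?_⟩
      · simp only [past, servicesPast, embedded, h1, h.S_eq]
      · simp only [future, servicesFuture, embedded, h1, h.S_eq]
    refine hasCondDistrib_of_lintegral
      ⟨fun ω => (dpt (X ω).cyc n, servicesPast n (X ω).cyc), by fun_prop, hae.mono fun ω h =>
        Prod.ext h.1 h.2.1⟩
      ⟨fun ω => servicesFuture n (X ω).cyc, by fun_prop, hae.mono fun ω h => h.2.2⟩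
      fun H hH => ?_
    refine Eq.trans (lintegral_congr_ae (hae.mono fun ω h => ?_))
      ((hY.lintegral_after_zero hlam hG hn hH).trans
        (lintegral_congr_ae (hae.mono fun ω h => ?_)))
    · simp only [h.1, h.2.1, h.2.2]
    · simp only [h.1, h.2.1, Kernel.comap_apply, presentAt]

theorem IsStationarySystem.identDistrib_xi {Ω' : Type*} [MeasurableSpace Ω'] {P' : Measure Ω'}
    [IsProbabilityMeasure P'] {X' : Ω' → MessageFlow} {b' : Bool} (hlam : 0 < lam)
    [IsProbabilityMeasure G] (hX : IsStationarySystem P X lam G)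
    (hr : ∀ᵐ ω ∂P, (X ω).Regular b) (hX' : IsStationarySystem P' X' lam G)
    (hr' : ∀ᵐ ω ∂P', (X' ω).Regular b') :
    IdentDistrib (fun ω t => xi X t ω) (fun ω t => xi X' t ω) P P' := by
  have hY := hX.isCycleFlow hlam hr
  have hY' := hX'.isCycleFlow hlam hr'
  have hYm := hY.measurable
  have hYm' := hY'.measurable
  have hnum : Measurable fun (y : ℤ → ℝ × ℝ × ℝ) t => num y t := by fun_prop
  have h1 : (fun ω t => xi X t ω) =ᵐ[P] fun ω t => num (X ω).cyc t :=
    hr.mono fun ω h => funext fun t => h.numInSystem_eq t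
  have h2 : (fun ω t => xi X' t ω) =ᵐ[P'] fun ω t => num (X' ω).cyc t :=
    hr'.mono fun ω h => funext fun t => h.numInSystem_eq t
  refine ⟨⟨_, hnum.comp hYm, h1⟩, ⟨_, hnum.comp hYm', h2⟩, ?_⟩
  rw [Measure.map_congr h1, Measure.map_congr h2]
  refine (Measure.map_map hnum hYm).symm.trans (Eq.trans ?_ (Measure.map_map hnum hYm'))
  rw [hY.map_eq hY' hlam]

/-- Given the duration `σ`, no message arrives during the service with probability `exp (-(lam *
σ))`. -/
lemma cycleLaw_lt (hlam : 0 < lam) [IsProbabilityMeasure G] (hG : G (Iic 0) = 0) :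
    (cycleLaw lam G).real {q | ¬ q.1 ≤ q.2} = laplace G lam := by
  have := isProbabilityMeasure_expMeasure hlam
  have hG' : ∀ᵐ σ ∂G, 0 < σ := by rw [ae_iff]; simpa [Iic, not_lt] using hG
  have hS : MeasurableSet {q : ℝ × ℝ | ¬ q.1 ≤ q.2} :=
    (measurableSet_le measurable_fst measurable_snd).compl
  have hL : laplace G lam = ∫ x, Real.exp (-lam * x) ∂G := by
    have h1 : G.restrict (Ioi 0) = G := Measure.restrict_eq_self_of_ae_mem hG'
    rw [laplace, h1]
  rw [hL, integral_eq_lintegral_of_nonneg_ae (Eventually.of_forall fun x => (Real.exp_pos _).le)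
    (by fun_prop), measureReal_def, cycleLaw, Measure.prod_apply_symm hS]
  congr 1
  refine lintegral_congr_ae (hG'.mono fun σ hσ => ?_)
  have : (fun x => (x, σ)) ⁻¹' {q : ℝ × ℝ | ¬ q.1 ≤ q.2} = Ioi σ := by
    ext x; simp
  simp only [this]
  rw [expMeasure_Ioi hlam hσ.le, neg_mul]

/-- Under the Palm probability `K X n` is almost surely the function `β` of mark `n`, and these
marks are i.i.d. -/
theorem IsStationarySystem.embeddedIsBernoulli (hlam : 0 < lam) [IsProbabilityMeasure G]
    (hG : G (Iic 0) = 0) (hX : IsStationarySystem P X lam G)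
    (hr : ∀ᵐ ω ∂P, (X ω).Regular b) : EmbeddedIsBernoulli P X (laplace G lam) := by
  have hY := hX.isCycleFlow hlam hr
  have hYm := hY.measurable
  have hpr := hY.isProbabilityMeasure_palm hlam
  have := isProbabilityMeasure_cycleLaw hlam (G := G)
  set Q := palm P fun n ω => dpt (X ω).cyc n with hQ
  have hSQ : palm P (S X) = Q := palm_S_eq hr
  set Z := palmServices fun ω => (X ω).cyc with hZdef
  have hZ : Measurable Z := measurable_palmServices hYm
  have hK : ∀ᵐ p ∂Q, ∀ n, K X n p = num (Z p) (dpt (Z p) n) := by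
    filter_upwards [ae_palm_eq hr] with p ⟨h1, h2⟩ n
    rw [K, embedded, h2, h1]
  let β : ℝ × ℝ → ℕ := fun q => if q.1 ≤ q.2 then 1 else 0
  have hβ : Measurable β :=
    Measurable.ite (measurableSet_le measurable_fst measurable_snd) measurable_const
      measurable_const
  have hν := Measure.isProbabilityMeasure_map (μ := cycleLaw lam G) hβ.aemeasurable
  have hk : Measurable fun (y : ℤ → ℝ × ℝ × ℝ) n => num y (dpt y n) := by fun_prop
  have hlaw : Q.map (fun p n => num (Z p) (dpt (Z p) n))
      = Measure.infinitePi fun _ : ℤ => (cycleLaw lam G).map β := by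
    rw [← Measure.infinitePi_map_pi (μ := fun _ : ℤ => cycleLaw lam G) (f := fun _ => β)
      fun _ => hβ]
    refine (Measure.map_map hk hZ).symm.trans ?_
    rw [hY.map_palmServices hlam, Measure.map_map hk measurable_services]
    refine Measure.map_congr ?_
    filter_upwards [ae_posMark_infinitePi hlam hG (ι := ℤ)] with c hc
    funext n
    simp only [Function.comp_apply]
    rw [num_services_dpt, num_services_zero fun i => hc (i + n), zero_add]
  have hmarg : ∀ n, Q.map (fun p => num (Z p) (dpt (Z p) n)) = (cycleLaw lam G).map β := by
    intro n
    rw [← Measure.infinitePi_map_eval (fun _ : ℤ => (cycleLaw lam G).map β) n, ← hlaw,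
      Measure.map_map (measurable_pi_apply n) (by fun_prop)]
    rfl
  have hval : ∀ (n : ℤ) (k : ℕ), Q.real {p | K X n p = k} = (cycleLaw lam G).real {q | β q = k} := by
    intro n k
    have h1 : {p | K X n p = k} =ᵐ[Q] {p | num (Z p) (dpt (Z p) n) = k} := by
      filter_upwards [hK] with p hp
      change (K X n p = k) = (num (Z p) (dpt (Z p) n) = k)
      rw [hp]
    rw [measureReal_congr h1, measureReal_def, measureReal_def]
    congr 1
    have h2 := congrArg (fun ν => ν {k}) (hmarg n)
    rwa [Measure.map_apply (by fun_prop) (measurableSet_singleton k),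
      Measure.map_apply hβ (measurableSet_singleton k)] at h2
  have hzero : (cycleLaw lam G).real {q | β q = 0} = laplace G lam := by
    rw [← cycleLaw_lt hlam hG]
    congr 1
    ext q
    simp [β]
  refine ⟨?_, fun n => ?_, fun n => ?_⟩
  · rw [hSQ]
    have h1 : iIndepFun (fun n p => num (Z p) (dpt (Z p) n)) Q := by
      rw [iIndepFun_iff_map_fun_eq_infinitePi_map fun n => by fun_prop, hlaw]
      congr 1
      funext n
      exact (hmarg n).symm
    exact h1.congr fun n => hK.mono fun p hp => (hp n).symm
  · rw [hSQ, hval n 0]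
    exact hzero
  · rw [hSQ, hval n 1, ← hzero]
    refine Eq.trans ?_ (probReal_compl_eq_one_sub (hβ (measurableSet_singleton 0)))
    congr 1
    ext q
    simp [β]

end System

end AoI

end

theorem mainTheorem9 {lam : ℝ} (hlam : 0 < lam)
    (G : Measure ℝ) [IsProbabilityMeasure G] (hG : G (Iic 0) = 0) (hGmean : Integrable id G)
    {Ω₁ : Type*} [MeasurableSpace Ω₁] (P₁ : Measure Ω₁) [IsProbabilityMeasure P₁]
    (B : Ω₁ → AoI.MessageFlow) (hB : AoI.IsStationarySystem P₁ B lam G)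
    (hB2 : ∀ᵐ ω ∂P₁, (B ω).IsB2)
    {Ω₂ : Type*} [MeasurableSpace Ω₂] (P₂ : Measure Ω₂) [IsProbabilityMeasure P₂]
    (R : Ω₂ → AoI.MessageFlow) (hR : AoI.IsStationarySystem P₂ R lam G)
    (hP2 : ∀ᵐ ω ∂P₂, (R ω).IsP2) :
    (∃ κ : Kernel ℕ ((ℕ → ℝ × ℕ) × (ℝ≥0 → ℕ)), IsMarkovKernel κ ∧
      AoI.XiIsSemiMarkov P₁ B κ ∧ AoI.XiIsSemiMarkov P₂ R κ) ∧
    IdentDistrib (fun ω t => AoI.xi B t ω) (fun ω t => AoI.xi R t ω) P₁ P₂ ∧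
    AoI.EmbeddedIsBernoulli P₁ B (AoI.laplace G lam) ∧
    AoI.EmbeddedIsBernoulli P₂ R (AoI.laplace G lam) := by
  have h1 : ∀ᵐ ω ∂P₁, (B ω).Regular true := by
    filter_upwards [hB.input.isInput, hB2] with ω h h' using AoI.MessageFlow.IsB2.regular h h'
  have h2 : ∀ᵐ ω ∂P₂, (R ω).Regular false := by
    filter_upwards [hR.input.isInput, hP2] with ω h h' using AoI.MessageFlow.IsP2.regular h h'
  exact ⟨⟨AoI.transition lam G, AoI.isMarkovKernel_transition hlam,
    hB.xiIsSemiMarkov hlam hG h1, hR.xiIsSemiMarkov hlam hG h2⟩,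
    hB.identDistrib_xi hlam h1 hR h2, hB.embeddedIsBernoulli hlam hG h1,
    hR.embeddedIsBernoulli hlam hG h2⟩
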